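/- Let $\xi_0,\xi_1,\dots$ be i.i.d. complex-valued, non-degenerate (not almost surely constant) random variables with $\mathbb E\log(1+|\xi_0|)<\infty$. Let $a_{k;n}$ ($n\in\mathbb N$, $0\le k\le n$) be deterministic complex numbers for which there is a continuous concave function $g:[0,1]\to\mathbb R$ with finite left derivative at $1$, $g'_-(1)>-\infty$, such that $$\lim_{n\to\infty}\ \sup_{0\le k\le n}\Big|\tfrac1n\log|a_{k;n}|-g\big(\tfrac kn\big)\Big|=0,\qquad \log 0:=-\infty .$$ Put $P_n(z)=\sum_{k=0}^n\xi_k a_{k;n}z^k$. For a non-constant polynomial $P$ let $[\![P]\!]=\frac1{\deg P}\sum_{z:P(z)=0}\delta_z$, with zeros counted with multiplicity, and let $[\![P]\!]=0$ if $P$ is constant. Let $t>0$ and let $\nu_t$ be the limiting zero distribution at time $t$, that is, the (existing and unique) deterministic probability measure on $\mathbb C$ to which $$\Big[\!\!\Big[\exp\Big\{-\frac t{2n}\partial_z^2\Big\}P_n\Big]\!\!\Big],\qquad \exp\Big\{-\frac s2\partial_z^2\Big\}P:=\sum_{j\ge0}\frac1{j!}\Big(-\frac s2\Big)^j\partial_z^{2j}P,$$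 converges weakly in probability as $n\to\infty$ (that is, integrals of every bounded continuous function $\mathbb C\to\mathbb R$ converge in probability). Let $\mathsf{sc}_t$ be the semicircle distribution of variance $t$, with density $\frac{1}{2\pi t}\sqrt{4t-x^2}$ on $[-2\sqrt t,2\sqrt t]\subset\mathbb R\subset\mathbb C$. Then $$t_{\mathrm{Wig}}:=\sup_{\alpha\in(0,1)}\exp\Big(2\cdot\frac{g(\alpha)-g(1)}{1-\alpha}+\frac{\alpha}{1-\alpha}\log\alpha+1\Big)$$ is finite, and $\nu_t=\mathsf{sc}_t$ if and only if $t\ge t_{\mathrm{Wig}}$. If $0<t<t_{\mathrm{Wig}}$, then $\nu_t$ is not concentrated on the real line, i.e. $\nu_t(\mathbb C\setminus\mathbb R)>0$. -/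

import Mathlib

open MeasureTheory ProbabilityTheory Filter Topology Polynomial
open scoped ENNReal BoundedContinuousFunction

namespace HeatZeros

noncomputable section

/-- The heat-flow operator `exp(-(s/2) ∂_z²)` on complex polynomials, as the terminating series
`∑_j (1/j!) (-s/2)^j ∂_z^{2j} p`. All terms with `2 * j > p.natDegree` vanish. -/
def heatFlow (s : ℂ) (p : ℂ[X]) : ℂ[X] :=
  ∑ j ∈ Finset.range (p.natDegree + 1),
    C ((1 / (j.factorial : ℂ)) * (-s / 2) ^ j) * derivative^[2 * j] p

/-- The empirical distribution of the complex zeros of `p`: each zero, counted with multiplicity,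
gets weight `1 / deg p`. It is the zero measure when `p` is constant (there are no roots in the
multiset `p.roots` then). -/
def zeroDistribution (p : ℂ[X]) : Measure ℂ :=
  (p.natDegree : ℝ≥0∞)⁻¹ • (p.roots.map fun z => Measure.dirac z).sum

/-- The random polynomial `P_n(z) = ∑_{k=0}^n ξ_k a_{k;n} z^k`, with `a n k` for `a_{k;n}`. -/
def randomPoly {Ω : Type*} (ξ : ℕ → Ω → ℂ) (a : ℕ → ℕ → ℂ) (n : ℕ) (ω : Ω) : ℂ[X] :=
  ∑ k ∈ Finset.range (n + 1), C (ξ k ω * a n k) * X ^ k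

/-- `ξ_0, ξ_1, …` are i.i.d., non-degenerate complex random variables with
`𝔼 log (1 + |ξ_0|) < ∞`. -/
structure IsAdmissibleNoise {Ω : Type*} [MeasurableSpace Ω] (P : Measure Ω)
    (ξ : ℕ → Ω → ℂ) : Prop where
  measurable : ∀ k, Measurable (ξ k)
  indep : iIndepFun ξ P
  identDistrib : ∀ k, IdentDistrib (ξ k) (ξ 0) P P
  nondegenerate : ¬ ∃ c : ℂ, ∀ᵐ ω ∂P, ξ 0 ω = c
  integrable_log : Integrable (fun ω => Real.log (1 + ‖ξ 0 ω‖)) P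

/-- The deterministic coefficients `a_{k;n}` have exponential profile `g`, i.e.
`sup_{0 ≤ k ≤ n} |(1/n) log |a_{k;n}| - g(k/n)| → 0`, where `g` is continuous and concave on
`[0, 1]` with finite left derivative at `1`. As `log 0 = -∞` in this condition, it forces
`a_{k;n} ≠ 0` for all `k ≤ n` once `n` is large. -/
structure HasExponentialProfile (a : ℕ → ℕ → ℂ) (g : ℝ → ℝ) : Prop where
  continuousOn : ContinuousOn g (Set.Icc 0 1)
  concaveOn : ConcaveOn ℝ (Set.Icc 0 1) g
  leftDeriv_one : DifferentiableWithinAt ℝ g (Set.Iio 1) 1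
  profile : ∀ ε : ℝ, 0 < ε → ∀ᶠ n : ℕ in atTop, ∀ k ≤ n,
    a n k ≠ 0 ∧ |1 / (n : ℝ) * Real.log ‖a n k‖ - g ((k : ℝ) / n)| ≤ ε

/-- The random measures `μ_n` converge weakly to the deterministic measure `ν` in probability:
`∫ f dμ_n → ∫ f dν` in probability for every bounded continuous `f : ℂ → ℝ`. -/
def TendstoWeaklyInProbability {Ω : Type*} [MeasurableSpace Ω] (P : Measure Ω)
    (μ : ℕ → Ω → Measure ℂ) (ν : Measure ℂ) : Prop :=
  ∀ f : ℂ →ᵇ ℝ,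
    TendstoInMeasure P (fun n ω => ∫ z, f z ∂(μ n ω)) atTop (fun _ => ∫ z, f z ∂ν)

/-- `ν` is the limiting zero distribution at time `t` of the random polynomials `P_n`: the limit,
weakly in probability, of the empirical zero distributions of `exp(-(t/(2n)) ∂_z²) P_n`. -/
def IsLimitingZeroDistribution {Ω : Type*} [MeasurableSpace Ω] (P : Measure Ω)
    (ξ : ℕ → Ω → ℂ) (a : ℕ → ℕ → ℂ) (t : ℝ) (ν : ProbabilityMeasure ℂ) : Prop :=
  TendstoWeaklyInProbability P
    (fun n ω => zeroDistribution (heatFlow ((t : ℂ) / (n : ℂ)) (randomPoly ξ a n ω)))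
    (ν : Measure ℂ)

/-- The semicircle distribution of variance `t > 0`, as a measure on `ℂ` carried by the real line:
it has density `√(4t - x²) / (2πt)` on `[-2√t, 2√t]`. -/
def semicircle (t : ℝ) : Measure ℂ :=
  Measure.map (fun x : ℝ => (x : ℂ))
    ((volume.restrict (Set.Icc (-2 * √t) (2 * √t))).withDensity fun x =>
      ENNReal.ofReal (√(4 * t - x ^ 2) / (2 * Real.pi * t)))

/-- The expression whose supremum over `α ∈ (0, 1)` is the collapse time. -/
def wignerTimeFun (g : ℝ → ℝ) (α : ℝ) : ℝ :=
  Real.exp (2 * ((g α - g 1) / (1 - α)) + α / (1 - α) * Real.log α + 1)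

/-- The collapse time `t_Wig`. -/
def wignerTime (g : ℝ → ℝ) : ℝ := sSup (wignerTimeFun g '' Set.Ioo 0 1)

end

end HeatZeros

/-!
The heat flow maps `z ^ k` to a rescaled Hermite polynomial, whose `n`-th root asymptotics off the
real line identify the `n`-th root of the modulus of the `k`-th summand of the evolved polynomial
at `z` as `exp (g α + hermitePot t α z)` with `α = k / n`. Hence `(1 / n) log |P|` is
asymptotically at most `limitPot t g z`, the maximum over `α ∈ [0, 1]` of the exponents, and it is
not smaller because the many near-maximal summands are independent and non-degenerate, so that
their sum is exponentially small only with vanishing probability (Littlewood–Offord). Convergence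
of the logarithmic potentials forces the zero distributions to converge to the Riesz measure of
`limitPot t g`.

The semicircle distribution has potential `hermitePot t 1` up to a constant. So the limit is the
semicircle distribution as soon as the maximum is attained at `α = 1` for every `z`, and this is
what `wignerTime g ≤ t` means. If `t < wignerTime g`, then `limitPot t g` exceeds
`g 1 + hermitePot t 1` somewhere in the upper half-plane, while the finite left derivative of `g`
at `1` makes the two agree for `z` far up the imaginary axis. If the limit were carried by the real
line, both functions would be harmonic in the upper half-plane, contradicting the minimum principle
for their difference.
-/

namespace HeatZeros

noncomputable section

/-! ### The truncated logarithmic kernel -/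

section Kernel

variable {E : Type*} [NormedAddCommGroup E] {r s : ℝ}

/-- The logarithmic kernel `log ‖w‖`, truncated at radius `r` so that it is continuous at `0`. -/
def logKer (r : ℝ) (w : E) : ℝ := Real.log (max r ‖w‖)

/-- The kernel `logKer r` centred at `z` and renormalised at infinity, so that it is bounded in the
second variable and can be integrated against every finite measure. -/
def regKer (r : ℝ) (z w : E) : ℝ := logKer r (z - w) - logKer 1 w

lemma continuous_logKer (hr : 0 < r) : Continuous (logKer r : E → ℝ) :=
  (continuous_const.max continuous_norm).log fun _ => (lt_max_of_lt_left hr).ne'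

lemma logKer_of_le {w : E} (h : r ≤ ‖w‖) : logKer r w = Real.log ‖w‖ := by
  rw [logKer, max_eq_right h]

lemma logKer_of_ge {w : E} (h : ‖w‖ ≤ r) : logKer r w = Real.log r := by
  rw [logKer, max_eq_left h]

lemma logKer_mono (hr : 0 < r) (h : r ≤ s) (w : E) : logKer r w ≤ logKer s w :=
  Real.log_le_log (lt_max_of_lt_left hr) (max_le_max_right _ h)

lemma logKer_neg (r : ℝ) (w : E) : logKer r (-w) = logKer r w := by rw [logKer, norm_neg, logKer]

lemma log_norm_le_logKer {w : E} (hw : w ≠ 0) : Real.log ‖w‖ ≤ logKer r w :=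
  Real.log_le_log (norm_pos_iff.2 hw) (le_max_right _ _)

lemma logKer_sub_logKer_le (hr : 0 < r) (h : r ≤ s) (w : E) :
    logKer s w - logKer r w ≤ Real.log s - Real.log r := by
  rcases le_total ‖w‖ s with hw | hw
  · rw [logKer_of_ge hw]
    gcongr
    exact Real.log_le_log hr (le_max_left _ _)
  · rw [logKer_of_le hw, logKer_of_le (h.trans hw), sub_self]
    exact sub_nonneg.2 (Real.log_le_log hr h)

lemma abs_logKer_sub_logKer_one_le (hr : 0 < r) (w : E) :
    |logKer r w - logKer 1 w| ≤ |Real.log r| := by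
  rcases le_total r 1 with h | h
  · rw [abs_sub_comm, abs_of_nonneg (sub_nonneg.2 (logKer_mono hr h w))]
    refine (logKer_sub_logKer_le hr h w).trans ?_
    rw [Real.log_one, zero_sub]
    exact neg_le_abs _
  · rw [abs_of_nonneg (sub_nonneg.2 (logKer_mono one_pos h w))]
    refine (logKer_sub_logKer_le one_pos h w).trans ?_
    rw [Real.log_one, sub_zero]
    exact le_abs_self _

lemma abs_log_sub_log_le {x y : ℝ} (hr : 0 < r) (hx : r ≤ x) (hy : r ≤ y) :
    |Real.log x - Real.log y| ≤ |x - y| / r := by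
  wlog hxy : y ≤ x generalizing x y
  · rw [abs_sub_comm, abs_sub_comm x]
    exact this hy hx (le_of_not_ge hxy)
  have hy0 : 0 < y := hr.trans_le hy
  have hx0 : 0 < x := hr.trans_le hx
  rw [abs_of_nonneg (sub_nonneg.2 (Real.log_le_log hy0 hxy)), abs_of_nonneg (sub_nonneg.2 hxy)]
  calc Real.log x - Real.log y = Real.log (x / y) := (Real.log_div hx0.ne' hy0.ne').symm
    _ ≤ x / y - 1 := Real.log_le_sub_one_of_pos (div_pos hx0 hy0)
    _ = (x - y) / y := by rw [sub_div, div_self hy0.ne']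
    _ ≤ (x - y) / r := div_le_div_of_nonneg_left (sub_nonneg.2 hxy) hr hy

lemma abs_logKer_sub_le (hr : 0 < r) (v w : E) : |logKer r v - logKer r w| ≤ ‖v - w‖ / r := by
  refine (abs_log_sub_log_le hr (le_max_left _ _) (le_max_left _ _)).trans ?_
  gcongr
  refine (abs_max_sub_max_le_max _ _ _ _).trans ?_
  rw [sub_self, abs_zero]
  exact max_le (norm_nonneg _) (abs_norm_sub_norm_le v w)

lemma abs_regKer_sub_le (hr : 0 < r) (z z' w : E) :
    |regKer r z w - regKer r z' w| ≤ ‖z - z'‖ / r := by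
  simpa [regKer] using abs_logKer_sub_le hr (z - w) (z' - w)

lemma abs_regKer_le (hr : 0 < r) (z w : E) : |regKer r z w| ≤ ‖z‖ / r + |Real.log r| := by
  calc |regKer r z w|
      = |(logKer r (z - w) - logKer r (-w)) + (logKer r w - logKer 1 w)| := by
        rw [regKer, logKer_neg, sub_add_sub_cancel]
    _ ≤ ‖z - w - -w‖ / r + |Real.log r| :=
        (abs_add_le _ _).trans
          (add_le_add (abs_logKer_sub_le hr _ _) (abs_logKer_sub_logKer_one_le hr w))
    _ = ‖z‖ / r + |Real.log r| := by rw [sub_neg_eq_add, sub_add_cancel]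

lemma continuous_regKer (hr : 0 < r) : Continuous fun p : E × E => regKer r p.1 p.2 :=
  ((continuous_logKer hr).comp (continuous_fst.sub continuous_snd)).sub
    ((continuous_logKer one_pos).comp continuous_snd)

lemma continuous_regKer_right (hr : 0 < r) (z : E) : Continuous (regKer r z) :=
  (continuous_regKer hr).comp (Continuous.prodMk_right z)

/-- `regKer r z` as a bounded continuous function, to be tested against weak convergence. -/
def regKerBCF (hr : 0 < r) (z : E) : E →ᵇ ℝ :=
  BoundedContinuousFunction.ofNormedAddCommGroup (regKer r z) (continuous_regKer_right hr z)
    (‖z‖ / r + |Real.log r|) (abs_regKer_le hr z)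

lemma regKer_zero_nonneg {ρ : ℝ} (hρ : 1 ≤ ρ) (w : E) : 0 ≤ regKer ρ 0 w := by
  rw [regKer, zero_sub, logKer_neg]
  exact sub_nonneg.2 (logKer_mono one_pos hρ w)

lemma regKer_zero_le_indicator {ρ : ℝ} (hρ : 1 ≤ ρ) (w : E) :
    regKer ρ 0 w ≤ (Metric.closedBall 0 ρ).indicator (fun _ => Real.log ρ) w := by
  rw [regKer, zero_sub, logKer_neg]
  by_cases h : ‖w‖ ≤ ρ
  · rw [Set.indicator_of_mem (mem_closedBall_zero_iff.2 h), logKer_of_ge h, sub_le_self_iff]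
    exact Real.log_nonneg (le_max_left _ _)
  · have h' := (not_le.1 h).le
    rw [Set.indicator_of_notMem (mt mem_closedBall_zero_iff.1 h), logKer_of_le h',
      logKer_of_le (hρ.trans h'), sub_self]

lemma tendsto_logKer {w : E} (hw : w ≠ 0) : Tendsto (fun r => logKer r w) (𝓝 0)
    (𝓝 (Real.log ‖w‖)) := by
  refine tendsto_const_nhds.congr' ?_
  filter_upwards [eventually_lt_nhds (norm_pos_iff.2 hw)] with r hr
  rw [logKer_of_le hr.le]

lemma tendsto_logKer_slope (hr : 0 < r) (w : E) :
    Tendsto (fun s => (logKer s w - logKer r w) / (Real.log s - Real.log r)) (𝓝[>] r)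
      (𝓝 ((Metric.closedBall 0 r).indicator 1 w)) := by
  refine tendsto_const_nhds.congr' ?_
  by_cases hw : ‖w‖ ≤ r
  · filter_upwards [self_mem_nhdsWithin] with s (hs : r < s)
    rw [Set.indicator_of_mem (mem_closedBall_zero_iff.2 hw), logKer_of_ge hw,
      logKer_of_ge (hw.trans hs.le), div_self (sub_pos.2 (Real.log_lt_log hr hs)).ne', Pi.one_apply]
  · filter_upwards [nhdsWithin_le_nhds (eventually_lt_nhds (not_le.1 hw))] with s hs
    rw [Set.indicator_of_notMem (mt mem_closedBall_zero_iff.1 hw), logKer_of_le hs.le,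
      logKer_of_le (not_le.1 hw).le, sub_self, zero_div]

end Kernel

/-! ### Truncated potentials determine a measure -/

section Potential

variable {E : Type*} [NormedAddCommGroup E] [MeasurableSpace E] {ν : Measure E} {r s : ℝ}

/-- The logarithmic potential of `ν`, with the truncated and renormalised kernel `regKer r`. -/
def truncPotential (ν : Measure E) (r : ℝ) (z : E) : ℝ := ∫ w, regKer r z w ∂ν

lemma truncPotential_zero_nonneg (ν : Measure E) {ρ : ℝ} (hρ : 1 ≤ ρ) :
    0 ≤ truncPotential ν ρ 0 :=
  integral_nonneg (regKer_zero_nonneg hρ)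

variable [OpensMeasurableSpace E]

lemma integrable_regKer (ν : Measure E) [IsFiniteMeasure ν] (hr : 0 < r) (z : E) :
    Integrable (regKer r z) ν :=
  Integrable.of_bound (continuous_regKer_right hr z).aestronglyMeasurable _
    (ae_of_all _ (abs_regKer_le hr z))

lemma truncPotential_mono (ν : Measure E) [IsFiniteMeasure ν] (hr : 0 < r) (h : r ≤ s) (z : E) :
    truncPotential ν r z ≤ truncPotential ν s z :=
  integral_mono (integrable_regKer ν hr z) (integrable_regKer ν (hr.trans_le h) z) fun _ =>
    sub_le_sub_right (logKer_mono hr h _) _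

lemma abs_truncPotential_sub_le (ν : Measure E) [IsFiniteMeasure ν] (hr : 0 < r) (z z' : E) :
    |truncPotential ν r z - truncPotential ν r z'| ≤ ‖z - z'‖ / r * ν.real Set.univ := by
  unfold truncPotential
  rw [← integral_sub (integrable_regKer ν hr z) (integrable_regKer ν hr z'), ← Real.norm_eq_abs]
  exact norm_integral_le_of_norm_le_const (ae_of_all _ (abs_regKer_sub_le hr z z'))

lemma truncPotential_zero_le (ν : Measure E) [IsFiniteMeasure ν] {ρ : ℝ} (hρ : 1 ≤ ρ) :
    truncPotential ν ρ 0 ≤ ν.real (Metric.closedBall 0 ρ) * Real.log ρ := by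
  have hball : MeasurableSet (Metric.closedBall (0 : E) ρ) :=
    Metric.isClosed_closedBall.measurableSet
  refine (integral_mono (integrable_regKer ν (one_pos.trans_le hρ) 0)
    ((integrable_const _).indicator hball) (regKer_zero_le_indicator hρ)).trans_eq ?_
  rw [integral_indicator_const _ hball, smul_eq_mul]

lemma continuous_truncPotential (ν : Measure E) [IsFiniteMeasure ν] (hr : 0 < r) :
    Continuous (truncPotential ν r) :=
  (LipschitzWith.of_dist_le' (K := ν.real Set.univ / r) fun z z' => by
    rw [Real.dist_eq, dist_eq_norm, div_mul_eq_mul_div, mul_comm, ← div_mul_eq_mul_div]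
    exact abs_truncPotential_sub_le ν hr z z').continuous

lemma tendsto_truncPotential_slope (ν : Measure E) [IsFiniteMeasure ν] (hr : 0 < r) (z : E) :
    Tendsto (fun s => (truncPotential ν s z - truncPotential ν r z) / (Real.log s - Real.log r))
      (𝓝[>] r) (𝓝 (ν.real (Metric.closedBall z r))) := by
  have hint : ∀ s, r < s → (truncPotential ν s z - truncPotential ν r z) /
      (Real.log s - Real.log r) =
        ∫ w, (logKer s (z - w) - logKer r (z - w)) / (Real.log s - Real.log r) ∂ν := fun s hs => by
    rw [integral_div, truncPotential, truncPotential,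
      ← integral_sub (integrable_regKer ν (hr.trans hs) z) (integrable_regKer ν hr z)]
    simp only [regKer, sub_sub_sub_cancel_right]
  have hball : ν.real (Metric.closedBall z r) =
      ∫ w, (Metric.closedBall (0 : E) r).indicator 1 (z - w) ∂ν := by
    rw [← integral_indicator_one Metric.isClosed_closedBall.measurableSet]
    refine integral_congr_ae (ae_of_all _ fun w => ?_)
    simp only [Set.indicator, Metric.mem_closedBall, dist_eq_norm', zero_sub, norm_neg]
    rfl
  rw [hball]
  refine Tendsto.congr' (eventually_nhdsWithin_of_forall fun s hs => (hint s hs).symm) ?_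
  refine tendsto_integral_filter_of_dominated_convergence (fun _ => 1)
    (eventually_nhdsWithin_of_forall fun s hs => ?_)
    (eventually_nhdsWithin_of_forall fun s hs => ae_of_all _ fun w => ?_) (integrable_const _)
    (ae_of_all _ fun w => tendsto_logKer_slope hr (z - w))
  · have hsub := continuous_sub_left z
    exact ((((continuous_logKer (hr.trans hs)).comp hsub).sub
      ((continuous_logKer hr).comp hsub)).div_const _).aestronglyMeasurable
  · have hlog : 0 < Real.log s - Real.log r := sub_pos.2 (Real.log_lt_log hr hs)
    rw [Real.norm_of_nonneg (div_nonneg (sub_nonneg.2 (logKer_mono hr hs.le _)) hlog.le)]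
    exact (div_le_one hlog).2 (logKer_sub_logKer_le hr hs.le _)

end Potential

lemma le_of_closedBall_eq {α : Type*} [MetricSpace α] [MeasurableSpace α] [BorelSpace α]
    [SecondCountableTopology α] [HasBesicovitchCovering α] {μ ν : Measure α}
    [IsLocallyFiniteMeasure μ] [IsLocallyFiniteMeasure ν]
    (h : ∀ x r, 0 < r → μ (Metric.closedBall x r) = ν (Metric.closedBall x r)) : μ ≤ ν := by
  have hone : ν.rnDeriv μ =ᵐ[μ] fun _ => 1 := by
    filter_upwards [Besicovitch.ae_tendsto_rnDeriv ν μ, Besicovitch.ae_tendsto_rnDeriv μ μ,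
      Measure.rnDeriv_self μ] with x hν hμ hx
    rw [← hx]
    refine tendsto_nhds_unique hν (hμ.congr' (eventually_nhdsWithin_of_forall fun r hr => ?_))
    simp only [h x r hr]
  calc μ = μ.withDensity (fun _ => 1) := by simp
    _ = μ.withDensity (ν.rnDeriv μ) := (withDensity_congr_ae hone).symm
    _ ≤ ν := Measure.withDensity_rnDeriv_le ν μ

/-- `ν` is the Riesz measure of the potential `U`, normalised by the constant `L`. The relation is
expressed through circle averages, so that neither pointwise values of the potential of `ν` nor
distributional Laplacians occur. -/
def IsRieszMeasure (U : ℂ → ℝ) (ν : Measure ℂ) (L : ℝ) : Prop :=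
  ∀ z R, 0 < R → Real.circleAverage U z R = L + truncPotential ν R z

theorem IsRieszMeasure.unique {U : ℂ → ℝ} {μ ν : Measure ℂ} [IsFiniteMeasure μ]
    [IsFiniteMeasure ν] {L L' : ℝ} (hμ : IsRieszMeasure U μ L) (hν : IsRieszMeasure U ν L') :
    μ = ν := by
  have hball : ∀ z R, 0 < R → μ (Metric.closedBall z R) = ν (Metric.closedBall z R) := by
    intro z R hR
    rw [← measureReal_eq_measureReal_iff]
    refine tendsto_nhds_unique (tendsto_truncPotential_slope μ hR z)
      ((tendsto_truncPotential_slope ν hR z).congr'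
        (eventually_nhdsWithin_of_forall fun s (hs : R < s) => ?_))
    congr 1
    linarith [hμ z R hR, hν z R hR, hμ z s (hR.trans hs), hν z s (hR.trans hs)]
  exact le_antisymm (le_of_closedBall_eq hball)
    (le_of_closedBall_eq fun z R hR => (hball z R hR).symm)

lemma IsRieszMeasure.const_add {U : ℂ → ℝ} (hU : Continuous U) {ν : Measure ℂ} {L : ℝ}
    (h : IsRieszMeasure U ν L) (c : ℝ) : IsRieszMeasure (fun z => c + U z) ν (c + L) := by
  intro z R hR
  rw [Real.circleAverage_fun_add (circleIntegrable_const _ _ _) hU.continuousOn.circleIntegrable',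
    Real.circleAverage_const, h z R hR, add_assoc]

/-! ### Limits of circle averages -/

lemma ae_circleMap_notMem {S : Set ℂ} (hS : S.Countable) (z : ℂ) {R : ℝ} (hR : R ≠ 0) :
    ∀ᵐ θ : ℝ, circleMap z R θ ∉ S :=
  (hS.preimage_circleMap z hR).ae_notMem volume

section CircleLimits

variable {f : ℕ → ℂ → ℝ} {F : ℂ → ℝ} {z : ℂ} {R : ℝ}

lemma circleAverage_congr_ae {f g : ℂ → ℝ}
    (h : ∀ᵐ θ : ℝ, f (circleMap z R θ) = g (circleMap z R θ)) :
    Real.circleAverage f z R = Real.circleAverage g z R := by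
  unfold Real.circleAverage
  rw [intervalIntegral.integral_congr_ae (h.mono fun _ hθ _ => hθ)]

lemma tendsto_circleAverage_of_antitone (hf : ∀ k, CircleIntegrable (f k) z R)
    (hF : CircleIntegrable F z R) (hanti : ∀ ζ, Antitone fun k => f k ζ)
    (hlim : ∀ᵐ θ : ℝ, Tendsto (fun k => f k (circleMap z R θ)) atTop (𝓝 (F (circleMap z R θ)))) :
    Tendsto (fun k => Real.circleAverage (f k) z R) atTop (𝓝 (Real.circleAverage F z R)) := by
  simp only [Real.circleAverage, intervalIntegral.integral_of_le Real.two_pi_pos.le]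
  exact (integral_tendsto_of_tendsto_of_antitone (fun k => (hf k).1) hF.1
    (ae_of_all _ fun θ => hanti _) (ae_restrict_of_ae hlim)).const_smul _

end CircleLimits

section CircleKernel

variable {ν : Measure ℂ} [IsFiniteMeasure ν] {r : ℕ → ℝ} {R : ℝ} {z w : ℂ}

lemma circleAverage_log_norm_sub (hR : 0 < R) (z w : ℂ) :
    Real.circleAverage (fun ζ => Real.log ‖ζ - w‖) z R = logKer R (z - w) := by
  have hnorm : |R⁻¹ * ‖z - w‖| = ‖z - w‖ / R := by
    rw [abs_of_nonneg (by positivity), inv_mul_eq_div]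
  rw [circleAverage_log_norm_sub_const_eq_log_radius_add_posLog hR.ne']
  rcases le_total ‖z - w‖ R with h | h
  · rw [logKer_of_ge h, (Real.posLog_eq_zero_iff _).2 (hnorm ▸ (div_le_one hR).2 h), add_zero]
  · rw [logKer_of_le h, Real.posLog_eq_log (hnorm ▸ (one_le_div hR).2 h), inv_mul_eq_div,
      Real.log_div (hR.trans_le h).ne' hR.ne', add_sub_cancel]

lemma circleIntegrable_regKer {r : ℝ} (hr : 0 < r) (z w : ℂ) (R : ℝ) :
    CircleIntegrable (fun ζ => regKer r ζ w) z R :=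
  ((continuous_regKer hr).comp (Continuous.prodMk_left w)).continuousOn.circleIntegrable'

lemma integrable_regKer_circleMap (ν : Measure ℂ) [IsFiniteMeasure ν] {r : ℝ} (hr : 0 < r) (z : ℂ)
    (R : ℝ) :
    Integrable (fun p : ℝ × ℂ => regKer r (circleMap z R p.1) p.2)
      ((volume.restrict (Set.Ioc 0 (2 * Real.pi))).prod ν) := by
  refine Integrable.of_bound (C := (‖z‖ + |R|) / r + |Real.log r|) ?_
    (ae_of_all _ fun p => (abs_regKer_le hr _ _).trans ?_)
  · exact ((continuous_regKer hr).comp (((continuous_circleMap z R).comp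
      continuous_fst).prodMk continuous_snd)).aestronglyMeasurable
  · gcongr
    refine (norm_add_le _ _).trans_eq ?_
    rw [norm_mul, Complex.norm_real, Complex.norm_exp_ofReal_mul_I, mul_one, Real.norm_eq_abs]

lemma circleAverage_truncPotential (ν : Measure ℂ) [IsFiniteMeasure ν] {r : ℝ} (hr : 0 < r)
    (z : ℂ) (R : ℝ) :
    Real.circleAverage (truncPotential ν r) z R =
      ∫ w, Real.circleAverage (fun ζ => regKer r ζ w) z R ∂ν := by
  simp only [Real.circleAverage, truncPotential, smul_eq_mul, integral_const_mul,
    intervalIntegral.integral_of_le Real.two_pi_pos.le]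
  rw [integral_integral_swap (integrable_regKer_circleMap ν hr z R)]

lemma integrable_circleAverage_regKer (ν : Measure ℂ) [IsFiniteMeasure ν] {r : ℝ} (hr : 0 < r)
    (z : ℂ) (R : ℝ) :
    Integrable (fun w => Real.circleAverage (fun ζ => regKer r ζ w) z R) ν := by
  simp only [Real.circleAverage, smul_eq_mul, intervalIntegral.integral_of_le Real.two_pi_pos.le]
  exact (integrable_regKer_circleMap ν hr z R).integral_prod_right.const_mul _

lemma antitone_regKer (hr0 : ∀ k, 0 < r k) (hanti : Antitone r) (z w : ℂ) :
    Antitone fun k => regKer (r k) z w :=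
  fun _ k h => sub_le_sub_right (logKer_mono (hr0 k) (hanti h) _) _

lemma tendsto_circleAverage_regKer (hR : 0 < R) (hr0 : ∀ k, 0 < r k) (hanti : Antitone r)
    (hr : Tendsto r atTop (𝓝 0)) (z w : ℂ) :
    Tendsto (fun k => Real.circleAverage (fun ζ => regKer (r k) ζ w) z R) atTop
      (𝓝 (regKer R z w)) := by
  have hlog := circleIntegrable_log_norm_sub_const (a := w) (c := z) R
  rw [regKer, ← circleAverage_log_norm_sub hR, ← Real.circleAverage_const (logKer 1 w) z R,
    ← Real.circleAverage_fun_sub hlog (circleIntegrable_const _ _ _)]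
  refine tendsto_circleAverage_of_antitone (fun k => circleIntegrable_regKer (hr0 k) z w R)
    (hlog.sub (circleIntegrable_const _ _ _)) (fun ζ => antitone_regKer hr0 hanti ζ w) ?_
  filter_upwards [ae_circleMap_notMem (Set.countable_singleton w) z hR.ne'] with θ hθ
  exact ((tendsto_logKer (sub_ne_zero.2 hθ)).comp hr).sub_const _

lemma isRieszMeasure_of_tendsto {U : ℂ → ℝ} (hU : Continuous U) {L : ℝ} (hr0 : ∀ k, 0 < r k)
    (hanti : Antitone r) (hr : Tendsto r atTop (𝓝 0))
    (h : ∀ z, Tendsto (fun k => L + truncPotential ν (r k) z) atTop (𝓝 (U z))) :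
    IsRieszMeasure U ν L := by
  intro z R hR
  have hcont : ∀ k, Continuous (truncPotential ν (r k)) := fun k =>
    continuous_truncPotential ν (hr0 k)
  have htoU : Tendsto (fun k => Real.circleAverage (fun ζ => L + truncPotential ν (r k) ζ) z R)
      atTop (𝓝 (Real.circleAverage U z R)) :=
    tendsto_circleAverage_of_antitone
      (fun k => (continuous_const.add (hcont k)).continuousOn.circleIntegrable')
      hU.continuousOn.circleIntegrable'
      (fun ζ _ k hjk => add_le_add_right (truncPotential_mono ν (hr0 k) (hanti hjk) ζ) L)
      (ae_of_all _ fun _ => h _)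
  have htoPotential : Tendsto (fun k => ∫ w, Real.circleAverage (fun ζ => regKer (r k) ζ w) z R ∂ν)
      atTop (𝓝 (truncPotential ν R z)) :=
    integral_tendsto_of_tendsto_of_antitone
      (fun k => integrable_circleAverage_regKer ν (hr0 k) z R) (integrable_regKer ν hR z)
      (ae_of_all _ fun w _ _ hjk => Real.circleAverage_mono
        (circleIntegrable_regKer (hr0 _) z w R) (circleIntegrable_regKer (hr0 _) z w R)
        fun ζ _ => antitone_regKer hr0 hanti ζ w hjk)
      (ae_of_all _ (tendsto_circleAverage_regKer hR hr0 hanti hr z))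
  refine tendsto_nhds_unique htoU ((htoPotential.const_add L).congr fun k => ?_)
  rw [Real.circleAverage_fun_add (circleIntegrable_const _ _ _)
    (hcont k).continuousOn.circleIntegrable', Real.circleAverage_const,
    circleAverage_truncPotential ν (hr0 k)]

end CircleKernel

/-! ### Zeros of polynomials -/

lemma log_norm_multiset_prod {s : Multiset ℂ} (h : (0 : ℂ) ∉ s) :
    Real.log ‖s.prod‖ = (s.map fun w => Real.log ‖w‖).sum := by
  induction s using Multiset.induction_on with
  | empty => simp
  | cons a s ih =>
    rw [Multiset.mem_cons, not_or] at h
    rw [Multiset.prod_cons, Multiset.map_cons, Multiset.sum_cons, norm_mul, ← ih h.2,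
      Real.log_mul (norm_ne_zero_iff.2 (Ne.symm h.1))
        (norm_ne_zero_iff.2 (Multiset.prod_ne_zero h.2))]

lemma log_norm_eval {p : ℂ[X]} {z : ℂ} (hz : p.eval z ≠ 0) :
    Real.log ‖p.eval z‖ =
      Real.log ‖p.leadingCoeff‖ + (p.roots.map fun w => Real.log ‖z - w‖).sum := by
  have hp : p ≠ 0 := by
    rintro rfl
    exact hz eval_zero
  have h0 : (0 : ℂ) ∉ p.roots.map (z - ·) := by
    simp only [Multiset.mem_map, not_exists, not_and, sub_eq_zero]
    rintro w hw rfl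
    exact hz (isRoot_of_mem_roots hw)
  rw [(IsAlgClosed.splits p).eval_eq_prod_roots, norm_mul,
    Real.log_mul (norm_ne_zero_iff.2 (leadingCoeff_ne_zero.2 hp))
      (norm_ne_zero_iff.2 (Multiset.prod_ne_zero h0)),
    log_norm_multiset_prod h0, Multiset.map_map]
  rfl

lemma circleAverage_multiset_sum {ι : Type*} (s : Multiset ι) {f : ι → ℂ → ℝ} {z : ℂ} {R : ℝ}
    (hf : ∀ i, CircleIntegrable (f i) z R) :
    CircleIntegrable (fun ζ => (s.map fun i => f i ζ).sum) z R ∧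
      Real.circleAverage (fun ζ => (s.map fun i => f i ζ).sum) z R =
        (s.map fun i => Real.circleAverage (f i) z R).sum := by
  induction s using Multiset.induction_on with
  | empty => simp [Real.circleAverage_const, circleIntegrable_const]
  | cons i s ih =>
    simp only [Multiset.map_cons, Multiset.sum_cons]
    exact ⟨(hf i).add ih.1, by rw [Real.circleAverage_fun_add (hf i) ih.1, ih.2]⟩

lemma circleIntegrable_log_norm_eval (p : ℂ[X]) (z : ℂ) (R : ℝ) :
    CircleIntegrable (fun ζ => Real.log ‖p.eval ζ‖) z R :=
  MeromorphicOn.circleIntegrable_log_norm fun x _ =>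
    (p.differentiable.analyticAt x).meromorphicAt

lemma ae_eval_circleMap_ne_zero {p : ℂ[X]} (hp : p ≠ 0) (z : ℂ) {R : ℝ} (hR : R ≠ 0) :
    ∀ᵐ θ : ℝ, p.eval (circleMap z R θ) ≠ 0 := by
  filter_upwards [ae_circleMap_notMem (p.rootSet_finite ℂ).countable z hR] with θ hθ h0
  exact hθ (mem_rootSet.2 ⟨hp, by rwa [coe_aeval_eq_eval]⟩)

lemma circleAverage_log_norm_eval {p : ℂ[X]} (hp : p ≠ 0) (z : ℂ) {R : ℝ} (hR : 0 < R) :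
    Real.circleAverage (fun ζ => Real.log ‖p.eval ζ‖) z R =
      Real.log ‖p.leadingCoeff‖ + (p.roots.map fun w => logKer R (z - w)).sum := by
  obtain ⟨hint, havg⟩ := circleAverage_multiset_sum p.roots
    (f := fun w ζ => Real.log ‖ζ - w‖) (z := z) (R := R)
    fun w => circleIntegrable_log_norm_sub_const R
  rw [circleAverage_congr_ae (g := fun ζ => Real.log ‖p.leadingCoeff‖ +
      (p.roots.map fun w => Real.log ‖ζ - w‖).sum)
      ((ae_eval_circleMap_ne_zero hp z hR.ne').mono fun θ => log_norm_eval),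
    Real.circleAverage_fun_add (circleIntegrable_const _ _ _) hint, havg,
    Real.circleAverage_const]
  simp only [circleAverage_log_norm_sub hR]

lemma log_norm_eval_le_circleAverage {p : ℂ[X]} {z : ℂ} (hz : p.eval z ≠ 0) {R : ℝ} (hR : 0 < R) :
    Real.log ‖p.eval z‖ ≤ Real.circleAverage (fun ζ => Real.log ‖p.eval ζ‖) z R := by
  have hp : p ≠ 0 := by
    rintro rfl
    exact hz eval_zero
  rw [log_norm_eval hz, circleAverage_log_norm_eval hp z hR]
  refine add_le_add_right (Multiset.sum_map_le_sum_map _ _ fun w hw =>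
    log_norm_le_logKer (sub_ne_zero.2 ?_)) _
  rintro rfl
  exact hz (isRoot_of_mem_roots hw)

/-! ### The zero distribution -/

lemma integral_multiset_sum_dirac (s : Multiset ℂ) (f : ℂ → ℝ) :
    Integrable f (s.map fun z => Measure.dirac z).sum ∧
      ∫ z, f z ∂(s.map fun z => Measure.dirac z).sum = (s.map f).sum := by
  induction s using Multiset.induction_on with
  | empty => simp
  | cons a s ih =>
    have ha : Integrable f (Measure.dirac a) := integrable_dirac (by simp)
    simp only [Multiset.map_cons, Multiset.sum_cons]
    exact ⟨ha.add_measure ih.1, by rw [integral_add_measure ha ih.1, ih.2, integral_dirac]⟩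

lemma natDegree_mul_integral_zeroDistribution (p : ℂ[X]) (f : ℂ → ℝ) :
    p.natDegree * ∫ z, f z ∂(zeroDistribution p) = (p.roots.map f).sum := by
  rw [zeroDistribution, integral_smul_measure, (integral_multiset_sum_dirac _ _).2, smul_eq_mul,
    ENNReal.toReal_inv, ENNReal.toReal_natCast]
  rcases eq_or_ne p.natDegree 0 with h | h
  · rw [Multiset.card_eq_zero.1 ((IsAlgClosed.splits p).natDegree_eq_card_roots.symm.trans h), h]
    simp
  · exact mul_inv_cancel_left₀ (Nat.cast_ne_zero.2 h) _

lemma multiset_sum_dirac_univ (s : Multiset ℂ) :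
    (s.map fun z => Measure.dirac z).sum Set.univ = s.card := by
  induction s using Multiset.induction_on with
  | empty => simp
  | cons a s ih =>
    rw [Multiset.map_cons, Multiset.sum_cons, Measure.add_apply, ih, measure_univ,
      Multiset.card_cons, Nat.cast_succ, add_comm]

lemma isProbabilityMeasure_zeroDistribution {p : ℂ[X]} (hp : 0 < p.natDegree) :
    IsProbabilityMeasure (zeroDistribution p) := by
  refine ⟨?_⟩
  rw [zeroDistribution, Measure.smul_apply, multiset_sum_dirac_univ,
    ← (IsAlgClosed.splits p).natDegree_eq_card_roots, smul_eq_mul]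
  exact ENNReal.inv_mul_cancel (Nat.cast_ne_zero.2 hp.ne') (ENNReal.natCast_ne_top _)

instance isZeroOrProbabilityMeasure_zeroDistribution (p : ℂ[X]) :
    IsZeroOrProbabilityMeasure (zeroDistribution p) := by
  rcases p.natDegree.eq_zero_or_pos with h | h
  · have hroots := Multiset.card_eq_zero.1
      ((IsAlgClosed.splits p).natDegree_eq_card_roots.symm.trans h)
    rw [zeroDistribution, hroots, Multiset.map_zero, Multiset.sum_zero, smul_zero]
    infer_instance
  · have := isProbabilityMeasure_zeroDistribution h
    infer_instance

lemma circleAverage_log_norm_eval_eq_logMahlerMeasure_add {p : ℂ[X]} (hp : p ≠ 0) (z : ℂ) {R : ℝ}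
    (hR : 0 < R) :
    Real.circleAverage (fun ζ => Real.log ‖p.eval ζ‖) z R =
      p.logMahlerMeasure + p.natDegree * truncPotential (zeroDistribution p) R z := by
  rw [truncPotential, natDegree_mul_integral_zeroDistribution, logMahlerMeasure_def,
    circleAverage_log_norm_eval hp z hR, circleAverage_log_norm_eval hp 0 one_pos]
  have hsum : (p.roots.map (regKer R z)).sum =
      (p.roots.map fun w => logKer R (z - w)).sum - (p.roots.map fun w => logKer 1 w).sum :=
    Multiset.sum_map_sub
  simp only [hsum, zero_sub, logKer_neg]
  ring

/-! ### Limits of zero distributions from limits of logarithmic potentials -/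

lemma tendsto_circleAverage_zero {U : ℂ → ℝ} (hU : Continuous U) (z : ℂ) :
    Tendsto (Real.circleAverage U z) (𝓝 0) (𝓝 (U z)) := by
  have h := (Real.Continuous.circleAverage (c := z) hU).tendsto 0
  rwa [Real.circleAverage_zero] at h

/-- The polynomials `q m`, of degree at most `N m → ∞`, have the limiting logarithmic potential `U`:
`(1 / N m) log |q m|` is asymptotically at least `U` at the points of a dense set `S`, and at most
`U` in circle averages. The logarithmic growth of `U` keeps the zeros from escaping to infinity. -/
structure HasLogPotential (q : ℕ → ℂ[X]) (N : ℕ → ℕ) (U : ℂ → ℝ) (S : Set ℂ) : Prop where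
  continuous : Continuous U
  dense : Dense S
  grow : ∃ C : ℝ, ∀ ρ : ℝ, 1 < ρ → ∃ z ∈ S, ‖z‖ ≤ ρ ∧ Real.log ρ - C ≤ U z
  tendsto_atTop : Tendsto N atTop atTop
  natDegree_le : ∀ m, (q m).natDegree ≤ N m
  lower : ∀ z ∈ S, ∀ ε : ℝ, 0 < ε → ∀ᶠ m in atTop,
    Real.exp (N m * (U z - ε)) ≤ ‖(q m).eval z‖
  upper : ∀ z : ℂ, ∀ R : ℝ, 0 < R → ∀ ε : ℝ, 0 < ε → ∀ᶠ m in atTop,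
    Real.circleAverage (fun ζ => Real.log ‖(q m).eval ζ‖) z R ≤
      N m * (Real.circleAverage U z R + ε)

namespace HasLogPotential

variable {q : ℕ → ℂ[X]} {N : ℕ → ℕ} {U : ℂ → ℝ} {S : Set ℂ}

/-- The normalised circle average `(1 / N) ⨍ log |q|`, in the form given by Jensen's formula. -/
def jensenMean (q : ℂ[X]) (N : ℕ) (R : ℝ) (z : ℂ) : ℝ :=
  (N : ℝ)⁻¹ * q.logMahlerMeasure + q.natDegree / N * truncPotential (zeroDistribution q) R z

lemma circleAverage_eq_mul_jensenMean {q : ℂ[X]} (hq : q ≠ 0) {N : ℕ} (hN : 0 < N) (z : ℂ) {R : ℝ}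
    (hR : 0 < R) :
    Real.circleAverage (fun ζ => Real.log ‖q.eval ζ‖) z R = N * jensenMean q N R z := by
  have hN' : (N : ℝ) ≠ 0 := Nat.cast_ne_zero.2 hN.ne'
  rw [circleAverage_log_norm_eval_eq_logMahlerMeasure_add hq z hR, jensenMean]
  field_simp

lemma eventually_pos (h : HasLogPotential q N U S) : ∀ᶠ m in atTop, 0 < N m :=
  h.tendsto_atTop.eventually_gt_atTop 0

lemma eventually_ne_zero (h : HasLogPotential q N U S) : ∀ᶠ m in atTop, q m ≠ 0 := by
  obtain ⟨z, hz⟩ := h.dense.nonempty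
  filter_upwards [h.lower z hz 1 one_pos] with m hm h0
  rw [h0, eval_zero, norm_zero] at hm
  exact hm.not_gt (Real.exp_pos _)

lemma eventually_le_jensenMean (h : HasLogPotential q N U S) {z : ℂ} (hz : z ∈ S) {R : ℝ}
    (hR : 0 < R) {ε : ℝ} (hε : 0 < ε) :
    ∀ᶠ m in atTop, U z - ε ≤ jensenMean (q m) (N m) R z := by
  filter_upwards [h.lower z hz ε hε, h.eventually_pos, h.eventually_ne_zero] with m hm hN hq
  have h0 : 0 < ‖(q m).eval z‖ := (Real.exp_pos _).trans_le hm
  refine le_of_mul_le_mul_left ?_ (Nat.cast_pos.2 hN : (0 : ℝ) < N m)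
  rw [← circleAverage_eq_mul_jensenMean hq hN z hR]
  exact ((Real.le_log_iff_exp_le h0).2 hm).trans
    (log_norm_eval_le_circleAverage (norm_pos_iff.1 h0) hR)

lemma eventually_jensenMean_le (h : HasLogPotential q N U S) (z : ℂ) {R : ℝ} (hR : 0 < R) {ε : ℝ}
    (hε : 0 < ε) :
    ∀ᶠ m in atTop, jensenMean (q m) (N m) R z ≤ Real.circleAverage U z R + ε := by
  filter_upwards [h.upper z R hR ε hε, h.eventually_pos, h.eventually_ne_zero] with m hm hN hq
  refine le_of_mul_le_mul_left ?_ (Nat.cast_pos.2 hN : (0 : ℝ) < N m)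
  rwa [← circleAverage_eq_mul_jensenMean hq hN z hR]

lemma natDegree_div_le_one (h : HasLogPotential q N U S) (m : ℕ) :
    ((q m).natDegree : ℝ) / N m ≤ 1 :=
  div_le_one_of_le₀ (Nat.cast_le.2 (h.natDegree_le m)) (Nat.cast_nonneg _)

/-- The disc of radius `ρ` carries all but `O(1 / log ρ)` of the zeros, in terms of potentials. -/
lemma exists_log_sub_le_truncPotential (h : HasLogPotential q N U S) :
    ∃ C : ℝ, ∀ ρ : ℝ, 1 < ρ → ∀ᶠ m in atTop,
      Real.log ρ - C ≤ (q m).natDegree / N m * truncPotential (zeroDistribution (q m)) ρ 0 := by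
  obtain ⟨C, hC⟩ := h.grow
  refine ⟨C + Real.circleAverage U 0 1 + 3, fun ρ hρ => ?_⟩
  obtain ⟨z, hzS, hzρ, hzU⟩ := hC ρ hρ
  have hρ0 : 0 < ρ := one_pos.trans hρ
  filter_upwards [h.eventually_le_jensenMean hzS hρ0 one_pos,
    h.eventually_jensenMean_le 0 one_pos one_pos] with m hlow hup
  have hdeg := h.natDegree_div_le_one m
  have hdeg0 : (0 : ℝ) ≤ (q m).natDegree / N m := by positivity
  have hshift : truncPotential (zeroDistribution (q m)) ρ z ≤
      truncPotential (zeroDistribution (q m)) ρ 0 + 1 := by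
    have hlip := (le_abs_self _).trans
      (abs_truncPotential_sub_le (zeroDistribution (q m)) hρ0 z 0)
    rw [sub_zero] at hlip
    have := mul_le_one₀ ((div_le_one hρ0).2 hzρ) measureReal_nonneg
      (measureReal_le_one (μ := zeroDistribution (q m)) (s := Set.univ))
    linarith
  have hone : 0 ≤ (q m).natDegree / N m * truncPotential (zeroDistribution (q m)) 1 0 :=
    mul_nonneg hdeg0 (truncPotential_zero_nonneg _ le_rfl)
  have hmul := mul_le_mul_of_nonneg_left hshift hdeg0
  simp only [jensenMean] at hlow hup
  linarith

lemma tendsto_natDegree_div (h : HasLogPotential q N U S) :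
    Tendsto (fun m => ((q m).natDegree : ℝ) / N m) atTop (𝓝 1) := by
  obtain ⟨C, hC⟩ := h.exists_log_sub_le_truncPotential
  refine tendsto_order.2 ⟨fun a ha => ?_, fun a ha =>
    Eventually.of_forall fun m => (h.natDegree_div_le_one m).trans_lt ha⟩
  have hlim : Tendsto (fun ρ : ℝ => 1 - C / Real.log ρ) atTop (𝓝 (1 - 0)) :=
    (tendsto_const_nhds.div_atTop Real.tendsto_log_atTop).const_sub 1
  rw [sub_zero] at hlim
  obtain ⟨ρ, haρ, hρ⟩ := ((hlim.eventually_const_lt ha).and (eventually_gt_atTop 1)).exists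
  have hlog := Real.log_pos hρ
  filter_upwards [hC ρ hρ] with m hm
  refine haρ.trans_le (le_of_mul_le_mul_right ?_ hlog)
  calc (1 - C / Real.log ρ) * Real.log ρ = Real.log ρ - C := by field_simp
    _ ≤ _ := hm
    _ ≤ (q m).natDegree / N m * (1 * Real.log ρ) := by
        gcongr
        refine (truncPotential_zero_le _ hρ.le).trans ?_
        gcongr
        exact measureReal_le_one
    _ = _ := by rw [one_mul]

lemma eventually_natDegree_pos (h : HasLogPotential q N U S) :
    ∀ᶠ m in atTop, 0 < (q m).natDegree := by
  filter_upwards [h.tendsto_natDegree_div.eventually_const_lt one_pos] with m hm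
  refine Nat.pos_of_ne_zero fun h0 => ?_
  rw [h0, Nat.cast_zero, zero_div] at hm
  exact lt_irrefl _ hm

lemma exists_measure_norm_gt_le (h : HasLogPotential q N U S) :
    ∃ C : ℝ, ∀ ρ : ℝ, 1 < ρ → ∀ᶠ m in atTop,
      zeroDistribution (q m) {w | ρ < ‖w‖} ≤ ENNReal.ofReal (C / Real.log ρ) := by
  obtain ⟨C, hC⟩ := h.exists_log_sub_le_truncPotential
  refine ⟨C, fun ρ hρ => ?_⟩
  have hlog := Real.log_pos hρ
  filter_upwards [hC ρ hρ, h.eventually_natDegree_pos] with m hm hdeg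
  have := isProbabilityMeasure_zeroDistribution hdeg
  have hball : {w : ℂ | ρ < ‖w‖} = (Metric.closedBall 0 ρ)ᶜ := by
    ext w
    rw [Set.mem_compl_iff, mem_closedBall_zero_iff, not_le, Set.mem_ofPred_eq]
  rw [← ofReal_measureReal, hball,
    probReal_compl_eq_one_sub Metric.isClosed_closedBall.measurableSet]
  refine ENNReal.ofReal_le_ofReal ((le_div_iff₀ hlog).2 ?_)
  have hle := hm.trans (mul_le_of_le_one_left (truncPotential_zero_nonneg _ hρ.le)
    (h.natDegree_div_le_one m))
  linarith [hle.trans (truncPotential_zero_le _ hρ.le)]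

lemma exists_ultrafilter_limit (h : HasLogPotential q N U S) {F : Ultrafilter ℕ}
    (hF : (F : Filter ℕ) ≤ atTop) :
    ∃ ν : ProbabilityMeasure ℂ, ∀ f : ℂ →ᵇ ℝ,
      Tendsto (fun m => ∫ z, f z ∂(zeroDistribution (q m))) F (𝓝 (∫ z, f z ∂(ν : Measure ℂ))) := by
  have hexists : ∀ m, ∃ μ : ProbabilityMeasure ℂ, 0 < (q m).natDegree →
      (μ : Measure ℂ) = zeroDistribution (q m) := fun m => by
    by_cases hm : 0 < (q m).natDegree
    · exact ⟨⟨_, isProbabilityMeasure_zeroDistribution hm⟩, fun _ => rfl⟩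
    · exact ⟨⟨Measure.dirac 0, inferInstance⟩, fun h => absurd h hm⟩
  choose μ hμ using hexists
  obtain ⟨C, hC⟩ := h.exists_measure_norm_gt_le
  have hlim : Tendsto (fun ρ : ℝ => ENNReal.ofReal (C / Real.log ρ)) atTop (𝓝 0) := by
    rw [← ENNReal.ofReal_zero]
    exact ENNReal.tendsto_ofReal (tendsto_const_nhds.div_atTop Real.tendsto_log_atTop)
  have htight : IsTightMeasureSet (Set.range fun m => (μ m : Measure ℂ)) := by
    refine isTightMeasureSet_range_of_tendsto_limsup_measure_norm_gt
      (tendsto_of_tendsto_of_tendsto_of_le_of_le' tendsto_const_nhds hlim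
        (Eventually.of_forall fun _ => zero_le) ?_)
    filter_upwards [eventually_gt_atTop 1] with ρ hρ
    refine limsup_le_of_le (by isBoundedDefault) ?_
    filter_upwards [hC ρ hρ, h.eventually_natDegree_pos] with m hm hdeg
    rwa [hμ m hdeg]
  have hcompact : IsCompact (closure (Set.range μ)) := by
    refine isCompact_closure_of_isTightMeasureSet ?_
    convert htight using 1
    ext ν
    simp
  obtain ⟨ν, -, hν⟩ := hcompact.ultrafilter_le_nhds (F.map μ)
    (le_principal_iff.2 (mem_of_superset range_mem_map subset_closure))
  refine ⟨ν, fun f => (ProbabilityMeasure.tendsto_iff_forall_integral_tendsto.1 hν f).congr' ?_⟩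
  filter_upwards [hF h.eventually_natDegree_pos] with m hm
  rw [hμ m hm]

lemma exists_tendsto_jensenMean (h : HasLogPotential q N U S) {F : Ultrafilter ℕ}
    (hF : (F : Filter ℕ) ≤ atTop) {ν : Measure ℂ} (hν : ∀ f : ℂ →ᵇ ℝ,
      Tendsto (fun m => ∫ z, f z ∂(zeroDistribution (q m))) F (𝓝 (∫ z, f z ∂ν))) :
    ∃ L, ∀ z, ∀ R > 0, Tendsto (fun m => jensenMean (q m) (N m) R z) F
      (𝓝 (L + truncPotential ν R z)) := by
  have hpot : ∀ z, ∀ R > 0, Tendsto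
      (fun m => (q m).natDegree / N m * truncPotential (zeroDistribution (q m)) R z) F
      (𝓝 (truncPotential ν R z)) := fun z R hR => by
    have := (h.tendsto_natDegree_div.mono_left hF).mul (hν (regKerBCF hR z))
    rwa [one_mul] at this
  obtain ⟨z₀, hz₀⟩ := h.dense.nonempty
  have hbdd : ∀ᶠ m in (F : Filter ℕ), (N m : ℝ)⁻¹ * (q m).logMahlerMeasure ∈ Set.Icc
      (U z₀ - 1 - (truncPotential ν 1 z₀ + 1)) (Real.circleAverage U 0 1 + 1) := by
    filter_upwards [hF (h.eventually_le_jensenMean hz₀ one_pos one_pos),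
      hF (h.eventually_jensenMean_le 0 one_pos one_pos),
      (hpot z₀ 1 one_pos).eventually_lt_const (lt_add_one _)] with m hlow hup hlt
    have hone : 0 ≤ (q m).natDegree / N m * truncPotential (zeroDistribution (q m)) 1 0 :=
      mul_nonneg (by positivity) (truncPotential_zero_nonneg _ le_rfl)
    simp only [jensenMean] at hlow hup
    exact ⟨by linarith, by linarith⟩
  obtain ⟨L, -, hL⟩ := isCompact_Icc.ultrafilter_le_nhds
    (F.map fun m => (N m : ℝ)⁻¹ * (q m).logMahlerMeasure) (le_principal_iff.2 hbdd)
  exact ⟨L, fun z R hR => Tendsto.add hL (hpot z R hR)⟩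

lemma exists_isRieszMeasure_of_tendsto (h : HasLogPotential q N U S) {F : Ultrafilter ℕ}
    (hF : (F : Filter ℕ) ≤ atTop) {ν : Measure ℂ} [IsFiniteMeasure ν] (hν : ∀ f : ℂ →ᵇ ℝ,
      Tendsto (fun m => ∫ z, f z ∂(zeroDistribution (q m))) F (𝓝 (∫ z, f z ∂ν))) :
    ∃ L, IsRieszMeasure U ν L := by
  obtain ⟨L, hL⟩ := h.exists_tendsto_jensenMean hF hν
  have hge : ∀ R > 0, ∀ z, U z ≤ L + truncPotential ν R z := by
    intro R hR
    have hclosed : IsClosed {z | U z ≤ L + truncPotential ν R z} :=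
      isClosed_le h.continuous (continuous_const.add (continuous_truncPotential _ hR))
    have hsub : S ⊆ {z | U z ≤ L + truncPotential ν R z} := fun z hz =>
      le_of_forall_pos_sub_le fun ε hε =>
        ge_of_tendsto (hL z R hR) (hF (h.eventually_le_jensenMean hz hR hε))
    exact fun z => hclosed.closure_subset_iff.2 hsub (h.dense z)
  have hle : ∀ z, ∀ R > 0, L + truncPotential ν R z ≤ Real.circleAverage U z R := fun z R hR =>
    le_of_forall_pos_le_add fun ε hε =>
      le_of_tendsto (hL z R hR) (hF (h.eventually_jensenMean_le z hR hε))
  have hr : ∀ k : ℕ, 0 < 1 / ((k : ℝ) + 1) := fun k => by positivity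
  exact ⟨L, isRieszMeasure_of_tendsto h.continuous hr (fun _ _ => Nat.one_div_le_one_div)
    tendsto_one_div_add_atTop_nhds_zero_nat fun z =>
    tendsto_of_tendsto_of_tendsto_of_le_of_le tendsto_const_nhds
      ((tendsto_circleAverage_zero h.continuous z).comp tendsto_one_div_add_atTop_nhds_zero_nat)
      (fun k => hge _ (hr k) z) fun k => hle z _ (hr k)⟩

/-- Every ultrafilter limit of the zero distributions is the Riesz measure of `U`, and there is only
one such measure. -/
theorem exists_tendsto (h : HasLogPotential q N U S) :
    ∃ ν : ProbabilityMeasure ℂ, (∃ L, IsRieszMeasure U (ν : Measure ℂ) L) ∧ ∀ f : ℂ →ᵇ ℝ,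
      Tendsto (fun m => ∫ z, f z ∂(zeroDistribution (q m))) atTop
        (𝓝 (∫ z, f z ∂(ν : Measure ℂ))) := by
  obtain ⟨ν, hν⟩ := h.exists_ultrafilter_limit (Ultrafilter.of_le atTop)
  obtain ⟨L, hL⟩ := h.exists_isRieszMeasure_of_tendsto (Ultrafilter.of_le atTop) hν
  refine ⟨ν, ⟨L, hL⟩, fun f => tendsto_iff_ultrafilter _ _ _ |>.2 fun F hF => ?_⟩
  obtain ⟨ν', hν'⟩ := h.exists_ultrafilter_limit hF
  obtain ⟨L', hL'⟩ := h.exists_isRieszMeasure_of_tendsto hF hν'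
  rw [hL.unique hL']
  exact hν' f

end HasLogPotential

/-! ### Hermite polynomials and the heat flow -/

/-- The monic Hermite polynomial `exp(-(s/2) ∂²) X ^ k` of variance `s`. -/
def hermitePoly (s : ℂ) (k : ℕ) : ℂ[X] := heatFlow s (X ^ k)

section HeatFlow

variable (s : ℂ)

lemma heatFlow_eq_sum_range {p : ℂ[X]} {M : ℕ} (h : p.natDegree < M) :
    heatFlow s p =
      ∑ j ∈ Finset.range M, C ((1 / (j.factorial : ℂ)) * (-s / 2) ^ j) * derivative^[2 * j] p := by
  refine Finset.sum_subset (Finset.range_subset_range.2 h) fun j _ hj => ?_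
  rw [Finset.mem_range, not_lt] at hj
  rw [iterate_derivative_eq_zero (by omega), mul_zero]

lemma heatFlow_C_mul (c : ℂ) (p : ℂ[X]) : heatFlow s (C c * p) = C c * heatFlow s p := by
  rw [heatFlow_eq_sum_range s (Nat.lt_succ_of_le (natDegree_C_mul_le c p)), heatFlow,
    Finset.mul_sum]
  exact Finset.sum_congr rfl fun j _ => by rw [iterate_derivative_C_mul, mul_left_comm]

lemma heatFlow_sum {ι : Type*} (I : Finset ι) (p : ι → ℂ[X]) :
    heatFlow s (∑ i ∈ I, p i) = ∑ i ∈ I, heatFlow s (p i) := by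
  obtain ⟨M, hM⟩ : ∃ M, ∀ i ∈ I, (p i).natDegree ≤ M :=
    ⟨_, fun i hi => Finset.le_sup (f := fun i => (p i).natDegree) hi⟩
  rw [heatFlow_eq_sum_range s (Nat.lt_succ_of_le (natDegree_sum_le_of_forall_le _ _ hM)),
    Finset.sum_congr rfl fun i hi => heatFlow_eq_sum_range s (Nat.lt_succ_of_le (hM i hi)),
    Finset.sum_comm]
  exact Finset.sum_congr rfl fun j _ => by rw [iterate_derivative_sum, Finset.mul_sum]

lemma natDegree_heatFlow_le (p : ℂ[X]) : (heatFlow s p).natDegree ≤ p.natDegree :=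
  natDegree_sum_le_of_forall_le _ _ fun _ _ => (natDegree_C_mul_le _ _).trans <|
    (natDegree_iterate_derivative _ _).trans (Nat.sub_le _ _)

lemma heatFlow_mul_X (p : ℂ[X]) :
    heatFlow s (p * X) = heatFlow s p * X - C s * heatFlow s (derivative p) := by
  set c : ℕ → ℂ := fun j => (1 / (j.factorial : ℂ)) * (-s / 2) ^ j with hc
  have hcoeff : ∀ j : ℕ, c (j + 1) * (2 * (j + 1) : ℕ) = -s * c j := fun j => by
    have : (j.factorial : ℂ) ≠ 0 := by exact_mod_cast j.factorial_ne_zero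
    have : (j + 1 : ℂ) ≠ 0 := by exact_mod_cast j.succ_ne_zero
    simp only [hc, Nat.factorial_succ]
    push_cast
    field_simp
    ring
  have hderiv : ∀ j ∈ Finset.range (p.natDegree + 1), C (c (j + 1)) *
      ((2 * (j + 1)) • derivative^[2 * (j + 1) - 1] p) =
      -(C s * (C (c j) * derivative^[2 * j] (derivative p))) := fun j _ => by
    rw [show 2 * (j + 1) - 1 = 2 * j + 1 by omega, Function.iterate_succ_apply]
    have := congrArg C (hcoeff j)
    simp only [map_mul, map_natCast, map_neg, nsmul_eq_mul] at this ⊢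
    push_cast at this ⊢
    linear_combination derivative^[2 * j] (derivative p) * this
  have hp' : (derivative p).natDegree < p.natDegree + 1 :=
    Nat.lt_succ_of_le ((natDegree_derivative_le p).trans (Nat.sub_le _ _))
  have hpX : (p * X).natDegree < p.natDegree + 2 :=
    Nat.lt_succ_of_le (natDegree_mul_le.trans (by gcongr; exact natDegree_X_le))
  have hp : p.natDegree < p.natDegree + 2 := by omega
  rw [heatFlow_eq_sum_range s hpX, heatFlow_eq_sum_range s hp, heatFlow_eq_sum_range s hp']
  calc ∑ j ∈ Finset.range (p.natDegree + 2), C (c j) * derivative^[2 * j] (p * X)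
      = (∑ j ∈ Finset.range (p.natDegree + 2), C (c j) * derivative^[2 * j] p) * X
        + ∑ j ∈ Finset.range (p.natDegree + 2),
          C (c j) * ((2 * j) • derivative^[2 * j - 1] p) := by
        simp only [iterate_derivative_mul_X, mul_add, Finset.sum_add_distrib, Finset.sum_mul,
          mul_assoc]
    _ = _ := by
        rw [Finset.sum_range_succ' (fun j => C (c j) * ((2 * j) • derivative^[2 * j - 1] p)),
          Finset.sum_congr rfl hderiv, Finset.sum_neg_distrib, ← Finset.mul_sum]
        simp only [mul_zero, zero_smul, add_zero, sub_eq_add_neg, hc]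

lemma hermitePoly_zero : hermitePoly s 0 = 1 := by simp [hermitePoly, heatFlow]

lemma hermitePoly_one : hermitePoly s 1 = X := by
  simp [hermitePoly, heatFlow, Finset.sum_range_succ]

lemma hermitePoly_add_two (k : ℕ) : hermitePoly s (k + 2) =
    hermitePoly s (k + 1) * X - C (s * (k + 1)) * hermitePoly s k := by
  rw [hermitePoly, pow_succ, heatFlow_mul_X, derivative_X_pow_succ, heatFlow_C_mul, C_mul,
    mul_assoc]
  rfl

lemma heatFlow_sum_C_mul_X_pow (I : Finset ℕ) (c : ℕ → ℂ) :
    heatFlow s (∑ k ∈ I, C (c k) * X ^ k) = ∑ k ∈ I, C (c k) * hermitePoly s k := by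
  simp only [heatFlow_sum, heatFlow_C_mul, hermitePoly]

lemma hermitePoly_eval_neg (z : ℂ) (k : ℕ) :
    (hermitePoly s k).eval (-z) = (-1) ^ k * (hermitePoly s k).eval z := by
  induction k using Nat.twoStepInduction with
  | zero => simp [hermitePoly_zero]
  | one => simp [hermitePoly_one]
  | more k ih1 ih2 =>
    simp only [hermitePoly_add_two, eval_sub, eval_mul, eval_X, eval_C, ih1, ih2]
    ring

end HeatFlow

lemma norm_hermitePoly_eval_le {s t : ℝ} (hs : 0 ≤ s) (z : ℂ) {n : ℕ} (hst : s * n ≤ t) :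
    ∀ k ≤ n, ‖(hermitePoly s k).eval z‖ ≤ (‖z‖ + t + 1) ^ k := by
  have ht : 0 ≤ t := le_trans (by positivity) hst
  intro k
  induction k using Nat.twoStepInduction with
  | zero => simp [hermitePoly_zero]
  | one =>
    intro _
    simp only [hermitePoly_one, eval_X, pow_one]
    linarith
  | more k ih1 ih2 =>
    intro hk
    have hcoeff : ‖(s : ℂ) * (k + 1)‖ ≤ t := by
      rw [show (s : ℂ) * (k + 1) = ((s * (k + 1) : ℝ) : ℂ) by push_cast; ring,
        Complex.norm_of_nonneg (by positivity)]
      refine le_trans ?_ hst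
      gcongr
      exact_mod_cast (by omega : k + 1 ≤ n)
    set B := ‖z‖ + t + 1 with hB
    have hB1 : 1 ≤ B := by linarith [norm_nonneg z]
    simp only [hermitePoly_add_two, eval_sub, eval_mul, eval_X, eval_C]
    calc _ ≤ ‖(hermitePoly s (k + 1)).eval z‖ * ‖z‖
          + ‖(s : ℂ) * (k + 1)‖ * ‖(hermitePoly s k).eval z‖ :=
          (norm_sub_le _ _).trans_eq (by rw [norm_mul, norm_mul])
      _ ≤ B ^ (k + 1) * ‖z‖ + t * B ^ k := by
          gcongr
          exacts [ih2 (by omega), ih1 (by omega)]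
      _ ≤ B ^ (k + 1) * ‖z‖ + t * B ^ (k + 1) := by gcongr; omega
      _ ≤ B ^ (k + 2) := by
          rw [pow_succ B (k + 1), hB]
          linarith [pow_nonneg (zero_le_one.trans hB1) (k + 1)]

/-! ### The roots of `r² - z r + c = 0` -/

/-- The modulus of the larger root of `r² - z r + c = 0`, for `c ≥ 0`. The mean of the distances of
`z` to `±2√c` is the semi-major axis of the ellipse through `z` with these foci. -/
def joukowskyRadius (c : ℝ) (z : ℂ) : ℝ :=
  ((‖z - 2 * √c‖ + ‖z + 2 * √c‖) / 2 +
    √(((‖z - 2 * √c‖ + ‖z + 2 * √c‖) / 2) ^ 2 - 4 * c)) / 2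

lemma exists_mul_eq_and_add_eq (c z : ℂ) : ∃ r r' : ℂ, r * r' = c ∧ r + r' = z ∧ ‖r'‖ ≤ ‖r‖ := by
  obtain ⟨w, hw⟩ := IsAlgClosed.exists_pow_nat_eq (z ^ 2 - 4 * c) two_pos
  have hmul : (z + w) / 2 * ((z - w) / 2) = c := by linear_combination (-1 / 4 : ℂ) * hw
  rcases le_total ‖(z - w) / 2‖ ‖(z + w) / 2‖ with h | h
  · exact ⟨_, _, hmul, by ring, h⟩
  · exact ⟨_, _, (mul_comm _ _).trans hmul, by ring, h⟩

section JoukowskyRadius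

variable {c : ℝ}

lemma norm_two_mul_sqrt (c : ℝ) : ‖(2 * √c : ℂ)‖ = 2 * √c := by
  rw [norm_mul, Complex.norm_of_nonneg (Real.sqrt_nonneg c), Complex.norm_ofNat]

lemma sq_norm_sub_add_norm_add (hc : 0 ≤ c) (z : ℂ) :
    (‖z - 2 * √c‖ + ‖z + 2 * √c‖) ^ 2 = 2 * ‖z‖ ^ 2 + 8 * c + 2 * ‖z ^ 2 - 4 * c‖ := by
  have hpar := parallelogram_law_with_norm ℝ z (2 * √c)
  have hsq : ((√c : ℝ) : ℂ) ^ 2 = c := by rw [← Complex.ofReal_pow, Real.sq_sqrt hc]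
  have hmul : ‖z - 2 * √c‖ * ‖z + 2 * √c‖ = ‖z ^ 2 - 4 * c‖ := by
    rw [← norm_mul]
    congr 1
    linear_combination (-4 : ℂ) * hsq
  rw [norm_two_mul_sqrt] at hpar
  linear_combination hpar + 2 * hmul + 8 * Real.sq_sqrt hc

lemma joukowskyRadius_add (hc : 0 ≤ c) {r r' : ℂ} (hmul : r * r' = c) (hle : ‖r'‖ ≤ ‖r‖) :
    joukowskyRadius c (r + r') = ‖r‖ := by
  have hnorm : ‖r‖ * ‖r'‖ = c := by rw [← norm_mul, hmul, Complex.norm_of_nonneg hc]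
  have hsum : (‖r + r' - 2 * √c‖ + ‖r + r' + 2 * √c‖) / 2 = ‖r‖ + ‖r'‖ := by
    have hdisc : ‖(r + r') ^ 2 - 4 * c‖ = ‖r - r'‖ ^ 2 := by
      rw [← norm_pow]
      congr 1
      linear_combination 4 * hmul
    rw [div_eq_iff two_ne_zero, ← sq_eq_sq₀ (by positivity) (by positivity),
      sq_norm_sub_add_norm_add hc, hdisc]
    linear_combination 2 * parallelogram_law_with_norm ℝ r r' - 8 * hnorm
  rw [joukowskyRadius, hsum,
    show (‖r‖ + ‖r'‖) ^ 2 - 4 * c = (‖r‖ - ‖r'‖) ^ 2 by linear_combination 4 * hnorm,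
    Real.sqrt_sq (sub_nonneg.2 hle)]
  ring

lemma norm_le_semiaxis (c : ℝ) (z : ℂ) : ‖z‖ ≤ (‖z - 2 * √c‖ + ‖z + 2 * √c‖) / 2 := by
  have := norm_add_le (z - 2 * √c) (z + 2 * √c)
  rw [show z - 2 * √c + (z + 2 * √c) = 2 * z by ring, norm_mul, Complex.norm_ofNat] at this
  linarith

lemma half_norm_le_joukowskyRadius (c : ℝ) (z : ℂ) : ‖z‖ / 2 ≤ joukowskyRadius c z := by
  have := norm_le_semiaxis c z
  unfold joukowskyRadius
  gcongr
  exact this.trans (le_add_of_nonneg_right (Real.sqrt_nonneg _))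

lemma sqrt_le_joukowskyRadius (c : ℝ) (z : ℂ) : √c ≤ joukowskyRadius c z := by
  have h := norm_sub_le (z + 2 * √c) (z - 2 * √c)
  rw [show z + 2 * √c - (z - 2 * √c) = 2 * (2 * √c) by ring, norm_mul, norm_two_mul_sqrt,
    Complex.norm_ofNat] at h
  unfold joukowskyRadius
  linarith [Real.sqrt_nonneg (((‖z - 2 * √c‖ + ‖z + 2 * √c‖) / 2) ^ 2 - 4 * c)]

lemma joukowskyRadius_le (hc : 0 ≤ c) (z : ℂ) : joukowskyRadius c z ≤ ‖z‖ + 2 * √c := by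
  have h1 := norm_sub_le z (2 * √c)
  have h2 := norm_add_le z (2 * √c)
  rw [norm_two_mul_sqrt] at h1 h2
  have hsqrt : √(((‖z - 2 * √c‖ + ‖z + 2 * √c‖) / 2) ^ 2 - 4 * c) ≤
      (‖z - 2 * √c‖ + ‖z + 2 * √c‖) / 2 :=
    (Real.sqrt_le_left (by positivity)).2 (by linarith)
  unfold joukowskyRadius
  linarith

lemma joukowskyRadius_zero (hc : 0 ≤ c) : joukowskyRadius c 0 = √c := by
  have hI : (√c * Complex.I) * -(√c * Complex.I) = c := by
    rw [← Complex.ofReal_inj.2 (Real.mul_self_sqrt hc), Complex.ofReal_mul]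
    linear_combination -(√c : ℂ) ^ 2 * Complex.I_sq
  rw [← add_neg_cancel (√c * Complex.I), joukowskyRadius_add hc hI (norm_neg _).le, norm_mul,
    Complex.norm_I, mul_one, Complex.norm_of_nonneg (Real.sqrt_nonneg c)]

lemma joukowskyRadius_neg (c : ℝ) (z : ℂ) : joukowskyRadius c (-z) = joukowskyRadius c z := by
  unfold joukowskyRadius
  rw [show -z - 2 * √c = -(z + 2 * √c) by ring, show -z + 2 * √c = -(z - 2 * √c) by ring,
    norm_neg, norm_neg, add_comm ‖z + 2 * √c‖]

lemma continuous_joukowskyRadius : Continuous fun p : ℝ × ℂ => joukowskyRadius p.1 p.2 := by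
  unfold joukowskyRadius
  have : Continuous fun p : ℝ × ℂ => ((√p.1 : ℝ) : ℂ) :=
    Complex.continuous_ofReal.comp (Real.continuous_sqrt.comp continuous_fst)
  fun_prop

lemma abs_im_le_joukowskyRadius (hc : 0 ≤ c) (z : ℂ) : |z.im| ≤ joukowskyRadius c z := by
  have hsq := sq_norm_sub_add_norm_add hc z
  have hre : 4 * c + z.im ^ 2 - z.re ^ 2 ≤ ‖z ^ 2 - 4 * c‖ := by
    have := (neg_le_abs _).trans (Complex.abs_re_le_norm (z ^ 2 - 4 * c))
    simp only [sq, Complex.sub_re, Complex.mul_re, Complex.ofReal_re, Complex.ofReal_im,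
      Complex.re_ofNat, Complex.im_ofNat] at this ⊢
    linarith
  have him : |z.im| ≤ √(((‖z - 2 * √c‖ + ‖z + 2 * √c‖) / 2) ^ 2 - 4 * c) := by
    refine Real.le_sqrt_of_sq_le ?_
    rw [sq_abs, div_pow, hsq, Complex.sq_norm, Complex.normSq_apply]
    linarith
  have := (Complex.abs_im_le_norm z).trans (norm_le_semiaxis c z)
  unfold joukowskyRadius
  linarith

end JoukowskyRadius

/-- The root of `r² - z r + c = 0` in the upper half-plane, for `Im z > 0` and `c ≥ 0`. -/
def upperRoot (z : ℂ) (c : ℝ) : ℂ := (z + Complex.I * Complex.sqrt (4 * c - z ^ 2)) / 2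

lemma im_sub_div (z : ℂ) (c : ℝ) (h : ℂ) : (z - c / h).im = z.im + c * h.im / ‖h‖ ^ 2 := by
  rw [Complex.sub_im, Complex.div_im, Complex.sq_norm]
  simp

lemma ne_zero_of_im_pos {z : ℂ} (hz : 0 < z.im) : z ≠ 0 := by
  rintro rfl
  exact hz.ne rfl

lemma le_im_sub_div (z : ℂ) {h : ℂ} {c : ℝ} (hc : 0 ≤ c) (hh : 0 ≤ h.im) :
    z.im ≤ (z - c / h).im := by
  rw [im_sub_div]
  exact le_add_of_nonneg_right (by positivity)

section UpperRoot

variable {z : ℂ} (hz : 0 < z.im) {c : ℝ}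

include hz

lemma discriminant_mem_slitPlane (hc : 0 ≤ c) : (4 * c - z ^ 2 : ℂ) ∈ Complex.slitPlane := by
  have hre : (4 * c - z ^ 2 : ℂ).re = 4 * c - z.re ^ 2 + z.im ^ 2 := by
    simp only [sq, Complex.sub_re, Complex.mul_re, Complex.re_ofNat, Complex.ofReal_re,
      Complex.im_ofNat, Complex.ofReal_im, mul_zero, sub_zero]
    ring
  have him : (4 * c - z ^ 2 : ℂ).im = -(2 * z.re * z.im) := by
    simp only [sq, Complex.sub_im, Complex.mul_im, Complex.re_ofNat, Complex.ofReal_im, mul_zero,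
      Complex.im_ofNat, Complex.ofReal_re, zero_mul, add_zero, zero_sub]
    ring
  rw [Complex.mem_slitPlane_iff, hre, him]
  by_cases hx : z.re = 0
  · exact .inl (by nlinarith [pow_pos hz 2])
  · exact .inr (neg_ne_zero.2 (by positivity))

lemma continuousOn_upperRoot : ContinuousOn (upperRoot z) (Set.Ici 0) :=
  (continuousOn_const.add (continuousOn_const.mul (ContinuousOn.cpow_const (by fun_prop)
    fun _ hc => discriminant_mem_slitPlane hz hc))).div_const _

lemma upperRoot_im_pos (c : ℝ) : 0 < (upperRoot z c).im := by
  have hre : 0 ≤ (Complex.sqrt (4 * c - z ^ 2)).re := by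
    rw [Complex.sqrt, Complex.cpow_inv_two_re]
    positivity
  have : (upperRoot z c).im = (z.im + (Complex.sqrt (4 * c - z ^ 2)).re) / 2 := by
    simp [upperRoot]
  rw [this]
  positivity

lemma upperRoot_fixed (c : ℝ) : z - c / upperRoot z c = upperRoot z c := by
  have h0 := ne_zero_of_im_pos (upperRoot_im_pos hz c)
  have hsqrt : Complex.sqrt (4 * c - z ^ 2) ^ 2 = 4 * c - z ^ 2 :=
    Complex.cpow_ofNat_inv_pow _ 2
  have hroot : upperRoot z c ^ 2 - z * upperRoot z c + c = 0 := by
    unfold upperRoot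
    linear_combination (-1 / 4 : ℂ) * hsqrt +
      (1 / 4 : ℂ) * Complex.sqrt (4 * c - z ^ 2) ^ 2 * Complex.I_sq
  field_simp
  linear_combination -hroot

lemma upperRoot_zero : upperRoot z 0 = z := by
  simpa using (upperRoot_fixed hz 0).symm

lemma le_im_upperRoot (hc : 0 ≤ c) : z.im ≤ (upperRoot z c).im :=
  (le_im_sub_div z hc (upperRoot_im_pos hz c).le).trans_eq (by rw [upperRoot_fixed hz])

lemma joukowskyRadius_eq_norm_upperRoot (hc : 0 ≤ c) : joukowskyRadius c z = ‖upperRoot z c‖ := by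
  have him := upperRoot_im_pos hz c
  have h0 := ne_zero_of_im_pos him
  have hpos : 0 < ‖upperRoot z c‖ := norm_pos_iff.2 h0
  have hc' : c ≤ ‖upperRoot z c‖ ^ 2 := by
    have hi := congrArg Complex.im (upperRoot_fixed hz c)
    rw [im_sub_div] at hi
    have : c * (upperRoot z c).im / ‖upperRoot z c‖ ^ 2 < 1 * (upperRoot z c).im := by linarith
    rw [mul_div_right_comm] at this
    exact ((div_lt_one (by positivity)).1 (lt_of_mul_lt_mul_right this him.le)).le
  have hle : ‖c / upperRoot z c‖ ≤ ‖upperRoot z c‖ := by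
    rw [norm_div, Complex.norm_of_nonneg hc, div_le_iff₀ hpos, ← sq]
    exact hc'
  rw [← joukowskyRadius_add hc (mul_div_cancel₀ _ h0) hle, ← sub_eq_iff_eq_add.1
    (upperRoot_fixed hz c)]

end UpperRoot

/-! ### Asymptotics of Hermite polynomials off the real line -/

/-- The quantity `4 sinh² (d / 2)`, with `d` the hyperbolic distance of two points of the upper
half-plane. -/
def hyperbolicGap (h r : ℂ) : ℝ := ‖h - r‖ ^ 2 / (h.im * r.im)

lemma hyperbolicGap_self (h : ℂ) : hyperbolicGap h h = 0 := by simp [hyperbolicGap]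

lemma hyperbolicGap_sub_div {z h r : ℂ} (hz : 0 < z.im) (hh : 0 < h.im) (hr : 0 < r.im) {c : ℝ}
    (hc : 0 ≤ c) : hyperbolicGap (z - c / h) (z - c / r) =
      (z - c / h).im⁻¹ * (c * h.im / ‖h‖ ^ 2) * ((z - c / r).im⁻¹ * (c * r.im / ‖r‖ ^ 2)) *
        hyperbolicGap h r := by
  have hh0 : h ≠ 0 := ne_zero_of_im_pos hh
  have hr0 : r ≠ 0 := ne_zero_of_im_pos hr
  have hsub : z - c / h - (z - c / r) = c * (h - r) / (h * r) := by
    field_simp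
    ring
  rw [hyperbolicGap, hyperbolicGap, hsub, norm_div, norm_mul, norm_mul, Complex.norm_of_nonneg hc]
  have := hz.trans_le (le_im_sub_div z hc hh.le)
  have := hz.trans_le (le_im_sub_div z hc hr.le)
  have : 0 < ‖h‖ := norm_pos_iff.2 hh0
  have : 0 < ‖r‖ := norm_pos_iff.2 hr0
  field_simp

lemma hyperbolicGap_sub_div_le {z h r : ℂ} (hz : 0 < z.im) (hh : z.im ≤ h.im) (hr : z.im ≤ r.im)
    {c t : ℝ} (hc : c ∈ Set.Icc 0 t) :
    hyperbolicGap (z - c / h) (z - c / r) ≤ t / (z.im ^ 2 + t) * hyperbolicGap h r := by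
  have ht : 0 ≤ t := hc.1.trans hc.2
  have hh0 : 0 < h.im := hz.trans_le hh
  have hr0 : 0 < r.im := hz.trans_le hr
  have him : h.im ≤ ‖h‖ := (le_abs_self _).trans (Complex.abs_im_le_norm h)
  have hhp : 0 < ‖h‖ := hh0.trans_le him
  have hp : c * h.im / ‖h‖ ^ 2 * z.im ≤ t := by
    rw [div_mul_eq_mul_div, div_le_iff₀ (by positivity)]
    calc c * h.im * z.im ≤ t * ‖h‖ * ‖h‖ := by
          gcongr
          exacts [hc.2, hh.trans him]
      _ = t * ‖h‖ ^ 2 := by ring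
  have hgap0 : 0 ≤ hyperbolicGap h r := div_nonneg (sq_nonneg _) (by positivity)
  rw [hyperbolicGap_sub_div hz hh0 hr0 hc.1, im_sub_div, im_sub_div]
  have hp0 : 0 ≤ c * h.im / ‖h‖ ^ 2 := div_nonneg (mul_nonneg hc.1 hh0.le) (sq_nonneg _)
  have hp0' : 0 ≤ c * r.im / ‖r‖ ^ 2 := div_nonneg (mul_nonneg hc.1 hr0.le) (sq_nonneg _)
  generalize c * h.im / ‖h‖ ^ 2 = p at *
  generalize c * r.im / ‖r‖ ^ 2 = p' at *
  have hfactor : (z.im + p)⁻¹ * p ≤ t / (z.im ^ 2 + t) := by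
    rw [inv_mul_eq_div, div_le_div_iff₀ (by positivity) (by positivity)]
    nlinarith
  have hfactor' : (z.im + p')⁻¹ * p' ≤ 1 := by
    rw [inv_mul_eq_div]
    exact div_le_one_of_le₀ (by linarith) (by positivity)
  gcongr
  exact (mul_le_of_le_one_right (by positivity) hfactor').trans hfactor

lemma natCast_mul_div_mem_Icc {t : ℝ} (ht : 0 ≤ t) {n k : ℕ} (hk : k ≤ n) :
    t / n * k ∈ Set.Icc 0 t := by
  refine ⟨by positivity, ?_⟩
  rw [div_mul_eq_mul_div, mul_div_assoc]
  exact mul_le_of_le_one_right ht (div_le_one_of_le₀ (by exact_mod_cast hk) n.cast_nonneg)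

/-- A compact subset of the upper half-plane that contains the image of `{h | Im z ≤ Im h}` under
`h ↦ z - c / h`, for `c ∈ [0, t]`. -/
def ratioRegion (t : ℝ) (z : ℂ) : Set ℂ :=
  {h | z.im ≤ h.im} ∩ Metric.closedBall 0 (‖z‖ + t / z.im)

lemma isCompact_ratioRegion (t : ℝ) (z : ℂ) : IsCompact (ratioRegion t z) :=
  (isCompact_closedBall _ _).inter_left (isClosed_le continuous_const Complex.continuous_im)

/-- Ratios of consecutive Hermite polynomials. -/
def hermiteRatio (s : ℝ) (z : ℂ) (k : ℕ) : ℂ :=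
  (hermitePoly s (k + 1)).eval z / (hermitePoly s k).eval z

lemma hermiteRatio_zero (s : ℝ) (z : ℂ) : hermiteRatio s z 0 = z := by
  simp [hermiteRatio, hermitePoly_zero, hermitePoly_one]

lemma hermiteRatio_succ {s : ℝ} {z : ℂ} {k : ℕ} (h : (hermitePoly s (k + 1)).eval z ≠ 0) :
    hermiteRatio s z (k + 1) = z - (s * (k + 1 : ℕ) : ℝ) / hermiteRatio s z k := by
  rw [hermiteRatio, hermiteRatio, hermitePoly_add_two]
  simp only [eval_sub, eval_mul, eval_X, eval_C]
  push_cast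
  field_simp

section UpperHalfPlane

variable {z : ℂ} (hz : 0 < z.im) {t : ℝ}

include hz

lemma sub_div_mem_ratioRegion {h : ℂ} (hh : z.im ≤ h.im) {c : ℝ} (hc : c ∈ Set.Icc 0 t) :
    z - c / h ∈ ratioRegion t z := by
  refine ⟨le_im_sub_div z hc.1 (hz.le.trans hh), mem_closedBall_zero_iff.2 ?_⟩
  have him : z.im ≤ ‖h‖ := hh.trans ((le_abs_self _).trans (Complex.abs_im_le_norm h))
  have ht : 0 ≤ t := hc.1.trans hc.2
  calc ‖z - c / h‖ ≤ ‖z‖ + ‖(c : ℂ) / h‖ := norm_sub_le _ _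
    _ = ‖z‖ + c / ‖h‖ := by rw [norm_div, Complex.norm_of_nonneg hc.1]
    _ ≤ ‖z‖ + t / z.im := by
        gcongr
        exact hc.2

lemma upperRoot_mem_ratioRegion {c : ℝ} (hc : c ∈ Set.Icc 0 t) :
    upperRoot z c ∈ ratioRegion t z := by
  rw [← upperRoot_fixed hz]
  exact sub_div_mem_ratioRegion hz (le_im_upperRoot hz hc.1) hc

lemma hermitePoly_eval_ne_zero_and_le_im_hermiteRatio {s : ℝ} (hs : 0 ≤ s) (k : ℕ) :
    (hermitePoly s k).eval z ≠ 0 ∧ z.im ≤ (hermiteRatio s z k).im := by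
  induction k with
  | zero => simp [hermitePoly_zero, hermiteRatio_zero]
  | succ k ih =>
    have hpos : 0 < (hermiteRatio s z k).im := hz.trans_le ih.2
    have hne : (hermitePoly s (k + 1)).eval z ≠ 0 := (div_ne_zero_iff.1 (ne_zero_of_im_pos hpos)).1
    refine ⟨hne, ?_⟩
    rw [hermiteRatio_succ hne]
    exact le_im_sub_div z (by positivity) hpos.le

lemma hermitePoly_eval_ne_zero {s : ℝ} (hs : 0 ≤ s) (k : ℕ) : (hermitePoly s k).eval z ≠ 0 :=
  (hermitePoly_eval_ne_zero_and_le_im_hermiteRatio hz hs k).1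

lemma le_im_hermiteRatio {s : ℝ} (hs : 0 ≤ s) (k : ℕ) : z.im ≤ (hermiteRatio s z k).im :=
  (hermitePoly_eval_ne_zero_and_le_im_hermiteRatio hz hs k).2

lemma log_norm_hermitePoly_eval {s : ℝ} (hs : 0 ≤ s) (k : ℕ) :
    Real.log ‖(hermitePoly s k).eval z‖ = ∑ j ∈ Finset.range k, Real.log ‖hermiteRatio s z j‖ := by
  have hne := fun j => norm_ne_zero_iff.2 (hermitePoly_eval_ne_zero hz hs j)
  rw [Finset.sum_congr rfl fun j _ => by
    rw [hermiteRatio, norm_div, Real.log_div (hne _) (hne _)], Finset.sum_range_sub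
    fun j => Real.log ‖(hermitePoly s j).eval z‖]
  simp [hermitePoly_zero]

lemma eventually_hyperbolicGap_upperRoot_le {δ : ℝ} (hδ : 0 < δ) :
    ∀ᶠ n : ℕ in atTop, ∀ h ∈ ratioRegion t z, ∀ x ∈ Set.Icc 0 t, ∀ y ∈ Set.Icc 0 t,
      |x - y| ≤ t / n →
        hyperbolicGap h (upperRoot z y) ≤ hyperbolicGap h (upperRoot z x) + δ := by
  have hcont : ContinuousOn (fun p : ℂ × ℝ => hyperbolicGap p.1 (upperRoot z p.2))
      (ratioRegion t z ×ˢ Set.Icc 0 t) := by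
    have hroot : ContinuousOn (fun p : ℂ × ℝ => upperRoot z p.2)
        (ratioRegion t z ×ˢ Set.Icc 0 t) :=
      (continuousOn_upperRoot hz).comp continuousOn_snd fun p hp => hp.2.1
    refine ContinuousOn.div ((continuousOn_fst.sub hroot).norm.pow 2)
      ((Complex.continuous_im.comp_continuousOn continuousOn_fst).mul
        (Complex.continuous_im.comp_continuousOn hroot)) fun p hp => ?_
    exact (mul_pos (hz.trans_le hp.1.1) (upperRoot_im_pos hz _)).ne'
  obtain ⟨d, hd, huc⟩ := Metric.uniformContinuousOn_iff.1
    (((isCompact_ratioRegion t z).prod isCompact_Icc).uniformContinuousOn_of_continuous hcont) δ hδ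
  filter_upwards [(tendsto_const_div_atTop_nhds_zero_nat t).eventually_lt_const hd]
    with n hn h hh x hx y hy hxy
  have := huc (h, y) ⟨hh, hy⟩ (h, x) ⟨hh, hx⟩ (by
    rw [Prod.dist_eq, dist_self, max_eq_right dist_nonneg, dist_comm, Real.dist_eq]
    exact hxy.trans_lt hn)
  rw [Real.dist_eq] at this
  linarith [le_abs_self (hyperbolicGap h (upperRoot z y) - hyperbolicGap h (upperRoot z x))]

lemma hermiteRatio_mem_ratioRegion (ht : 0 ≤ t) {n k : ℕ} (hk : k ≤ n) :
    hermiteRatio (t / n) z k ∈ ratioRegion t z := by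
  have hs : 0 ≤ t / n := by positivity
  cases k with
  | zero => 
    have := sub_div_mem_ratioRegion hz le_rfl (Set.left_mem_Icc.2 ht)
    simpa [hermiteRatio_zero] using this
  | succ k =>
    rw [hermiteRatio_succ (hermitePoly_eval_ne_zero hz hs _)]
    exact sub_div_mem_ratioRegion hz (le_im_hermiteRatio hz hs k) (natCast_mul_div_mem_Icc ht hk)

lemma eventually_hyperbolicGap_hermiteRatio_le (ht : 0 ≤ t) {δ : ℝ} (hδ : 0 < δ) :
    ∀ᶠ n : ℕ in atTop, ∀ k ≤ n,
      hyperbolicGap (hermiteRatio (t / n) z k) (upperRoot z (t / n * k)) ≤ δ := by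
  set κ := t / (z.im ^ 2 + t)
  have hκ0 : 0 ≤ κ := by positivity
  have hκ1 : 0 < 1 - κ := sub_pos.2 ((div_lt_one (by positivity)).2 (by linarith [pow_pos hz 2]))
  filter_upwards [eventually_hyperbolicGap_upperRoot_le (t := t) hz (mul_pos hκ1 hδ)] with n hn k
  have hs : 0 ≤ t / n := by positivity
  induction k with
  | zero => simp [hermiteRatio_zero, upperRoot_zero hz, hyperbolicGap_self, hδ.le]
  | succ k ih =>
    intro hk
    have hmem := natCast_mul_div_mem_Icc ht hk
    have hmem' := natCast_mul_div_mem_Icc ht (k.le_succ.trans hk)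
    have hstep := hn _ (hermiteRatio_mem_ratioRegion hz ht (k.le_succ.trans hk)) _ hmem' _ hmem (by
      rw [← mul_sub, abs_mul, abs_of_nonneg hs]
      simp)
    calc _ = hyperbolicGap (z - (t / n * (k + 1 : ℕ) : ℝ) / hermiteRatio (t / n) z k)
          (z - (t / n * (k + 1 : ℕ) : ℝ) / upperRoot z (t / n * (k + 1 : ℕ))) := by
          rw [upperRoot_fixed hz, hermiteRatio_succ (hermitePoly_eval_ne_zero hz hs _)]
      _ ≤ κ * hyperbolicGap (hermiteRatio (t / n) z k) (upperRoot z (t / n * (k + 1 : ℕ))) :=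
          hyperbolicGap_sub_div_le hz (le_im_hermiteRatio hz hs k) (le_im_upperRoot hz hmem.1) hmem
      _ ≤ κ * (δ + (1 - κ) * δ) := mul_le_mul_of_nonneg_left
          (hstep.trans (add_le_add_left (ih (k.le_succ.trans hk)) _)) hκ0
      _ ≤ δ := by nlinarith [mul_nonneg hδ.le (sq_nonneg (1 - κ))]

lemma abs_log_norm_sub_log_norm_le {h r : ℂ} (hh : h ∈ ratioRegion t z) (hr : r ∈ ratioRegion t z) :
    |Real.log ‖h‖ - Real.log ‖r‖| ≤ (‖z‖ + t / z.im) / z.im * √(hyperbolicGap h r) := by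
  have him : ∀ w ∈ ratioRegion t z, z.im ≤ ‖w‖ := fun w hw =>
    hw.1.trans ((le_abs_self _).trans (Complex.abs_im_le_norm w))
  have hle : ∀ w ∈ ratioRegion t z, w.im ≤ ‖z‖ + t / z.im := fun w hw =>
    ((le_abs_self _).trans (Complex.abs_im_le_norm w)).trans (mem_closedBall_zero_iff.1 hw.2)
  have hh0 : 0 < h.im := hz.trans_le hh.1
  have hr0 : 0 < r.im := hz.trans_le hr.1
  have hB : 0 ≤ ‖z‖ + t / z.im := hh0.le.trans (hle h hh)
  have hdist : ‖h - r‖ ≤ (‖z‖ + t / z.im) * √(hyperbolicGap h r) := by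
    rw [← Real.sqrt_sq hB, ← Real.sqrt_mul (sq_nonneg _)]
    refine Real.le_sqrt_of_sq_le ?_
    calc ‖h - r‖ ^ 2 = h.im * r.im * hyperbolicGap h r := by
          rw [hyperbolicGap]
          field_simp
      _ ≤ (‖z‖ + t / z.im) ^ 2 * hyperbolicGap h r := by
          rw [sq]
          gcongr
          exacts [div_nonneg (sq_nonneg _) (by positivity), hle h hh, hle r hr]
  refine (abs_log_sub_log_le hz (him h hh) (him r hr)).trans ?_
  rw [div_mul_eq_mul_div]
  gcongr
  exact (abs_norm_sub_norm_le _ _).trans hdist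

lemma eventually_abs_log_hermiteRatio_sub_le (ht : 0 ≤ t) {ε : ℝ} (hε : 0 < ε) :
    ∀ᶠ n : ℕ in atTop, ∀ k ≤ n, ∀ x ∈ Set.Icc 0 t, |t / n * k - x| ≤ t / n →
      |Real.log ‖hermiteRatio (t / n) z k‖ - Real.log ‖upperRoot z x‖| ≤ ε := by
  obtain ⟨δ, hδ, hδε⟩ : ∃ δ > 0, (‖z‖ + t / z.im) / z.im * √(δ + δ) ≤ ε := by
    have hcont : Tendsto (fun δ => (‖z‖ + t / z.im) / z.im * √(δ + δ)) (𝓝[>] 0) (𝓝 0) := by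
      refine tendsto_nhdsWithin_of_tendsto_nhds (Continuous.tendsto' (by fun_prop) _ _ (by simp))
    exact ((eventually_mem_nhdsWithin.and (hcont.eventually_le_const hε)).exists)
  filter_upwards [eventually_hyperbolicGap_hermiteRatio_le hz ht hδ,
    eventually_hyperbolicGap_upperRoot_le (t := t) hz hδ] with n hgap hroot k hk x hx hkx
  have hmem := hermiteRatio_mem_ratioRegion hz ht hk
  refine (abs_log_norm_sub_log_norm_le hz hmem (upperRoot_mem_ratioRegion hz hx)).trans
    (le_trans ?_ hδε)
  have : 0 ≤ t / z.im := by positivity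
  gcongr
  exact (hroot _ hmem _ (natCast_mul_div_mem_Icc ht hk) x hx hkx).trans (by gcongr; exact hgap k hk)

end UpperHalfPlane

lemma abs_sum_div_sub_integral_le {f : ℝ → ℝ} {c : ℕ → ℝ} {k n : ℕ} {ε : ℝ} (hn : 0 < n)
    (hf : ContinuousOn f (Set.Icc 0 (k / n)))
    (h : ∀ j < k, ∀ x ∈ Set.Icc (j / n : ℝ) ((j + 1 : ℕ) / n), |c j - f x| ≤ ε) :
    |1 / (n : ℝ) * ∑ j ∈ Finset.range k, c j - ∫ x in (0 : ℝ)..(k / n), f x| ≤ k / n * ε := by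
  have hle : ∀ j : ℕ, (j / n : ℝ) ≤ (j + 1 : ℕ) / n := fun j => by
    gcongr
    exact j.le_succ
  have hint : ∀ j < k, IntervalIntegrable f volume (j / n) ((j + 1 : ℕ) / n) := fun j hj => by
    refine (hf.mono ?_).intervalIntegrable_of_Icc (hle j)
    exact Set.Icc_subset_Icc (by positivity) (by gcongr; exact hj)
  have hterm : ∀ j ∈ Finset.range k,
      |1 / (n : ℝ) * c j - ∫ x in (j / n : ℝ)..((j + 1 : ℕ) / n), f x| ≤ ε * (1 / n) := by
    intro j hj
    have hj := Finset.mem_range.1 hj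
    have hlen : ((j + 1 : ℕ) / n - j / n : ℝ) = 1 / n := by
      push_cast
      ring
    have hconst : 1 / (n : ℝ) * c j = ∫ _ in (j / n : ℝ)..((j + 1 : ℕ) / n), c j := by
      rw [intervalIntegral.integral_const, hlen, smul_eq_mul]
    rw [hconst, ← intervalIntegral.integral_sub intervalIntegrable_const (hint j hj),
      ← Real.norm_eq_abs]
    refine (intervalIntegral.norm_integral_le_of_norm_le_const fun x hx => ?_).trans_eq
      (by rw [hlen, abs_of_nonneg (by positivity)])
    rw [Set.uIoc_of_le (hle j)] at hx
    exact h j hj x (Set.Ioc_subset_Icc_self hx)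
  have hsum := intervalIntegral.sum_integral_adjacent_intervals (a := fun j : ℕ => (j / n : ℝ)) hint
  simp only [Nat.cast_zero, zero_div] at hsum
  rw [← hsum, Finset.mul_sum, ← Finset.sum_sub_distrib]
  refine (Finset.abs_sum_le_sum_abs _ _).trans ((Finset.sum_le_sum hterm).trans_eq ?_)
  rw [Finset.sum_const, Finset.card_range, nsmul_eq_mul]
  ring

/-- The limit of `(1/n) log |He_k(z; t/n)|` as `k/n → α`. -/
def hermitePot (t α : ℝ) (z : ℂ) : ℝ := ∫ β in (0 : ℝ)..α, Real.log (joukowskyRadius (t * β) z)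

lemma hermitePot_neg (t α : ℝ) (z : ℂ) : hermitePot t α (-z) = hermitePot t α z := by
  unfold hermitePot
  simp_rw [joukowskyRadius_neg]

lemma hermitePot_eq_integral_upperRoot {z : ℂ} (hz : 0 < z.im) {t α : ℝ} (ht : 0 ≤ t)
    (hα : 0 ≤ α) : hermitePot t α z = ∫ β in (0 : ℝ)..α, Real.log ‖upperRoot z (t * β)‖ := by
  refine intervalIntegral.integral_congr fun β hβ => ?_
  rw [Set.uIcc_of_le hα] at hβ
  simp only [joukowskyRadius_eq_norm_upperRoot hz (mul_nonneg ht hβ.1)]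

lemma eventually_abs_log_hermitePoly_sub_le_of_im_pos {z : ℂ} (hz : 0 < z.im) {t : ℝ} (ht : 0 ≤ t)
    {ε : ℝ} (hε : 0 < ε) :
    ∀ᶠ n : ℕ in atTop, ∀ k ≤ n, (hermitePoly (t / n : ℝ) k).eval z ≠ 0 ∧
      |1 / (n : ℝ) * Real.log ‖(hermitePoly (t / n : ℝ) k).eval z‖ - hermitePot t (k / n) z| ≤
        ε := by
  have hlog : ContinuousOn (fun β => Real.log ‖upperRoot z (t * β)‖) (Set.Ici 0) :=
    ((continuousOn_upperRoot hz).comp (by fun_prop) fun β hβ => mul_nonneg ht hβ).norm.log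
      fun β _ => norm_ne_zero_iff.2 (ne_zero_of_im_pos (upperRoot_im_pos hz _))
  filter_upwards [eventually_abs_log_hermiteRatio_sub_le hz ht hε, eventually_gt_atTop 0]
    with n hratio hn k hk
  have hs : 0 ≤ t / n := by positivity
  have hn' : (0 : ℝ) < n := by exact_mod_cast hn
  have hkn : (k : ℝ) ≤ n := by exact_mod_cast hk
  refine ⟨hermitePoly_eval_ne_zero hz hs k, ?_⟩
  rw [log_norm_hermitePoly_eval hz hs, hermitePot_eq_integral_upperRoot hz ht (by positivity)]
  refine (abs_sum_div_sub_integral_le (ε := ε) hn (hlog.mono fun β hβ => hβ.1)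
    fun j hj β hβ => ?_).trans (mul_le_of_le_one_left hε.le (div_le_one_of_le₀ hkn hn'.le))
  have hβ0 : 0 ≤ β := le_trans (by positivity) hβ.1
  have hβ1 : β ≤ 1 := hβ.2.trans (div_le_one_of_le₀ (by exact_mod_cast hj.trans_le hk) hn'.le)
  refine hratio j (hj.le.trans hk) (t * β) ⟨by positivity, mul_le_of_le_one_right ht hβ1⟩ ?_
  rw [div_mul_eq_mul_div, mul_div_assoc, ← mul_sub, abs_mul, abs_of_nonneg ht, ← mul_one_div t]
  have hlen : ((j + 1 : ℕ) / n : ℝ) = j / n + 1 / n := by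
    push_cast
    ring
  gcongr
  rw [abs_le]
  constructor <;> linarith [hβ.1, hβ.2, one_div_nonneg.2 hn'.le]

lemma eventually_abs_log_hermitePoly_sub_le {z : ℂ} (hz : z.im ≠ 0) {t : ℝ} (ht : 0 ≤ t)
    {ε : ℝ} (hε : 0 < ε) :
    ∀ᶠ n : ℕ in atTop, ∀ k ≤ n, (hermitePoly (t / n : ℝ) k).eval z ≠ 0 ∧
      |1 / (n : ℝ) * Real.log ‖(hermitePoly (t / n : ℝ) k).eval z‖ - hermitePot t (k / n) z| ≤
        ε := by
  rcases hz.lt_or_gt with h | h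
  · have h' : 0 < (-z).im := by simpa using h
    filter_upwards [eventually_abs_log_hermitePoly_sub_le_of_im_pos h' ht hε] with n hn k hk
    simpa [hermitePoly_eval_neg, hermitePot_neg] using hn k hk
  · exact eventually_abs_log_hermitePoly_sub_le_of_im_pos h ht hε

/-! ### The limiting potential -/

section

variable {t : ℝ}

lemma joukowskyRadius_pos {c : ℝ} (hc : 0 < c) (z : ℂ) : 0 < joukowskyRadius c z :=
  (Real.sqrt_pos.2 hc).trans_le (sqrt_le_joukowskyRadius c z)

lemma joukowskyRadius_zero_le {c : ℝ} (hc : 0 ≤ c) (z : ℂ) :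
    joukowskyRadius c 0 ≤ joukowskyRadius c z := by
  rw [joukowskyRadius_zero hc]
  exact sqrt_le_joukowskyRadius c z

lemma abs_log_joukowskyRadius_le (ht : 0 < t) {β : ℝ} (hβ : β ∈ Set.Ioc (0 : ℝ) 1) (z : ℂ) :
    |Real.log (joukowskyRadius (t * β) z)| ≤ |Real.log β| + (|Real.log t| + (‖z‖ + 2 * √t)) := by
  have hc : 0 < t * β := mul_pos ht hβ.1
  have lower : (Real.log t + Real.log β) / 2 ≤ Real.log (joukowskyRadius (t * β) z) := by
    rw [← Real.log_mul ht.ne' hβ.1.ne', ← Real.log_sqrt hc.le]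
    exact Real.log_le_log (Real.sqrt_pos.2 hc) (sqrt_le_joukowskyRadius _ z)
  have upper : Real.log (joukowskyRadius (t * β) z) ≤ ‖z‖ + 2 * √t := by
    have hlog := Real.log_le_sub_one_of_pos (joukowskyRadius_pos hc z)
    have hradius := joukowskyRadius_le hc.le z
    have hsqrt : √(t * β) ≤ √t := Real.sqrt_le_sqrt (mul_le_of_le_one_right ht.le hβ.2)
    linarith
  have : 0 ≤ ‖z‖ + 2 * √t := by positivity
  rw [abs_le]
  constructor <;>
    linarith [neg_abs_le (Real.log t), neg_abs_le (Real.log β), abs_nonneg (Real.log t),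
      abs_nonneg (Real.log β)]

lemma intervalIntegrable_abs_log_add (C a b : ℝ) :
    IntervalIntegrable (fun β => |Real.log β| + C) volume a b :=
  intervalIntegral.intervalIntegrable_log'.abs.add intervalIntegrable_const

lemma measurable_log_joukowskyRadius (t : ℝ) (z : ℂ) :
    Measurable fun β => Real.log (joukowskyRadius (t * β) z) :=
  Real.measurable_log.comp (continuous_joukowskyRadius.comp
    ((continuous_const.mul continuous_id).prodMk continuous_const)).measurable

lemma intervalIntegrable_log_joukowskyRadius (ht : 0 < t) (z : ℂ) {a b : ℝ}
    (ha : a ∈ Set.Icc (0 : ℝ) 1) (hb : b ∈ Set.Icc (0 : ℝ) 1) :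
    IntervalIntegrable (fun β => Real.log (joukowskyRadius (t * β) z)) volume a b := by
  refine (intervalIntegrable_abs_log_add (|Real.log t| + (‖z‖ + 2 * √t)) a b).mono_fun
    (measurable_log_joukowskyRadius t z).aestronglyMeasurable ?_
  rw [Filter.EventuallyLE, ae_restrict_iff' measurableSet_uIoc]
  refine ae_of_all _ fun β hβ => ?_
  rw [Set.uIoc, Set.mem_Ioc] at hβ
  exact (abs_log_joukowskyRadius_le ht ⟨(le_min ha.1 hb.1).trans_lt hβ.1,
    hβ.2.trans (max_le ha.2 hb.2)⟩ z).trans (le_abs_self _)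

lemma hermitePot_sub (ht : 0 < t) (z : ℂ) {a b : ℝ}
    (ha : a ∈ Set.Icc (0 : ℝ) 1) (hb : b ∈ Set.Icc (0 : ℝ) 1) :
    hermitePot t b z - hermitePot t a z =
      ∫ β in a..b, Real.log (joukowskyRadius (t * β) z) :=
  have h0 : (0 : ℝ) ∈ Set.Icc (0 : ℝ) 1 := Set.left_mem_Icc.2 zero_le_one
  intervalIntegral.integral_interval_sub_left (intervalIntegrable_log_joukowskyRadius ht z h0 hb)
    (intervalIntegrable_log_joukowskyRadius ht z h0 ha)

lemma continuousOn_hermitePot (ht : 0 < t) (z : ℂ) :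
    ContinuousOn (fun α => hermitePot t α z) (Set.Icc 0 1) := by
  have h := intervalIntegral.continuousOn_primitive_interval' (a := (0 : ℝ))
    (intervalIntegrable_log_joukowskyRadius ht z (a := 0) (b := 1) (by simp) (by simp)) (by simp)
  rwa [Set.uIcc_of_le zero_le_one] at h

/-- A modulus of continuity of the potentials `hermitePot t α`, uniform in `α ∈ [0, 1]`. -/
def hermitePotDist (t : ℝ) (z z' : ℂ) : ℝ :=
  ∫ β in (0 : ℝ)..1,
    |Real.log (joukowskyRadius (t * β) z) - Real.log (joukowskyRadius (t * β) z')|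

lemma abs_hermitePot_sub_le (ht : 0 < t) (z z' : ℂ) {α : ℝ} (hα : α ∈ Set.Icc (0 : ℝ) 1) :
    |hermitePot t α z - hermitePot t α z'| ≤ hermitePotDist t z z' := by
  have h0 : (0 : ℝ) ∈ Set.Icc (0 : ℝ) 1 := Set.left_mem_Icc.2 zero_le_one
  have h1 : (1 : ℝ) ∈ Set.Icc (0 : ℝ) 1 := Set.right_mem_Icc.2 zero_le_one
  unfold hermitePot hermitePotDist
  rw [← intervalIntegral.integral_sub (intervalIntegrable_log_joukowskyRadius ht z h0 hα)
    (intervalIntegrable_log_joukowskyRadius ht z' h0 hα)]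
  refine (intervalIntegral.abs_integral_le_integral_abs hα.1).trans ?_
  exact intervalIntegral.integral_mono_interval le_rfl hα.1 hα.2
    (ae_of_all _ fun _ => abs_nonneg _) ((intervalIntegrable_log_joukowskyRadius ht z h0 h1).sub
      (intervalIntegrable_log_joukowskyRadius ht z' h0 h1)).abs

lemma tendsto_hermitePotDist (ht : 0 < t) (z : ℂ) :
    Tendsto (fun z' => hermitePotDist t z' z) (𝓝 z) (𝓝 0) := by
  suffices Tendsto (fun z' => hermitePotDist t z' z) (𝓝 z)
      (𝓝 (∫ _ in (0 : ℝ)..1, (0 : ℝ))) by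
    rwa [intervalIntegral.integral_zero] at this
  refine intervalIntegral.tendsto_integral_filter_of_dominated_convergence
    (fun β => (|Real.log β| + (|Real.log t| + (‖z‖ + 1 + 2 * √t))) +
      (|Real.log β| + (|Real.log t| + (‖z‖ + 2 * √t)))) ?_ ?_
    ((intervalIntegrable_abs_log_add _ _ _).add (intervalIntegrable_abs_log_add _ _ _)) ?_
  · exact Eventually.of_forall fun z' => ((measurable_log_joukowskyRadius t z').sub
      (measurable_log_joukowskyRadius t z)).abs.aestronglyMeasurable
  · filter_upwards [Metric.ball_mem_nhds z one_pos] with z' hz'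
    refine ae_of_all _ fun β hβ => ?_
    rw [Set.uIoc_of_le zero_le_one] at hβ
    rw [Metric.mem_ball, dist_eq_norm] at hz'
    rw [Real.norm_eq_abs, abs_abs]
    refine (abs_sub _ _).trans ?_
    linarith [abs_log_joukowskyRadius_le ht hβ z', abs_log_joukowskyRadius_le ht hβ z,
      norm_le_norm_add_norm_sub' z' z]
  · refine ae_of_all _ fun β hβ => ?_
    rw [Set.uIoc_of_le zero_le_one] at hβ
    have hpos := joukowskyRadius_pos (mul_pos ht hβ.1) z
    have hcont : Tendsto (joukowskyRadius (t * β)) (𝓝 z) (𝓝 (joukowskyRadius (t * β) z)) :=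
      (continuous_joukowskyRadius.comp (Continuous.prodMk_right (t * β))).tendsto z
    simpa only [sub_self, abs_zero] using
      ((hcont.log hpos.ne').sub_const (Real.log (joukowskyRadius (t * β) z))).abs

lemma continuous_of_abs_sub_le_hermitePotDist {U : ℂ → ℝ} (ht : 0 < t)
    (hU : ∀ z z', |U z - U z'| ≤ hermitePotDist t z z') : Continuous U :=
  continuous_iff_continuousAt.2 fun z => tendsto_iff_dist_tendsto_zero.2 <|
    squeeze_zero (fun _ => dist_nonneg) (fun z' => hU z' z) (tendsto_hermitePotDist ht z)

lemma continuous_hermitePot (ht : 0 < t) {α : ℝ} (hα : α ∈ Set.Icc (0 : ℝ) 1) :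
    Continuous (hermitePot t α) :=
  continuous_of_abs_sub_le_hermitePotDist ht fun z w => abs_hermitePot_sub_le ht z w hα

/-- The maximum over `α ∈ [0, 1]` of `g α + hermitePot t α z`: the exponential growth rate at `z`
of the largest summand of the evolved polynomial, and the potential of its limiting zeros. -/
def limitPot (t : ℝ) (g : ℝ → ℝ) (z : ℂ) : ℝ :=
  sSup ((fun α => g α + hermitePot t α z) '' Set.Icc 0 1)

variable {g : ℝ → ℝ}

lemma exists_limitPot_eq (ht : 0 < t) (hg : ContinuousOn g (Set.Icc 0 1)) (z : ℂ) :
    ∃ α ∈ Set.Icc (0 : ℝ) 1, limitPot t g z = g α + hermitePot t α z :=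
  isCompact_Icc.exists_sSup_image_eq (Set.nonempty_Icc.2 zero_le_one)
    (hg.add (continuousOn_hermitePot ht z))

lemma le_limitPot (ht : 0 < t) (hg : ContinuousOn g (Set.Icc 0 1)) (z : ℂ) {α : ℝ}
    (hα : α ∈ Set.Icc (0 : ℝ) 1) : g α + hermitePot t α z ≤ limitPot t g z :=
  le_csSup (isCompact_Icc.image_of_continuousOn
    (hg.add (continuousOn_hermitePot ht z))).bddAbove (Set.mem_image_of_mem _ hα)

lemma limitPot_eq_of_forall_le (ht : 0 < t) (hg : ContinuousOn g (Set.Icc 0 1)) {z : ℂ} {α : ℝ}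
    (hα : α ∈ Set.Icc (0 : ℝ) 1)
    (h : ∀ β ∈ Set.Icc (0 : ℝ) 1, g β + hermitePot t β z ≤ g α + hermitePot t α z) :
    limitPot t g z = g α + hermitePot t α z := by
  obtain ⟨β, hβ, hlim⟩ := exists_limitPot_eq ht hg z
  exact le_antisymm (hlim.trans_le (h β hβ)) (le_limitPot ht hg z hα)

lemma abs_limitPot_sub_le (ht : 0 < t) (hg : ContinuousOn g (Set.Icc 0 1)) (z z' : ℂ) :
    |limitPot t g z - limitPot t g z'| ≤ hermitePotDist t z z' := by
  obtain ⟨α, hα, hlim⟩ := exists_limitPot_eq ht hg z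
  obtain ⟨α', hα', hlim'⟩ := exists_limitPot_eq ht hg z'
  have hle := le_limitPot ht hg z' hα
  have hle' := le_limitPot ht hg z hα'
  have hdist := abs_le.1 (abs_hermitePot_sub_le ht z z' hα)
  have hdist' := abs_le.1 (abs_hermitePot_sub_le ht z z' hα')
  rw [abs_le]
  constructor <;> linarith [hdist.2, hdist'.1]

lemma continuous_limitPot (ht : 0 < t) (hg : ContinuousOn g (Set.Icc 0 1)) :
    Continuous (limitPot t g) :=
  continuous_of_abs_sub_le_hermitePotDist ht (abs_limitPot_sub_le ht hg)

lemma log_norm_le_limitPot (ht : 0 < t) (hg : ContinuousOn g (Set.Icc 0 1)) {z : ℂ}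
    (hz : z ≠ 0) : g 1 + Real.log (‖z‖ / 2) ≤ limitPot t g z := by
  suffices Real.log (‖z‖ / 2) ≤ hermitePot t 1 z by
    linarith [le_limitPot ht hg z (Set.right_mem_Icc.2 zero_le_one)]
  calc Real.log (‖z‖ / 2) = ∫ _ in (0 : ℝ)..1, Real.log (‖z‖ / 2) := by simp
    _ ≤ hermitePot t 1 z := intervalIntegral.integral_mono_on zero_le_one intervalIntegrable_const
      (intervalIntegrable_log_joukowskyRadius ht z (by simp) (by simp)) fun _ _ =>
        Real.log_le_log (by positivity) (half_norm_le_joukowskyRadius _ z)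

lemma exists_log_sub_le_limitPot (ht : 0 < t) (hg : ContinuousOn g (Set.Icc 0 1)) {S : Set ℂ}
    (hS : Dense S) :
    ∃ C : ℝ, ∀ ρ : ℝ, 1 < ρ → ∃ z ∈ S, ‖z‖ ≤ ρ ∧ Real.log ρ - C ≤ limitPot t g z := by
  refine ⟨Real.log 4 - g 1, fun ρ hρ => ?_⟩
  have hopen : IsOpen {z : ℂ | ρ / 2 < ‖z‖ ∧ ‖z‖ < ρ} :=
    (isOpen_lt continuous_const continuous_norm).inter (isOpen_lt continuous_norm continuous_const)
  obtain ⟨z, ⟨hz_gt, hz_lt⟩, hz⟩ := hS.inter_open_nonempty _ hopen ⟨((3 / 4 * ρ : ℝ) : ℂ), by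
    rw [Set.mem_ofPred_eq, Complex.norm_real, Real.norm_of_nonneg (by positivity)]
    constructor <;> linarith⟩
  have hz0 : z ≠ 0 := norm_pos_iff.1 ((half_pos (one_pos.trans hρ)).trans hz_gt)
  refine ⟨z, hz, hz_lt.le, ?_⟩
  calc Real.log ρ - (Real.log 4 - g 1) = g 1 + Real.log (ρ / 4) := by
        rw [Real.log_div (by positivity) (by norm_num)]
        ring
    _ ≤ g 1 + Real.log (‖z‖ / 2) :=
        add_le_add_right (Real.log_le_log (by positivity) (by linarith)) _
    _ ≤ limitPot t g z := log_norm_le_limitPot ht hg hz0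

/-! ### The collapse time -/

lemma exists_forall_sub_le_mul_one_sub (hg : ContinuousOn g (Set.Icc 0 1))
    (hd : DifferentiableWithinAt ℝ g (Set.Iio 1) 1) :
    ∃ D : ℝ, ∀ α ∈ Set.Icc (0 : ℝ) 1, g α - g 1 ≤ D * (1 - α) := by
  obtain ⟨C, hC⟩ := hd.isBigO_sub.bound
  obtain ⟨b, hb, hnear⟩ := (mem_nhdsLT_iff_exists_Ioo_subset).1 hC
  obtain ⟨M, hM⟩ := isCompact_Icc.exists_bound_of_continuousOn
    (hg.sub (continuousOn_const (c := g 1)))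
  have hb' : 0 < 1 - b := sub_pos.2 hb
  refine ⟨max C (M / (1 - b)), fun α hα => (le_abs_self _).trans ?_⟩
  have hα1 : 0 ≤ 1 - α := sub_nonneg.2 hα.2
  rcases hα.2.eq_or_lt with rfl | hlt
  · simp
  rcases le_or_gt α b with hfar | hclose
  · have hM0 : 0 ≤ M := (norm_nonneg _).trans (hM α hα)
    calc |g α - g 1| ≤ M / (1 - b) * (1 - b) := by
          rw [div_mul_cancel₀ _ hb'.ne']
          exact hM α hα
      _ ≤ M / (1 - b) * (1 - α) := by gcongr
      _ ≤ _ := by gcongr; exact le_max_right _ _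
  · calc |g α - g 1| ≤ C * |α - 1| := hnear ⟨hclose, hlt⟩
      _ = C * (1 - α) := by rw [abs_sub_comm, abs_of_nonneg hα1]
      _ ≤ _ := by gcongr; exact le_max_left _ _

lemma bddAbove_wignerTimeFun (hg : ContinuousOn g (Set.Icc 0 1))
    (hd : DifferentiableWithinAt ℝ g (Set.Iio 1) 1) :
    BddAbove (wignerTimeFun g '' Set.Ioo 0 1) := by
  obtain ⟨D, hD⟩ := exists_forall_sub_le_mul_one_sub hg hd
  refine ⟨Real.exp (2 * D + 1), ?_⟩
  rintro _ ⟨α, ⟨h0, h1⟩, rfl⟩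
  have hslope : (g α - g 1) / (1 - α) ≤ D :=
    (div_le_iff₀ (sub_pos.2 h1)).2 (hD α ⟨h0.le, h1.le⟩)
  have hlog : α / (1 - α) * Real.log α ≤ 0 :=
    mul_nonpos_of_nonneg_of_nonpos (div_nonneg h0.le (sub_nonneg.2 h1.le))
      (Real.log_nonpos h0.le h1.le)
  exact Real.exp_le_exp.2 (by linarith)

lemma hermitePot_one_zero_sub (ht : 0 < t) {α : ℝ} (hα : α ∈ Set.Icc (0 : ℝ) 1) :
    hermitePot t 1 0 - hermitePot t α 0 =
      ((1 - α) * (Real.log t - 1) - α * Real.log α) / 2 := by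
  have hcongr : ∫ β in α..1, Real.log (joukowskyRadius (t * β) 0) =
      ∫ β in α..1, (Real.log t + Real.log β) / 2 := by
    refine intervalIntegral.integral_congr_ae (ae_of_all _ fun β hβ => ?_)
    rw [Set.uIoc_of_le hα.2] at hβ
    have hβ0 : 0 < β := hα.1.trans_lt hβ.1
    rw [joukowskyRadius_zero (by positivity), Real.log_sqrt (by positivity),
      Real.log_mul ht.ne' hβ0.ne']
  rw [hermitePot_sub ht 0 hα (Set.right_mem_Icc.2 zero_le_one), hcongr,
    intervalIntegral.integral_div, intervalIntegral.integral_add intervalIntegrable_const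
    intervalIntegral.intervalIntegrable_log', integral_log, intervalIntegral.integral_const,
    Real.log_one, smul_eq_mul]
  ring

lemma hermitePot_one_zero_sub_le (ht : 0 < t) (z : ℂ) {α : ℝ} (hα : α ∈ Set.Icc (0 : ℝ) 1) :
    hermitePot t 1 0 - hermitePot t α 0 ≤ hermitePot t 1 z - hermitePot t α z := by
  have h1 : (1 : ℝ) ∈ Set.Icc (0 : ℝ) 1 := Set.right_mem_Icc.2 zero_le_one
  rw [hermitePot_sub ht z hα h1, hermitePot_sub ht 0 hα h1]
  refine intervalIntegral.integral_mono_on_of_le_Ioo hα.2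
    (intervalIntegrable_log_joukowskyRadius ht 0 hα h1)
    (intervalIntegrable_log_joukowskyRadius ht z hα h1) fun β hβ => ?_
  have hc : 0 < t * β := mul_pos ht (hα.1.trans_lt hβ.1)
  exact Real.log_le_log (joukowskyRadius_pos hc 0) (joukowskyRadius_zero_le hc.le z)

lemma wignerTimeFun_le_iff (ht : 0 < t) {α : ℝ} (hα : α ∈ Set.Ioo (0 : ℝ) 1) :
    wignerTimeFun g α ≤ t ↔ g α + hermitePot t α 0 ≤ g 1 + hermitePot t 1 0 := by
  have h1 : 0 < 1 - α := sub_pos.2 hα.2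
  have hexponent : 2 * ((g α - g 1) / (1 - α)) + α / (1 - α) * Real.log α + 1 =
      (2 * (g α - g 1) + α * Real.log α + (1 - α)) / (1 - α) := by
    field_simp
  have hsub := hermitePot_one_zero_sub ht (Set.Ioo_subset_Icc_self hα)
  rw [wignerTimeFun, ← Real.le_log_iff_exp_le ht, hexponent, div_le_iff₀ h1]
  constructor <;> intro h <;> linarith

lemma limitPot_eq_of_wignerTime_le (ht : 0 < t) (hg : ContinuousOn g (Set.Icc 0 1))
    (hb : BddAbove (wignerTimeFun g '' Set.Ioo 0 1)) (h : wignerTime g ≤ t) (z : ℂ) :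
    limitPot t g z = g 1 + hermitePot t 1 z := by
  refine limitPot_eq_of_forall_le ht hg (Set.right_mem_Icc.2 zero_le_one) fun α hα => ?_
  have hIoo : ∀ β ∈ Set.Ioo (0 : ℝ) 1, g β + hermitePot t β z ≤ g 1 + hermitePot t 1 z := by
    intro β hβ
    have hle : wignerTimeFun g β ≤ t := (le_csSup hb (Set.mem_image_of_mem _ hβ)).trans h
    linarith [(wignerTimeFun_le_iff ht hβ).1 hle,
      hermitePot_one_zero_sub_le ht z (Set.Ioo_subset_Icc_self hβ)]
  exact ContinuousWithinAt.closure_le (by rwa [closure_Ioo zero_ne_one])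
    (((hg.add (continuousOn_hermitePot ht z)) α hα).mono Set.Ioo_subset_Icc_self)
    continuousWithinAt_const hIoo

lemma exists_lt_limitPot_of_lt_wignerTime (ht : 0 < t) (hg : ContinuousOn g (Set.Icc 0 1))
    (h : t < wignerTime g) :
    ∃ z : ℂ, 0 < z.im ∧ g 1 + hermitePot t 1 z < limitPot t g z := by
  obtain ⟨_, ⟨α, hα, rfl⟩, hlt⟩ := exists_lt_of_lt_csSup
    (Set.Nonempty.image _ (Set.nonempty_Ioo.2 zero_lt_one)) h
  rw [← not_le, wignerTimeFun_le_iff ht hα, not_le] at hlt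
  have hzero : g 1 + hermitePot t 1 0 < limitPot t g 0 :=
    hlt.trans_le (le_limitPot ht hg 0 (Set.Ioo_subset_Icc_self hα))
  have hopen : IsOpen {z : ℂ | g 1 + hermitePot t 1 z < limitPot t g z} :=
    isOpen_lt (continuous_const.add (continuous_hermitePot ht (by simp)))
      (continuous_limitPot ht hg)
  obtain ⟨ε, hε, hball⟩ := Metric.isOpen_iff.1 hopen 0 hzero
  refine ⟨((ε / 2 : ℝ) : ℂ) * Complex.I, by simpa using hε, hball ?_⟩
  rw [mem_ball_zero_iff, norm_mul, Complex.norm_I, mul_one, Complex.norm_real,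
    Real.norm_of_nonneg (by positivity)]
  linarith

lemma exists_limitPot_eq_of_im_pos (ht : 0 < t) (hg : ContinuousOn g (Set.Icc 0 1))
    (hd : DifferentiableWithinAt ℝ g (Set.Iio 1) 1) :
    ∃ z : ℂ, 0 < z.im ∧ limitPot t g z = g 1 + hermitePot t 1 z := by
  obtain ⟨D, hD⟩ := exists_forall_sub_le_mul_one_sub hg hd
  have h1 : (1 : ℝ) ∈ Set.Icc (0 : ℝ) 1 := Set.right_mem_Icc.2 zero_le_one
  set z : ℂ := (Real.exp D : ℂ) * Complex.I
  have hz : z.im = Real.exp D := by simp [z, Complex.exp_ofReal_re]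
  refine ⟨z, hz ▸ Real.exp_pos D, limitPot_eq_of_forall_le ht hg h1 fun α hα => ?_⟩
  have hslope : D * (1 - α) ≤ hermitePot t 1 z - hermitePot t α z := by
    rw [hermitePot_sub ht _ hα h1]
    calc D * (1 - α) = ∫ _ in α..1, D := by simp [mul_comm]
      _ ≤ _ := intervalIntegral.integral_mono_on hα.2 intervalIntegrable_const
        (intervalIntegrable_log_joukowskyRadius ht _ hα h1) fun β hβ => ?_
    have hradius : Real.exp D ≤ joukowskyRadius (t * β) z := by
      rw [← hz]
      exact (le_abs_self _).trans
        (abs_im_le_joukowskyRadius (mul_nonneg ht.le (hα.1.trans hβ.1)) z)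
    exact (Real.le_log_iff_exp_le ((Real.exp_pos D).trans_le hradius)).2 hradius
  linarith [hD α hα]

end

/-! ### Littlewood–Offord counting -/

lemma card_le_choose_of_isAntichain {ι : Type*} [DecidableEq ι]
    {𝒜 : Finset (Finset ι)} {K D : Finset ι} (h𝒜 : IsAntichain (· ⊆ ·) (𝒜 : Set (Finset ι)))
    (hD : ∀ A ∈ 𝒜, A \ K = D) :
    𝒜.card ≤ K.card.choose (K.card / 2) := by
  have hmono : ∀ A ∈ 𝒜, ∀ B ∈ 𝒜, A.subtype (· ∈ K) ⊆ B.subtype (· ∈ K) → A ⊆ B := by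
    intro A hA B hB h i hi
    by_cases hiK : i ∈ K
    · exact Finset.mem_subtype.1 (@h ⟨i, hiK⟩ (Finset.mem_subtype.2 hi))
    · have : i ∈ B \ K := hD B hB ▸ hD A hA ▸ Finset.mem_sdiff.2 ⟨hi, hiK⟩
      exact (Finset.mem_sdiff.1 this).1
  have hinj : Set.InjOn (Finset.subtype (· ∈ K)) (𝒜 : Set (Finset ι)) := fun A hA B hB h =>
    (hmono A hA B hB h.subset).antisymm (hmono B hB A hA h.superset)
  have hanti : IsAntichain (· ⊆ ·)
      ((𝒜.image (Finset.subtype (· ∈ K)) : Finset (Finset K)) : Set (Finset K)) := by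
    rw [Finset.coe_image]
    rintro _ ⟨A, hA, rfl⟩ _ ⟨B, hB, rfl⟩ hne hsub
    exact h𝒜 hA hB (fun h => hne (congrArg _ h)) (hmono A hA B hB hsub)
  rw [← Finset.card_image_of_injOn hinj, ← Fintype.card_coe K]
  exact hanti.sperner

section

variable {ι : Type*} [Fintype ι] [DecidableEq ι]

/-- The sum of the entries of `a`, with a minus sign on the indices in `A`. -/
def signedSum (a : ι → ℝ) (A : Finset ι) : ℝ := ∑ i, if i ∈ A then -a i else a i

lemma signedSum_sub_signedSum_of_subset (a : ι → ℝ) {A B : Finset ι} (hAB : A ⊆ B) :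
    signedSum a A - signedSum a B = 2 * ∑ i ∈ B \ A, a i := by
  rw [signedSum, signedSum, ← Finset.sum_sub_distrib, Finset.mul_sum,
    ← Finset.sum_subset (Finset.subset_univ (B \ A))]
  · refine Finset.sum_congr rfl fun i hi => ?_
    rw [Finset.mem_sdiff] at hi
    simp only [hi.1, hi.2, if_true, if_false]
    ring
  · intro i _ hi
    rw [Finset.mem_sdiff, not_and_not_right] at hi
    have : i ∈ A ↔ i ∈ B := ⟨fun h => hAB h, hi⟩
    simp only [this, sub_self]

lemma signedSum_abs_symmDiff (a : ι → ℝ) (A : Finset ι) :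
    signedSum (fun i => |a i|) (symmDiff A (Finset.univ.filter (a · < 0))) = signedSum a A := by
  refine Finset.sum_congr rfl fun i _ => ?_
  rcases lt_or_ge (a i) 0 with h | h
  · by_cases hA : i ∈ A <;> simp [Finset.mem_symmDiff, hA, h, abs_of_neg h]
  · by_cases hA : i ∈ A <;> simp [Finset.mem_symmDiff, hA, h.not_gt, abs_of_nonneg h]

lemma isAntichain_abs_signedSum_le {a : ι → ℝ} {K : Finset ι} {r : ℝ} (ha : ∀ i, 0 ≤ a i)
    (hK : ∀ i ∈ K, r < a i) (D : Finset ι) :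
    IsAntichain (· ⊆ ·) {A : Finset ι | |signedSum a A| ≤ r ∧ A \ K = D} := by
  rintro A ⟨hA, hAK⟩ B ⟨hB, hBK⟩ hne hAB
  obtain ⟨i, hiB, hiA⟩ := Finset.exists_of_ssubset (hAB.ssubset_of_ne hne)
  have hiK : i ∈ K := by
    by_contra hiK
    have : i ∈ A \ K := hAK ▸ hBK ▸ Finset.mem_sdiff.2 ⟨hiB, hiK⟩
    exact hiA (Finset.mem_sdiff.1 this).1
  have hle : a i ≤ ∑ j ∈ B \ A, a j :=
    Finset.single_le_sum (fun j _ => ha j) (Finset.mem_sdiff.2 ⟨hiB, hiA⟩)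
  linarith [signedSum_sub_signedSum_of_subset a hAB, hK i hiK, (abs_le.1 hA).2, (abs_le.1 hB).1]

lemma card_abs_signedSum_le_of_nonneg {a : ι → ℝ} {K : Finset ι} {r : ℝ} (ha : ∀ i, 0 ≤ a i)
    (hK : ∀ i ∈ K, r < a i) :
    (Finset.univ.filter fun A : Finset ι => |signedSum a A| ≤ r).card ≤
      K.card.choose (K.card / 2) * 2 ^ (Fintype.card ι - K.card) := by
  rw [← Finset.card_compl, ← Finset.card_powerset]
  refine Finset.card_le_mul_card_image_of_maps_to (f := fun A => A \ K) (fun A _ => ?_) _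
    fun D _ => card_le_choose_of_isAntichain (K := K) (D := D) ?_ ?_
  · exact Finset.mem_powerset.2 fun i hi => Finset.mem_compl.2 (Finset.mem_sdiff.1 hi).2
  · refine (isAntichain_abs_signedSum_le ha hK D).subset fun A hA => ?_
    simpa using hA
  · exact fun A hA => (Finset.mem_filter.1 hA).2

/-- The Erdős–Littlewood–Offord bound. -/
lemma card_abs_signedSum_le {a : ι → ℝ} {K : Finset ι} {r : ℝ} (hK : ∀ i ∈ K, r < |a i|) :
    (Finset.univ.filter fun A : Finset ι => |signedSum a A| ≤ r).card ≤
      K.card.choose (K.card / 2) * 2 ^ (Fintype.card ι - K.card) := by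
  refine le_trans (Finset.card_le_card_of_injOn
    (fun A => symmDiff A (Finset.univ.filter (a · < 0))) ?_ ?_)
    (card_abs_signedSum_le_of_nonneg (fun i => abs_nonneg (a i)) hK)
  · intro A hA
    simpa [signedSum_abs_symmDiff] using hA
  · exact fun A _ B _ h => symmDiff_left_injective _ h

lemma card_abs_signedSum_le_centralBinom (a : ι → ℝ) (r : ℝ) (m : ℕ) :
    ((Finset.univ.filter fun A : Finset ι => |signedSum a A| ≤ r).card : ℝ) ≤
      2 ^ Fintype.card ι * ((m.centralBinom : ℝ) / 4 ^ m +
        4 ^ m * (1 / 2) ^ (Finset.univ.filter fun i => r < |a i|).card) := by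
  set K := Finset.univ.filter fun i => r < |a i|
  rcases le_or_gt (2 * m) K.card with hm | hm
  · obtain ⟨K', hK', hcard⟩ := Finset.exists_subset_card_eq hm
    have hcount := card_abs_signedSum_le (a := a) (K := K') fun i hi =>
      (Finset.mem_filter.1 (hK' hi)).2
    rw [hcard, Nat.mul_div_cancel_left _ two_pos] at hcount
    have hpow : (2 : ℝ) ^ Fintype.card ι = 2 ^ (Fintype.card ι - 2 * m) * 4 ^ m := by
      rw [show (4 : ℝ) = 2 ^ 2 by norm_num, ← pow_mul, ← pow_add,
        Nat.sub_add_cancel (hcard ▸ K'.card_le_univ)]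
    calc ((Finset.univ.filter fun A : Finset ι => |signedSum a A| ≤ r).card : ℝ)
        ≤ (m.centralBinom : ℝ) * 2 ^ (Fintype.card ι - 2 * m) := by exact_mod_cast hcount
      _ = 2 ^ Fintype.card ι * ((m.centralBinom : ℝ) / 4 ^ m) := by
          rw [hpow]
          field_simp
      _ ≤ _ := by
          gcongr
          exact le_add_of_nonneg_right (by positivity)
  · have hone : (1 : ℝ) ≤ 4 ^ m * (1 / 2) ^ K.card :=
      calc (1 : ℝ) = 4 ^ m * (1 / 2) ^ (2 * m) := by
            rw [pow_mul, ← mul_pow]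
            norm_num
        _ ≤ 4 ^ m * (1 / 2) ^ K.card := by
            gcongr ?_ * ?_
            exact pow_le_pow_of_le_one (by norm_num) (by norm_num) hm.le
    calc ((Finset.univ.filter fun A : Finset ι => |signedSum a A| ≤ r).card : ℝ)
        ≤ 2 ^ Fintype.card ι := by
          exact_mod_cast (Finset.card_le_univ _).trans_eq Fintype.card_finset
      _ ≤ _ := le_mul_of_one_le_right (by positivity)
          (hone.trans (le_add_of_nonneg_left (by positivity)))

end

lemma centralBinom_sq_mul_le (m : ℕ) : m.centralBinom ^ 2 * (2 * m + 1) ≤ 16 ^ m := by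
  induction m with
  | zero => simp
  | succ m ih =>
    refine Nat.le_of_mul_le_mul_left ?_ (pow_pos m.succ_pos 2)
    calc (m + 1) ^ 2 * ((m + 1).centralBinom ^ 2 * (2 * (m + 1) + 1))
        = ((m + 1) * (m + 1).centralBinom) ^ 2 * (2 * (m + 1) + 1) := by ring
      _ = (m.centralBinom ^ 2 * (2 * m + 1)) * (4 * ((2 * m + 1) * (2 * m + 3))) := by
          rw [Nat.succ_mul_centralBinom_succ]
          ring
      _ ≤ 16 ^ m * (16 * (m + 1) ^ 2) := Nat.mul_le_mul ih (by nlinarith)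
      _ = (m + 1) ^ 2 * 16 ^ (m + 1) := by ring

lemma tendsto_centralBinom_div_four_pow :
    Tendsto (fun m : ℕ => (m.centralBinom : ℝ) / 4 ^ m) atTop (𝓝 0) := by
  have hle : ∀ m : ℕ, (m.centralBinom : ℝ) / 4 ^ m ≤ √(1 / (2 * m + 1)) := by
    intro m
    refine Real.le_sqrt_of_sq_le ?_
    rw [div_pow, div_le_div_iff₀ (by positivity) (by positivity), one_mul, ← pow_mul, mul_comm m 2,
      pow_mul]
    norm_num
    exact_mod_cast centralBinom_sq_mul_le m
  refine squeeze_zero (fun m => by positivity) hle ?_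
  have hlim : Tendsto (fun m : ℕ => (1 : ℝ) / (2 * m + 1)) atTop (𝓝 0) :=
    tendsto_const_nhds.div_atTop <| tendsto_atTop_add_const_right _ _
      (tendsto_natCast_atTop_atTop.const_mul_atTop two_pos)
  simpa only [Real.sqrt_zero] using hlim.sqrt

/-! ### Anticoncentration of sums of independent variables -/

/-- The probability that two independent samples of `μ` are at distance more than `r`. -/
def spread {E : Type*} [NormedAddCommGroup E] [MeasurableSpace E] (μ : Measure E) (r : ℝ) : ℝ :=
  (μ.prod μ).real {x | r < ‖x.1 - x.2‖}

lemma exists_spread_pos {E : Type*} [NormedAddCommGroup E] [MeasurableSpace E] {μ : Measure E}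
    [IsProbabilityMeasure μ] (hμ : ¬ ∃ c : E, ∀ᵐ x ∂μ, x = c) :
    ∃ δ : ℝ, 0 < δ ∧ 0 < spread μ δ := by
  by_contra! h
  have hsmall : ∀ k : ℕ, ∀ᵐ x ∂(μ.prod μ), ‖x.1 - x.2‖ ≤ 1 / ((k : ℝ) + 1) := by
    intro k
    have hnull : spread μ (1 / ((k : ℝ) + 1)) = 0 :=
      le_antisymm (h _ (by positivity)) measureReal_nonneg
    rw [spread, measureReal_eq_zero_iff] at hnull
    rw [ae_iff]
    simpa only [not_le] using hnull
  have hdiag : ∀ᵐ x ∂(μ.prod μ), x.1 = x.2 := by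
    filter_upwards [ae_all_iff.2 hsmall] with x hx
    have : ‖x.1 - x.2‖ ≤ 0 := ge_of_tendsto' tendsto_one_div_add_atTop_nhds_zero_nat hx
    exact sub_eq_zero.1 (norm_le_zero_iff.1 this)
  obtain ⟨x, hx⟩ := (Measure.ae_ae_of_ae_prod hdiag).exists
  exact hμ ⟨x, hx.mono fun y hy => hy.symm⟩

lemma spread_map {α E : Type*} [MeasurableSpace α] [NormedAddCommGroup E] [MeasurableSpace E]
    [BorelSpace E] [SecondCountableTopology E] (μ : Measure α) [SFinite μ] {f : α → E}
    (hf : Measurable f) (r : ℝ) :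
    spread (μ.map f) r = (μ.prod μ).real {x | r < ‖f x.1 - f x.2‖} := by
  rw [spread, Measure.map_prod_map μ μ hf hf, map_measureReal_apply (hf.prodMap hf)]
  · rfl
  · exact measurableSet_lt measurable_const (measurable_fst.sub measurable_snd).norm

lemma spread_le_spread_re_add_spread_im (μ : Measure ℂ) [IsFiniteMeasure μ] {δ B : ℝ} (hB : 0 < B)
    {b : ℂ} (hb : B ≤ ‖b‖) :
    spread μ δ ≤ spread (μ.map fun z => (z * b).re) (δ * B / 2) +
      spread (μ.map fun z => (z * b).im) (δ * B / 2) := by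
  rw [spread_map μ (by fun_prop), spread_map μ (by fun_prop)]
  refine le_trans (measureReal_mono fun x hx => ?_) (measureReal_union_le _ _)
  by_contra hcon
  simp only [Set.mem_union, Set.mem_ofPred_eq, not_or, not_lt, Real.norm_eq_abs, ← Complex.sub_re,
    ← Complex.sub_im, ← sub_mul] at hcon
  have hnorm := Complex.norm_le_abs_re_add_abs_im ((x.1 - x.2) * b)
  rw [norm_mul] at hnorm
  have hlt : δ * B < ‖x.1 - x.2‖ * ‖b‖ := mul_lt_mul hx hb hB (norm_nonneg _)
  linarith [hcon.1, hcon.2]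

lemma integral_half_ite (μ : Measure ℝ) [IsProbabilityMeasure μ] (r : ℝ) :
    ∫ x, (if r < |x.1 - x.2| then 1 / 2 else 1 : ℝ) ∂(μ.prod μ) = 1 - spread μ r / 2 := by
  have hmeas : MeasurableSet {x : ℝ × ℝ | r < ‖x.1 - x.2‖} :=
    measurableSet_lt measurable_const (by fun_prop)
  have hite : ∀ x : ℝ × ℝ, (if r < |x.1 - x.2| then 1 / 2 else 1 : ℝ) =
      1 - {x : ℝ × ℝ | r < ‖x.1 - x.2‖}.indicator 1 x / 2 := by
    intro x
    by_cases hx : r < |x.1 - x.2| <;> simp [Set.indicator, hx]; norm_num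
  simp_rw [hite]
  rw [integral_sub (integrable_const _) (((integrable_const _).indicator hmeas).div_const _),
    integral_div, integral_indicator_one hmeas, integral_const, probReal_univ, one_smul, spread]

section

variable {ι : Type*} [Fintype ι]

lemma measureReal_abs_sum_le_sq_le (μ : ι → Measure ℝ) [∀ i, IsProbabilityMeasure (μ i)] (r : ℝ) :
    (Measure.pi μ).real {x | |∑ i, x i| ≤ r} ^ 2 ≤
      (Measure.pi fun i => (μ i).prod (μ i)).real {w | |∑ i, ((w i).1 - (w i).2)| ≤ 2 * r} := by
  set E : Set (ι → ℝ) := {x | |∑ i, x i| ≤ r}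
  have hE : MeasurableSet E := measurableSet_le (by fun_prop) measurable_const
  rw [sq, ← measureReal_prod_prod, ← (measurePreserving_arrowProdEquivProdArrow ℝ ℝ ι μ
    μ).measureReal_preimage (hE.prod hE).nullMeasurableSet]
  refine measureReal_mono fun w hw => ?_
  have hfst : |∑ i, (w i).1| ≤ r := hw.1
  have hsnd : |∑ i, (w i).2| ≤ r := hw.2
  rw [Set.mem_ofPred_eq, Finset.sum_sub_distrib]
  linarith [abs_sub (∑ i, (w i).1) (∑ i, (w i).2)]

section

variable [DecidableEq ι]

/-- Exchange the two components of `w i` at the indices `i ∈ A`. -/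
def swapAt {α : Type*} (A : Finset ι) (w : ι → α × α) (i : ι) : α × α :=
  if i ∈ A then (w i).swap else w i

lemma measurePreserving_swapAt {α : Type*} [MeasurableSpace α] (μ : ι → Measure α)
    [∀ i, SigmaFinite (μ i)] (A : Finset ι) :
    MeasurePreserving (swapAt A) (Measure.pi fun i => (μ i).prod (μ i))
      (Measure.pi fun i => (μ i).prod (μ i)) := by
  refine measurePreserving_pi _ _ (f := fun i (x : α × α) => if i ∈ A then x.swap else x)
    fun i => ?_
  by_cases h : i ∈ A
  · simpa only [h, if_true] using Measure.measurePreserving_swap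
  · simp only [h, if_false]
    exact MeasurePreserving.id _

lemma sum_swapAt_sub (w : ι → ℝ × ℝ) (A : Finset ι) :
    ∑ i, ((swapAt A w i).1 - (swapAt A w i).2) = signedSum (fun i => (w i).1 - (w i).2) A := by
  refine Finset.sum_congr rfl fun i _ => ?_
  by_cases h : i ∈ A <;> simp [swapAt, h]

/-- Averaging over all `2 ^ card ι` exchanges turns the probability into a count of signs. -/
lemma two_pow_mul_measureReal_abs_sum_sub (μ : ι → Measure ℝ) [∀ i, IsProbabilityMeasure (μ i)]
    (r : ℝ) :
    2 ^ Fintype.card ι *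
        (Measure.pi fun i => (μ i).prod (μ i)).real {w | |∑ i, ((w i).1 - (w i).2)| ≤ r} =
      ∫ w, ((Finset.univ.filter fun A : Finset ι =>
        |signedSum (fun i => (w i).1 - (w i).2) A| ≤ r).card : ℝ)
        ∂(Measure.pi fun i => (μ i).prod (μ i)) := by
  set Q := Measure.pi fun i => (μ i).prod (μ i)
  set F : Set (ι → ℝ × ℝ) := {w | |∑ i, ((w i).1 - (w i).2)| ≤ r}
  have hF : MeasurableSet F := measurableSet_le (by fun_prop) measurable_const
  have hcount : ∀ w : ι → ℝ × ℝ, ((Finset.univ.filter fun A : Finset ι =>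
      |signedSum (fun i => (w i).1 - (w i).2) A| ≤ r).card : ℝ) =
        ∑ A : Finset ι, (swapAt A ⁻¹' F).indicator 1 w := by
    intro w
    rw [Finset.card_filter, Nat.cast_sum]
    refine Finset.sum_congr rfl fun A _ => ?_
    by_cases h : swapAt A w ∈ F
    · rw [Set.indicator_of_mem (Set.mem_preimage.2 h), ← sum_swapAt_sub, if_pos (by exact h),
        Nat.cast_one, Pi.one_apply]
    · rw [Set.indicator_of_notMem (mt Set.mem_preimage.1 h), ← sum_swapAt_sub, if_neg (by exact h),
        Nat.cast_zero]
  have hint : ∀ A : Finset ι,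
      Integrable ((swapAt A ⁻¹' F).indicator (1 : (ι → ℝ × ℝ) → ℝ)) Q := fun A =>
    (integrable_const (1 : ℝ)).indicator ((measurePreserving_swapAt μ A).measurable hF)
  simp_rw [hcount]
  rw [integral_finsetSum _ fun A _ => hint A]
  have hswap : ∀ A : Finset ι, ∫ w, (swapAt A ⁻¹' F).indicator 1 w ∂Q = Q.real F := fun A => by
    rw [integral_indicator_one ((measurePreserving_swapAt μ A).measurable hF),
      (measurePreserving_swapAt μ A).measureReal_preimage hF.nullMeasurableSet]
  simp_rw [hswap]
  rw [Finset.sum_const, Finset.card_univ, Fintype.card_finset, nsmul_eq_mul, Nat.cast_pow,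
    Nat.cast_ofNat]

end

lemma measureReal_abs_sum_sub_le (μ : ι → Measure ℝ) [∀ i, IsProbabilityMeasure (μ i)] (r : ℝ)
    (m : ℕ) :
    (Measure.pi fun i => (μ i).prod (μ i)).real {w | |∑ i, ((w i).1 - (w i).2)| ≤ r} ≤
      (m.centralBinom : ℝ) / 4 ^ m + 4 ^ m * ∏ i, (1 - spread (μ i) r / 2) := by
  classical
  set Q := Measure.pi fun i => (μ i).prod (μ i)
  have hpow : ∀ w : ι → ℝ × ℝ, ∏ i, (if r < |(w i).1 - (w i).2| then 1 / 2 else 1 : ℝ) =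
      (1 / 2) ^ (Finset.univ.filter fun i => r < |(w i).1 - (w i).2|).card := fun w => by
    simp only [Finset.prod_ite, Finset.prod_const, one_pow, mul_one]
  have hprod : ∫ w, (1 / 2 : ℝ) ^ (Finset.univ.filter fun i => r < |(w i).1 - (w i).2|).card ∂Q =
      ∏ i, (1 - spread (μ i) r / 2) := by
    simp_rw [← integral_half_ite, ← integral_fintype_prod_eq_prod, hpow]
    rfl
  have hint : Integrable (fun w : ι → ℝ × ℝ => (1 / 2 : ℝ) ^
      (Finset.univ.filter fun i => r < |(w i).1 - (w i).2|).card) Q := by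
    refine Integrable.of_bound (Measurable.aestronglyMeasurable ?_) 1 (ae_of_all _ fun w => ?_)
    · simp_rw [← hpow]
      exact Finset.measurable_prod _ fun i _ => Measurable.ite
        (measurableSet_lt measurable_const (by fun_prop)) measurable_const measurable_const
    · rw [Real.norm_of_nonneg (by positivity)]
      exact pow_le_one₀ (by norm_num) (by norm_num)
  refine le_of_mul_le_mul_left ?_ (pow_pos two_pos (Fintype.card ι))
  rw [two_pow_mul_measureReal_abs_sum_sub μ r]
  calc _ ≤ ∫ w, 2 ^ Fintype.card ι * ((m.centralBinom : ℝ) / 4 ^ m + 4 ^ m * (1 / 2) ^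
        (Finset.univ.filter fun i => r < |(w i).1 - (w i).2|).card) ∂Q :=
        integral_mono_of_nonneg (ae_of_all _ fun w => Nat.cast_nonneg _)
          (((integrable_const _).add (hint.const_mul _)).const_mul _)
          (ae_of_all _ fun w => card_abs_signedSum_le_centralBinom _ r m)
    _ = _ := by
      rw [integral_const_mul, integral_add (integrable_const _) (hint.const_mul _),
        integral_const_mul, integral_const, hprod, probReal_univ, one_smul]

lemma prod_one_sub_half_le {s : ι → ℝ} (hs : ∀ i, s i ∈ Set.Icc (0 : ℝ) 1) {J : Finset ι} {p : ℝ}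
    (hp : ∀ j ∈ J, p ≤ s j) : ∏ i, (1 - s i / 2) ≤ (1 - p / 2) ^ J.card := by
  classical
  calc ∏ i, (1 - s i / 2) ≤ ∏ i, if i ∈ J then 1 - p / 2 else 1 := by
        refine Finset.prod_le_prod (fun i _ => by linarith [(hs i).2]) fun i _ => ?_
        split_ifs with h
        · linarith [hp i h]
        · linarith [(hs i).1]
    _ = (1 - p / 2) ^ J.card := by rw [Finset.prod_ite_mem, Finset.univ_inter, Finset.prod_const]

end

lemma spread_mem_Icc {E : Type*} [NormedAddCommGroup E] [MeasurableSpace E] (μ : Measure E)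
    [IsProbabilityMeasure μ] (r : ℝ) : spread μ r ∈ Set.Icc (0 : ℝ) 1 :=
  ⟨measureReal_nonneg, measureReal_le_one⟩

/-- A Kolmogorov–Rogozin type inequality. -/
lemma measureReal_abs_sum_le_sq_le_of_iIndepFun {Ω ι : Type*} [MeasurableSpace Ω] {P : Measure Ω}
    [IsProbabilityMeasure P] {X : ι → Ω → ℝ} (hX : ∀ i, Measurable (X i)) (hind : iIndepFun X P)
    {I J : Finset ι} (hJI : J ⊆ I) {r p : ℝ} (hp : ∀ j ∈ J, p ≤ spread (P.map (X j)) (2 * r))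
    (m : ℕ) :
    P.real {ω | |∑ i ∈ I, X i ω| ≤ r} ^ 2 ≤
      (m.centralBinom : ℝ) / 4 ^ m + 4 ^ m * (1 - p / 2) ^ J.card := by
  classical
  have hprob : ∀ i : I, IsProbabilityMeasure (P.map (X i)) := fun i =>
    Measure.isProbabilityMeasure_map (hX i).aemeasurable
  have hlaw : P.map (fun ω (i : I) => X i ω) = Measure.pi fun i : I => P.map (X i) :=
    (iIndepFun_iff_map_fun_eq_pi_map fun i : I => (hX i).aemeasurable).1
      (hind.precomp Subtype.val_injective)
  have hpi : P.real {ω | |∑ i ∈ I, X i ω| ≤ r} =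
      (Measure.pi fun i : I => P.map (X i)).real {x | |∑ i, x i| ≤ r} := by
    rw [← hlaw, map_measureReal_apply (measurable_pi_lambda _ fun i : I => hX i)
      (measurableSet_le (by fun_prop) measurable_const)]
    congr 1 with ω
    simp only [Set.mem_preimage, Set.mem_ofPred_eq, Finset.sum_coe_sort I fun i => X i ω]
  have hcard : (J.subtype (· ∈ I)).card = J.card := by
    rw [Finset.card_subtype, Finset.filter_true_of_mem fun j hj => hJI hj]
  rw [hpi, ← hcard]
  refine (measureReal_abs_sum_le_sq_le _ r).trans
    ((measureReal_abs_sum_sub_le _ (2 * r) m).trans ?_)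
  gcongr
  exact prod_one_sub_half_le (fun i => spread_mem_Icc _ _) fun j hj =>
    hp j (Finset.mem_subtype.1 hj)

lemma measureReal_norm_sum_mul_le {Ω ι : Type*} [MeasurableSpace Ω] {P : Measure Ω}
    [IsProbabilityMeasure P] {ξ : ι → Ω → ℂ} (hξ : ∀ i, Measurable (ξ i)) (hind : iIndepFun ξ P)
    (φ : ℂ →L[ℝ] ℝ) (hφ : ∀ z, |φ z| ≤ ‖z‖) (b : ι → ℂ) {I J : Finset ι} (hJI : J ⊆ I) {r p : ℝ}
    (hp0 : 0 ≤ p) (hp2 : p ≤ 2)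
    (hp : ∀ j ∈ J, p ≤ spread ((P.map (ξ j)).map fun z => φ (z * b j)) (2 * r)) (m : ℕ) {M : ℕ}
    (hM : M ≤ J.card) :
    P.real {ω | ‖∑ i ∈ I, ξ i ω * b i‖ ≤ r} ^ 2 ≤
      (m.centralBinom : ℝ) / 4 ^ m + 4 ^ m * (1 - p / 2) ^ M := by
  have hmeas : ∀ i, Measurable fun z => φ (z * b i) := fun i =>
    (φ.continuous.comp (continuous_mul_const (b i))).measurable
  calc P.real {ω | ‖∑ i ∈ I, ξ i ω * b i‖ ≤ r} ^ 2
      ≤ P.real {ω | |∑ i ∈ I, φ (ξ i ω * b i)| ≤ r} ^ 2 := by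
        gcongr
        · exact measure_ne_top _ _
        · rw [← map_sum]
          exact hφ _
    _ ≤ (m.centralBinom : ℝ) / 4 ^ m + 4 ^ m * (1 - p / 2) ^ J.card :=
        measureReal_abs_sum_le_sq_le_of_iIndepFun (fun i => (hmeas i).comp (hξ i))
          (hind.comp _ hmeas) hJI
          (fun j hj => (hp j hj).trans_eq (by rw [Measure.map_map (hmeas j) (hξ j)])) m
    _ ≤ (m.centralBinom : ℝ) / 4 ^ m + 4 ^ m * (1 - p / 2) ^ M := by
        have := pow_le_pow_of_le_one (a := 1 - p / 2) (by linarith) (by linarith) hM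
        gcongr

lemma exists_mul_one_sub_pow_le {p ε : ℝ} (hp0 : 0 < p) (hp2 : p ≤ 2) (hε : 0 < ε) :
    ∃ m M : ℕ, (m.centralBinom : ℝ) / 4 ^ m + 4 ^ m * (1 - p / 2) ^ M ≤ ε := by
  obtain ⟨m, hm⟩ := (tendsto_centralBinom_div_four_pow.eventually_lt_const (half_pos hε)).exists
  have hlim : Tendsto (fun M : ℕ => (4 : ℝ) ^ m * (1 - p / 2) ^ M) atTop (𝓝 (4 ^ m * 0)) :=
    (tendsto_pow_atTop_nhds_zero_of_lt_one (by linarith) (by linarith)).const_mul _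
  rw [mul_zero] at hlim
  obtain ⟨M, hM⟩ := (hlim.eventually_lt_const (half_pos hε)).exists
  exact ⟨m, M, by linarith⟩

theorem IsAdmissibleNoise.exists_anticoncentration {Ω : Type*} [MeasurableSpace Ω] {P : Measure Ω}
    [IsProbabilityMeasure P] {ξ : ℕ → Ω → ℂ} (hξ : IsAdmissibleNoise P ξ) :
    ∃ c : ℝ, 0 < c ∧ ∀ ε : ℝ, 0 < ε → ∃ M : ℕ, ∀ (I : Finset ℕ) (b : ℕ → ℂ) (B : ℝ), 0 < B →
      M ≤ (I.filter fun i => B ≤ ‖b i‖).card →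
      P.real {ω | ‖∑ i ∈ I, ξ i ω * b i‖ ≤ c * B} ≤ ε := by
  have hprob := Measure.isProbabilityMeasure_map (μ := P) (hξ.measurable 0).aemeasurable
  obtain ⟨δ, hδ, hp⟩ := exists_spread_pos (μ := P.map (ξ 0)) fun ⟨c, hc⟩ =>
    hξ.nondegenerate ⟨c, ae_of_ae_map (hξ.measurable 0).aemeasurable hc⟩
  have hp1 := (spread_mem_Icc (P.map (ξ 0)) δ).2
  set p := spread (P.map (ξ 0)) δ
  refine ⟨δ / 4, by positivity, fun ε hε => ?_⟩
  obtain ⟨m, M, hmM⟩ := exists_mul_one_sub_pow_le (half_pos hp) (by linarith) (pow_pos hε 2)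
  refine ⟨2 * M, fun I b B hB hcard => abs_le_of_sq_le_sq' ?_ hε.le |>.2⟩
  -- one of the two coordinates spreads at half of the large terms
  set J : (ℂ →L[ℝ] ℝ) → Finset ℕ := fun φ => I.filter fun i =>
    p / 2 ≤ spread ((P.map (ξ i)).map fun z => φ (z * b i)) (2 * (δ / 4 * B))
  have hcover : (I.filter fun i => B ≤ ‖b i‖) ⊆ J Complex.reCLM ∪ J Complex.imCLM := fun i hi => by
    obtain ⟨hiI, hBi⟩ := Finset.mem_filter.1 hi
    have hle := spread_le_spread_re_add_spread_im (P.map (ξ 0)) (δ := δ) hB hBi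
    rw [show δ * B / 2 = 2 * (δ / 4 * B) by ring] at hle
    simp only [J, Finset.mem_union, Finset.mem_filter, hiI, true_and, (hξ.identDistrib i).map_eq]
    by_contra! h
    simp only [Complex.reCLM_apply, Complex.imCLM_apply] at h
    linarith [h.1, h.2]
  have hbound : ∀ φ : ℂ →L[ℝ] ℝ, (∀ z, |φ z| ≤ ‖z‖) → M ≤ (J φ).card →
      P.real {ω | ‖∑ i ∈ I, ξ i ω * b i‖ ≤ δ / 4 * B} ^ 2 ≤ ε ^ 2 := fun φ hφ h =>
    (measureReal_norm_sum_mul_le hξ.measurable hξ.indep φ hφ b (Finset.filter_subset _ I)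
      (by positivity) (by linarith) (fun j hj => (Finset.mem_filter.1 hj).2) m h).trans hmM
  have hunion := (Finset.card_le_card hcover).trans (Finset.card_union_le _ _)
  rcases (by omega : M ≤ (J Complex.reCLM).card ∨ M ≤ (J Complex.imCLM).card) with h | h
  · exact hbound _ Complex.abs_re_le_norm h
  · exact hbound _ Complex.abs_im_le_norm h

/-! ### The semicircle distribution -/

section Disc

variable {F : ℝ → ℝ} {R : ℝ}

/-- The mean of `F` with respect to the arcsine law on `[-ρ, ρ]`, which is the law of the real part
of a uniform point of the circle of radius `ρ`. -/
def arcsineMean (F : ℝ → ℝ) (ρ : ℝ) : ℝ :=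
  Real.circleAverage (fun ζ => F (ρ * ζ.re)) 0 1

lemma continuous_arcsineMean (hF : Continuous F) : Continuous (arcsineMean F) := by
  have hmap : Continuous fun p : ℝ × ℝ => circleMap 0 1 p.2 :=
    (continuous_circleMap 0 1).comp continuous_snd
  unfold arcsineMean Real.circleAverage
  refine Continuous.const_smul
    (intervalIntegral.continuous_parametric_intervalIntegral_of_continuous' (μ := volume)
      (f := fun (ρ : ℝ) θ => F (ρ * (circleMap 0 1 θ).re)) ?_ 0 (2 * Real.pi)) (2 * Real.pi)⁻¹
  exact hF.comp (continuous_fst.mul (Complex.continuous_re.comp hmap))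

lemma circleIntegrable_comp_mul_re (hF : Continuous F) (ρ : ℝ) :
    CircleIntegrable (fun ζ => F (ρ * ζ.re)) 0 1 :=
  Continuous.continuousOn (by fun_prop) |>.circleIntegrable'

lemma integral_cos_eq_arcsineMean (F : ℝ → ℝ) (ρ : ℝ) :
    ∫ θ in Set.Ioo (-Real.pi) Real.pi, F (ρ * Real.cos θ) = 2 * Real.pi * arcsineMean F ρ := by
  have hper : Function.Periodic (fun θ => F (ρ * Real.cos θ)) (2 * Real.pi) :=
    fun θ => by simp only [Real.cos_add_two_pi]
  have hshift := hper.intervalIntegral_add_eq (-Real.pi) 0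
  rw [show -Real.pi + 2 * Real.pi = Real.pi by ring, zero_add] at hshift
  rw [← integral_Ioc_eq_integral_Ioo, ← intervalIntegral.integral_of_le (by linarith [Real.pi_pos]),
    hshift, arcsineMean, Real.circleAverage, smul_eq_mul, mul_inv_cancel_left₀ Real.two_pi_pos.ne']
  simp [circleMap, Complex.exp_ofReal_mul_I_re]

lemma integrableOn_disc {G : ℝ × ℝ → ℝ} (hG : Continuous G) (hR : 0 ≤ R) :
    IntegrableOn G {p : ℝ × ℝ | p.1 ^ 2 + p.2 ^ 2 < R ^ 2} := by
  refine (hG.continuousOn.integrableOn_compact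
    ((isCompact_Icc (a := -R) (b := R)).prod (isCompact_Icc (a := -R) (b := R)))).mono_set ?_
  intro p hp
  simp only [Set.mem_ofPred_eq] at hp
  exact ⟨abs_le_of_sq_le_sq' (by linarith [sq_nonneg p.2]) hR,
    abs_le_of_sq_le_sq' (by linarith [sq_nonneg p.1]) hR⟩

lemma measurableSet_disc (R : ℝ) : MeasurableSet {p : ℝ × ℝ | p.1 ^ 2 + p.2 ^ 2 < R ^ 2} :=
  measurableSet_lt (by fun_prop) measurable_const

lemma integral_disc_eq_integral_sqrt (hF : Continuous F) (hR : 0 ≤ R) :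
    ∫ p : ℝ × ℝ in {p | p.1 ^ 2 + p.2 ^ 2 < R ^ 2}, F p.1 =
      ∫ x, 2 * √(R ^ 2 - x ^ 2) * F x := by
  have hint := (integrable_indicator_iff (measurableSet_disc R)).2
    (integrableOn_disc (G := fun p => F p.1) (by fun_prop) hR)
  rw [← integral_indicator (measurableSet_disc R)]
  rw [Measure.volume_eq_prod] at hint ⊢
  rw [integral_prod _ hint]
  refine integral_congr_ae (ae_of_all _ fun x => ?_)
  have hslice : ∀ y : ℝ, Set.indicator {p : ℝ × ℝ | p.1 ^ 2 + p.2 ^ 2 < R ^ 2}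
      (fun p : ℝ × ℝ => F p.1) (x, y) =
      Set.indicator (Set.Ioo (-√(R ^ 2 - x ^ 2)) (√(R ^ 2 - x ^ 2))) (fun _ => F x) y := by
    intro y
    simp only [Set.indicator, Set.mem_ofPred_eq, Set.mem_Ioo, ← Real.sq_lt, lt_sub_iff_add_lt']
  simp only [hslice]
  rw [integral_indicator measurableSet_Ioo, setIntegral_const, Measure.real, Real.volume_Ioo,
    ENNReal.toReal_ofReal (by linarith [Real.sqrt_nonneg (R ^ 2 - x ^ 2)]), smul_eq_mul]
  ring

lemma integral_disc_eq_integral_arcsineMean (hF : Continuous F) (hR : 0 ≤ R) :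
    ∫ p : ℝ × ℝ in {p | p.1 ^ 2 + p.2 ^ 2 < R ^ 2}, F p.1 =
      ∫ ρ in 0..R, 2 * Real.pi * ρ * arcsineMean F ρ := by
  have hpolar : ∀ p ∈ polarCoord.target, p.1 • Set.indicator {p : ℝ × ℝ | p.1 ^ 2 + p.2 ^ 2 < R ^ 2}
      (fun p : ℝ × ℝ => F p.1) (polarCoord.symm p) =
      Set.indicator (Set.Iio R ×ˢ Set.univ) (fun p => p.1 * F (p.1 * Real.cos p.2)) p := by
    rintro ⟨ρ, θ⟩ ⟨hρ, -⟩
    have hsq : (ρ * Real.cos θ) ^ 2 + (ρ * Real.sin θ) ^ 2 < R ^ 2 ↔ ρ < R := by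
      rw [← pow_lt_pow_iff_left₀ (Set.mem_Ioi.1 hρ).le hR two_ne_zero, mul_pow, mul_pow, ← mul_add,
        Real.cos_sq_add_sin_sq, mul_one]
    by_cases h : ρ < R <;>
      simp [Set.indicator, polarCoord_symm_apply, hsq, h]
  have hset : polarCoord.target ∩ Set.Iio R ×ˢ Set.univ =
      Set.Ioo 0 R ×ˢ Set.Ioo (-Real.pi) Real.pi := by
    rw [polarCoord_target, Set.prod_inter_prod, Set.inter_univ, Set.Ioi_inter_Iio]
  rw [← integral_indicator (measurableSet_disc R), ← integral_comp_polarCoord_symm,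
    setIntegral_congr_fun polarCoord.open_target.measurableSet hpolar,
    setIntegral_indicator (measurableSet_Iio.prod .univ), hset, Measure.volume_eq_prod,
    setIntegral_prod, intervalIntegral.integral_of_le hR, integral_Ioc_eq_integral_Ioo]
  · refine setIntegral_congr_fun measurableSet_Ioo fun ρ _ => ?_
    simp only
    rw [integral_const_mul, integral_cos_eq_arcsineMean]
    ring
  · refine IntegrableOn.mono_set (t := Set.Icc 0 R ×ˢ Set.Icc (-Real.pi) Real.pi) ?_
      (Set.prod_mono Set.Ioo_subset_Icc_self Set.Ioo_subset_Icc_self)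
    exact ContinuousOn.integrableOn_compact (isCompact_Icc.prod isCompact_Icc)
      (Continuous.continuousOn (by fun_prop))

end Disc

section Semicircle

variable {t : ℝ}

lemma integral_semicircle_eq_integral_sqrt (ht : 0 ≤ t) {F : ℂ → ℝ} (hF : Continuous F) :
    ∫ w, F w ∂(semicircle t) =
      (4 * Real.pi * t)⁻¹ * ∫ x : ℝ, 2 * √((2 * √t) ^ 2 - x ^ 2) * F x := by
  have hsq : (2 * √t) ^ 2 = 4 * t := by rw [mul_pow, Real.sq_sqrt ht]; norm_num
  rw [semicircle, integral_map (by fun_prop) hF.aestronglyMeasurable,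
    integral_withDensity_eq_integral_toReal_smul (by fun_prop)
      (ae_of_all _ fun x => ENNReal.ofReal_lt_top), ← integral_const_mul,
    setIntegral_eq_integral_of_forall_compl_eq_zero]
  · refine integral_congr_ae (ae_of_all _ fun x => ?_)
    simp only [smul_eq_mul]
    rw [ENNReal.toReal_ofReal (by positivity), hsq]
    ring
  · intro x hx
    suffices √(4 * t - x ^ 2) = 0 by simp [this]
    refine Real.sqrt_eq_zero_of_nonpos ?_
    by_contra! h
    have habs := abs_lt_of_sq_lt_sq' (hsq ▸ sub_pos.1 h) (by positivity)
    exact hx ⟨by linarith [habs.1], habs.2.le⟩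

lemma integral_semicircle (ht : 0 < t) {F : ℂ → ℝ} (hF : Continuous F) :
    ∫ w, F w ∂(semicircle t) = ∫ β in 0..1, arcsineMean (fun x => F x) (2 * √(t * β)) := by
  have hFre : Continuous fun x : ℝ => F x := hF.comp Complex.continuous_ofReal
  have hmean := continuous_arcsineMean hFre
  have hderiv : ∀ ρ : ℝ, HasDerivAt (fun ρ => ρ ^ 2 / (4 * t)) (ρ / (2 * t)) ρ := fun ρ =>
    ((hasDerivAt_pow 2 ρ).div_const (4 * t)).congr_deriv (by field_simp; ring)
  have hsubst := intervalIntegral.integral_comp_mul_deriv (a := 0) (b := 2 * √t)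
    (fun ρ _ => hderiv ρ) (Continuous.continuousOn (by fun_prop))
    (g := fun β => arcsineMean (fun x => F x) (2 * √(t * β))) (by fun_prop)
  rw [show (0 : ℝ) ^ 2 / (4 * t) = 0 by simp, show (2 * √t) ^ 2 / (4 * t) = 1 by
    rw [mul_pow, Real.sq_sqrt ht.le]; field_simp; norm_num] at hsubst
  rw [integral_semicircle_eq_integral_sqrt ht.le hF,
    ← integral_disc_eq_integral_sqrt hFre (by positivity),
    integral_disc_eq_integral_arcsineMean hFre (by positivity),
    ← intervalIntegral.integral_const_mul, ← hsubst]
  refine intervalIntegral.integral_congr fun ρ hρ => ?_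
  rw [Set.uIcc_of_le (by positivity)] at hρ
  have hroot : 2 * √(t * (ρ ^ 2 / (4 * t))) = ρ := by
    rw [show t * (ρ ^ 2 / (4 * t)) = (ρ / 2) ^ 2 by field_simp; norm_num,
      Real.sqrt_sq (by linarith [hρ.1])]
    ring
  simp only [Function.comp_apply, hroot]
  have := Real.pi_pos
  field_simp
  norm_num

lemma isProbabilityMeasure_semicircle (ht : 0 < t) : IsProbabilityMeasure (semicircle t) := by
  have h := integral_semicircle ht (F := fun _ => 1) continuous_const
  simp only [arcsineMean, Real.circleAverage_const, intervalIntegral.integral_const, sub_zero,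
    integral_const, smul_eq_mul, mul_one] at h
  exact ⟨by simpa only [Measure.real, ENNReal.toReal_eq_one_iff] using h⟩

lemma semicircle_im_ne_zero (t : ℝ) : semicircle t {z : ℂ | z.im ≠ 0} = 0 := by
  rw [semicircle, Measure.map_apply (by fun_prop)]
  · simp
  · exact (isOpen_ne_fun Complex.continuous_im continuous_const).measurableSet

/-- On the unit circle `z - ρ * re ζ` is, up to a factor `-ζ⁻¹`, a quadratic polynomial in `ζ`
whose roots are the two Joukowsky preimages of `z`. -/
lemma norm_sub_mul_re {ρ : ℝ} (hρ : 0 < ρ) {r r' : ℂ} (hmul : r * r' = (ρ ^ 2 / 4 : ℝ)) {ζ : ℂ}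
    (hζ : ‖ζ‖ = 1) :
    ‖r + r' - (ρ * ζ.re : ℝ)‖ = ρ / 2 * (‖ζ - 2 * r / ρ‖ * ‖ζ - 2 * r' / ρ‖) := by
  have hζ0 : ζ ≠ 0 := norm_pos_iff.1 (by rw [hζ]; norm_num)
  have hρ0 : (ρ : ℂ) ≠ 0 := by exact_mod_cast hρ.ne'
  have hre : (ζ.re : ℂ) = (ζ + ζ⁻¹) / 2 := by
    rw [Complex.re_eq_add_conj, Complex.inv_def, Complex.normSq_eq_norm_sq, hζ]
    simp
  have hfac : r + r' - (ρ * ζ.re : ℝ) =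
      -(ρ / 2 * ((ζ - 2 * r / ρ) * (ζ - 2 * r' / ρ)) * ζ⁻¹) := by
    push_cast at hmul ⊢
    rw [hre]
    field_simp
    linear_combination 4 * hmul
  rw [hfac, norm_neg, norm_mul, norm_mul, norm_mul, norm_inv, hζ, inv_one, mul_one, norm_div,
    Complex.norm_real, Real.norm_of_nonneg hρ.le, Complex.norm_ofNat]

lemma circleIntegrable_half_mul_norm_mul (ρ : ℝ) (u u' : ℂ) :
    CircleIntegrable (fun ζ => Real.log (ρ / 2) + (Real.log ‖ζ - u‖ + Real.log ‖ζ - u'‖)) 0 1 :=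
  (circleIntegrable_const _ _ _).add
    ((circleIntegrable_log_norm_sub_const 1).add (circleIntegrable_log_norm_sub_const 1))

lemma circleAverage_half_mul_norm_mul {ρ : ℝ} (hρ : 0 < ρ) {r r' : ℂ}
    (hmul : r * r' = (ρ ^ 2 / 4 : ℝ)) (hle : ‖r'‖ ≤ ‖r‖) :
    Real.circleAverage (fun ζ => Real.log (ρ / 2) +
      (Real.log ‖ζ - 2 * r / ρ‖ + Real.log ‖ζ - 2 * r' / ρ‖)) 0 1 = Real.log ‖r‖ := by
  have hnorm : ‖r‖ * ‖r'‖ = (ρ / 2) ^ 2 := by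
    rw [← norm_mul, hmul, Complex.norm_real, Real.norm_of_nonneg (by positivity)]
    ring
  have hscale : ∀ v : ℂ, ‖2 * v / ρ‖ = ‖v‖ / (ρ / 2) := fun v => by
    rw [norm_div, norm_mul, Complex.norm_real, Real.norm_of_nonneg hρ.le, Complex.norm_ofNat]
    field_simp
  have hr : ρ / 2 ≤ ‖r‖ := by nlinarith [norm_nonneg r, norm_nonneg r']
  have hr' : ‖r'‖ ≤ ρ / 2 := by nlinarith [norm_nonneg r, norm_nonneg r']
  have hlog := fun v => circleIntegrable_log_norm_sub_const (a := v) (c := 0) 1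
  rw [Real.circleAverage_fun_add (circleIntegrable_const _ _ _)
      (f₂ := fun ζ => Real.log ‖ζ - 2 * r / ρ‖ + Real.log ‖ζ - 2 * r' / ρ‖)
      ((hlog _).add (hlog _)),
    Real.circleAverage_fun_add (hlog _) (hlog _), Real.circleAverage_const,
    circleAverage_log_norm_sub one_pos, circleAverage_log_norm_sub one_pos, zero_sub, zero_sub,
    logKer_neg, logKer_neg, logKer_of_le, logKer_of_ge, hscale, Real.log_one, add_zero,
    ← Real.log_mul (by positivity) (div_pos (by linarith) (by linarith)).ne',
    mul_div_cancel₀ _ (by positivity)]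
  · rwa [hscale, div_le_one (by positivity)]
  · rwa [hscale, one_le_div (by positivity)]

lemma tendsto_arcsineMean_logKer {ρ : ℝ} (hρ : 0 < ρ) (z : ℂ) {r : ℕ → ℝ} (hr0 : ∀ k, 0 < r k)
    (hanti : Antitone r) (hr : Tendsto r atTop (𝓝 0)) :
    Tendsto (fun k => arcsineMean (fun x => logKer (r k) (z - x)) ρ) atTop
      (𝓝 (Real.log (joukowskyRadius (ρ ^ 2 / 4) z))) := by
  obtain ⟨w, w', hmul, rfl, hle⟩ := exists_mul_eq_and_add_eq (ρ ^ 2 / 4 : ℝ) z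
  rw [joukowskyRadius_add (by positivity) hmul hle, ← circleAverage_half_mul_norm_mul hρ hmul hle]
  refine tendsto_circleAverage_of_antitone
    (fun k => circleIntegrable_comp_mul_re (F := fun x => logKer (r k) (w + w' - x))
      ((continuous_logKer (hr0 k)).comp (by fun_prop)) ρ)
    (circleIntegrable_half_mul_norm_mul ρ _ _)
    (fun ζ _ k hjk => logKer_mono (hr0 k) (hanti hjk) _) ?_
  filter_upwards [ae_circleMap_notMem (Set.countable_singleton (2 * w / (ρ : ℂ))) 0 one_ne_zero,
    ae_circleMap_notMem (Set.countable_singleton (2 * w' / (ρ : ℂ))) 0 one_ne_zero] with θ h h'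
  have hn : ‖circleMap 0 1 θ - 2 * w / ρ‖ ≠ 0 := norm_ne_zero_iff.2 (sub_ne_zero.2 h)
  have hn' : ‖circleMap 0 1 θ - 2 * w' / ρ‖ ≠ 0 := norm_ne_zero_iff.2 (sub_ne_zero.2 h')
  have hnorm := norm_sub_mul_re hρ hmul (ζ := circleMap 0 1 θ) (by simp)
  rw [← Real.log_mul hn hn', ← Real.log_mul (by positivity) (mul_ne_zero hn hn'), ← hnorm]
  refine (tendsto_logKer (norm_ne_zero_iff.1 ?_)).comp hr
  rw [hnorm]
  positivity

lemma truncPotential_semicircle (ht : 0 < t) {r : ℝ} (hr : 0 < r) (z : ℂ) :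
    truncPotential (semicircle t) r z =
      (∫ β in 0..1, arcsineMean (fun x => logKer r (z - x)) (2 * √(t * β))) -
        ∫ β in 0..1, arcsineMean (fun x => logKer 1 (x : ℂ)) (2 * √(t * β)) := by
  have hker : Continuous fun w : ℂ => logKer r (z - w) := (continuous_logKer hr).comp (by fun_prop)
  have hone : Continuous fun w : ℂ => logKer 1 w := continuous_logKer one_pos
  have hkerℝ : Continuous fun x : ℝ => logKer r (z - x) := hker.comp Complex.continuous_ofReal
  have honeℝ : Continuous fun x : ℝ => logKer 1 (x : ℂ) := hone.comp Complex.continuous_ofReal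
  have hmean := continuous_arcsineMean hkerℝ
  have hmean' := continuous_arcsineMean honeℝ
  rw [← intervalIntegral.integral_sub (Continuous.intervalIntegrable (by fun_prop) _ _)
    (Continuous.intervalIntegrable (by fun_prop) _ _)]
  refine (integral_semicircle ht (hker.sub hone)).trans
    (intervalIntegral.integral_congr fun β _ => ?_)
  exact Real.circleAverage_fun_sub (circleIntegrable_comp_mul_re hkerℝ _)
    (circleIntegrable_comp_mul_re honeℝ _)

theorem isRieszMeasure_semicircle (ht : 0 < t) :
    IsRieszMeasure (hermitePot t 1) (semicircle t)
      (∫ β in 0..1, arcsineMean (fun x => logKer 1 (x : ℂ)) (2 * √(t * β))) := by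
  have := isProbabilityMeasure_semicircle ht
  set r : ℕ → ℝ := fun k => 1 / ((k : ℝ) + 1)
  have hr0 : ∀ k, 0 < r k := fun k => by positivity
  have hanti : Antitone r := fun j k hjk => one_div_le_one_div_of_le (by positivity) (by gcongr)
  have hr : Tendsto r atTop (𝓝 0) := tendsto_one_div_add_atTop_nhds_zero_nat
  have hker : ∀ k z, Continuous fun x : ℝ => logKer (r k) (z - (x : ℂ)) := fun k z =>
    (continuous_logKer (hr0 k)).comp (by fun_prop)
  refine isRieszMeasure_of_tendsto (continuous_hermitePot ht ⟨zero_le_one, le_rfl⟩) hr0 hanti hr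
    fun z => ?_
  simp_rw [truncPotential_semicircle ht (hr0 _), add_sub_cancel, hermitePot,
    intervalIntegral.integral_of_le zero_le_one]
  refine integral_tendsto_of_tendsto_of_antitone (fun k => ?_)
    (intervalIntegrable_log_joukowskyRadius ht z (by simp) (by simp)).1 ?_ ?_
  · have := continuous_arcsineMean (hker k z)
    exact (Continuous.continuousOn (by fun_prop)).integrableOn_Icc.mono_set Set.Ioc_subset_Icc_self
  · exact ae_of_all _ fun β j k hjk => Real.circleAverage_mono
      (circleIntegrable_comp_mul_re (hker k z) _) (circleIntegrable_comp_mul_re (hker j z) _)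
      fun ζ _ => logKer_mono (hr0 k) (hanti hjk) _
  · refine (ae_restrict_iff' measurableSet_Ioc).2 (ae_of_all _ fun β hβ => ?_)
    have hc := mul_pos ht hβ.1
    have hlim := tendsto_arcsineMean_logKer (ρ := 2 * √(t * β)) (by positivity) z hr0 hanti hr
    rwa [mul_pow, Real.sq_sqrt hc.le, show (2 : ℝ) ^ 2 * (t * β) / 4 = t * β by ring] at hlim

end Semicircle

/-! ### Bounds for the evolved polynomials -/

section CircleBound

lemma eventually_integral_le_add {α : Type*} {_ : MeasurableSpace α} {μ : Measure α}
    {f : ℕ → α → ℝ} {U K : α → ℝ} (hf : ∀ m, Integrable (f m) μ) (hU : Integrable U μ)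
    (hK : Integrable K μ) (hfK : ∀ᶠ m in atTop, f m ≤ᵐ[μ] K)
    (hle : ∀ᵐ x ∂μ, ∀ δ : ℝ, 0 < δ → ∀ᶠ m in atTop, f m x ≤ U x + δ) {ε : ℝ} (hε : 0 < ε) :
    ∀ᶠ m in atTop, ∫ x, f m x ∂μ ≤ ∫ x, U x ∂μ + ε := by
  have hint : ∀ m, Integrable (fun x => max (min (f m x) (K x)) (U x)) μ := fun m =>
    ((hf m).inf hK).sup hU
  have hlim : Tendsto (fun m => ∫ x, max (min (f m x) (K x)) (U x) ∂μ) atTop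
      (𝓝 (∫ x, U x ∂μ)) := by
    refine tendsto_integral_of_dominated_convergence (fun x => |U x| + |K x|)
      (fun m => (hint m).1) (hU.abs.add hK.abs) (fun m => ae_of_all _ fun x => ?_) ?_
    · have h : min (f m x) (K x) ≤ K x := min_le_right _ _
      refine abs_le.2 ⟨le_max_of_le_right ?_, max_le ?_ ?_⟩ <;>
        linarith [neg_abs_le (U x), le_abs_self (U x), le_abs_self (K x), abs_nonneg (U x),
          abs_nonneg (K x)]
    · filter_upwards [hle] with x hx
      refine tendsto_order.2 ⟨fun b hb => .of_forall fun m => hb.trans_le (le_max_right _ _),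
        fun b hb => ?_⟩
      filter_upwards [hx ((b - U x) / 2) (by linarith)] with m hm
      exact max_lt ((min_le_left _ _).trans_lt (by linarith)) hb
  filter_upwards [hlim.eventually_le_const (lt_add_of_pos_right _ hε), hfK] with m hm hK'
  refine (integral_mono_ae (hf m) (hint m) ?_).trans hm
  filter_upwards [hK'] with x hx
  exact le_max_of_le_left (le_min le_rfl hx)

lemma eventually_circleAverage_log_norm_eval_le {q : ℕ → ℂ[X]} {N : ℕ → ℕ}
    (hN : Tendsto N atTop atTop) (hq : ∀ᶠ m in atTop, q m ≠ 0) {U : ℂ → ℝ} {z : ℂ} {R K : ℝ}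
    (hU : CircleIntegrable U z R) (hR : R ≠ 0)
    (hK : ∀ᶠ m in atTop, ∀ θ : ℝ, ‖(q m).eval (circleMap z R θ)‖ ≤ Real.exp (N m * K))
    (hle : ∀ᵐ θ : ℝ, ∀ δ : ℝ, 0 < δ → ∀ᶠ m in atTop,
      ‖(q m).eval (circleMap z R θ)‖ ≤ Real.exp (N m * (U (circleMap z R θ) + δ)))
    {ε : ℝ} (hε : 0 < ε) :
    ∀ᶠ m in atTop, Real.circleAverage (fun ζ => Real.log ‖(q m).eval ζ‖) z R ≤
      N m * (Real.circleAverage U z R + ε) := by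
  have hroot : ∀ᵐ θ : ℝ, ∀ m, q m ≠ 0 → (q m).eval (circleMap z R θ) ≠ 0 :=
    ae_all_iff.2 fun m => eventually_imp_distrib_left.2 fun hm => ae_eval_circleMap_ne_zero hm z hR
  have hlog : ∀ m θ c, 0 < N m → (q m).eval (circleMap z R θ) ≠ 0 →
      ‖(q m).eval (circleMap z R θ)‖ ≤ Real.exp (N m * c) →
      (N m : ℝ)⁻¹ * Real.log ‖(q m).eval (circleMap z R θ)‖ ≤ c := fun m θ c hm hθ h => by
    rwa [inv_mul_le_iff₀ (Nat.cast_pos.2 hm), Real.log_le_iff_le_exp (norm_pos_iff.2 hθ)]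
  have hmean := eventually_integral_le_add (μ := volume.restrict (Set.Ioc 0 (2 * Real.pi)))
    (f := fun m θ => (N m : ℝ)⁻¹ * Real.log ‖(q m).eval (circleMap z R θ)‖) (K := fun _ => K)
    (fun m => (circleIntegrable_log_norm_eval (q m) z R).1.const_mul _) hU.1
    (integrable_const K) ?_ (ae_restrict_of_ae ?_) (mul_pos Real.two_pi_pos hε)
  · filter_upwards [hmean, hN.eventually_gt_atTop 0] with m hm hNm
    have hNm' : (0 : ℝ) < N m := Nat.cast_pos.2 hNm
    rw [integral_const_mul, inv_mul_le_iff₀ hNm'] at hm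
    simp only [Real.circleAverage, intervalIntegral.integral_of_le Real.two_pi_pos.le, smul_eq_mul]
    rw [inv_mul_le_iff₀ Real.two_pi_pos]
    refine hm.trans_eq ?_
    field_simp
  · filter_upwards [hK, hq, hN.eventually_gt_atTop 0] with m hm hqm hNm
    filter_upwards [ae_restrict_of_ae hroot] with θ hθ
    exact hlog m θ K hNm (hθ m hqm) (hm θ)
  · filter_upwards [hroot, hle] with θ hθ hθle δ hδ
    filter_upwards [hθle δ hδ, hq, hN.eventually_gt_atTop 0] with m hm hqm hNm
    exact hlog m θ _ hNm (hθ m hqm) hm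

lemma ae_circleMap_im_ne_zero (z : ℂ) {R : ℝ} (hR : R ≠ 0) :
    ∀ᵐ θ : ℝ, (circleMap z R θ).im ≠ 0 := by
  set p : ℂ[X] := (X - C z) * (X - C (starRingEnd ℂ z)) - C ((R : ℂ) ^ 2) with hp
  have hp0 : p ≠ 0 := fun h => by simpa [hp, hR] using congrArg (eval z) h
  filter_upwards [ae_eval_circleMap_ne_zero hp0 z hR] with θ hθ him
  apply hθ
  -- A real point `ζ` of the circle satisfies `R ^ 2 = |ζ - z| ^ 2 = (ζ - z) * (ζ - conj z)`.
  have hconj : circleMap z R θ - starRingEnd ℂ z = starRingEnd ℂ (circleMap z R θ - z) := by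
    rw [map_sub, Complex.conj_eq_iff_im.2 him]
  have hnorm : ‖circleMap z R θ - z‖ = |R| := by simp [circleMap]
  simp only [hp, eval_sub, eval_mul, eval_X, eval_C]
  rw [hconj, Complex.mul_conj', hnorm, ← Complex.ofReal_pow, sq_abs, Complex.ofReal_pow, sub_self]

end CircleBound

section FlowPoly

/-- The polynomial with coefficients `x k * a n k`, evolved by the heat flow up to time `t / n`. -/
def flowPoly (a : ℕ → ℕ → ℂ) (t : ℝ) (n : ℕ) (x : ℕ → ℂ) : ℂ[X] :=
  heatFlow ((t : ℂ) / (n : ℂ)) (∑ k ∈ Finset.range (n + 1), C (x k * a n k) * X ^ k)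

/-- The value at `z` of the `k`-th summand of `flowPoly`, up to the noise. -/
def flowCoeff (a : ℕ → ℕ → ℂ) (t : ℝ) (n : ℕ) (z : ℂ) (k : ℕ) : ℂ :=
  a n k * (hermitePoly ((t / n : ℝ) : ℂ) k).eval z

lemma eval_flowPoly (a : ℕ → ℕ → ℂ) (t : ℝ) (n : ℕ) (x : ℕ → ℂ) (z : ℂ) :
    (flowPoly a t n x).eval z = ∑ k ∈ Finset.range (n + 1), x k * flowCoeff a t n z k := by
  rw [flowPoly, heatFlow_sum_C_mul_X_pow, eval_finsetSum]
  refine Finset.sum_congr rfl fun k _ => ?_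
  rw [eval_mul, eval_C, flowCoeff]
  push_cast
  ring

lemma natDegree_flowPoly_le (a : ℕ → ℕ → ℂ) (t : ℝ) (n : ℕ) (x : ℕ → ℂ) :
    (flowPoly a t n x).natDegree ≤ n :=
  (natDegree_heatFlow_le _ _).trans <| natDegree_sum_le_of_forall_le _ _ fun _ hk =>
    (natDegree_C_mul_X_pow_le _ _).trans (Finset.mem_range_succ_iff.1 hk)

lemma eventually_add_one_le_exp {ε : ℝ} (hε : 0 < ε) :
    ∀ᶠ n : ℕ in atTop, (n : ℝ) + 1 ≤ Real.exp (n * ε) := by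
  filter_upwards [tendsto_natCast_atTop_atTop.eventually_ge_atTop (2 / ε ^ 2)] with n hn
  have hexp := Real.quadratic_le_exp_of_nonneg (x := n * ε) (by positivity)
  have hn' : 2 ≤ n * ε ^ 2 := by rwa [div_le_iff₀ (by positivity)] at hn
  nlinarith [mul_le_mul_of_nonneg_left hn' (Nat.cast_nonneg (α := ℝ) n),
    mul_nonneg (Nat.cast_nonneg (α := ℝ) n) hε.le]

lemma natCast_div_mem_Icc {n k : ℕ} (hk : k ≤ n) : (k : ℝ) / n ∈ Set.Icc (0 : ℝ) 1 :=
  ⟨by positivity, div_le_one_of_le₀ (by exact_mod_cast hk) (by positivity)⟩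

lemma norm_eval_flowPoly_le {a : ℕ → ℕ → ℂ} {t : ℝ} {n : ℕ} {x : ℕ → ℂ} {z : ℂ} {b b' ε : ℝ}
    (hn : (n : ℝ) + 1 ≤ Real.exp (n * ε)) (hx : ∀ k ≤ n, ‖x k‖ ≤ Real.exp (n * b))
    (hz : ∀ k ≤ n, ‖flowCoeff a t n z k‖ ≤ Real.exp (n * b')) :
    ‖(flowPoly a t n x).eval z‖ ≤ Real.exp (n * (ε + b + b')) := by
  rw [eval_flowPoly]
  calc ‖∑ k ∈ Finset.range (n + 1), x k * flowCoeff a t n z k‖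
      ≤ ∑ _k ∈ Finset.range (n + 1), Real.exp (n * b) * Real.exp (n * b') := by
        refine norm_sum_le_of_le _ fun k hk => ?_
        rw [Finset.mem_range_succ_iff] at hk
        rw [norm_mul]
        exact mul_le_mul (hx k hk) (hz k hk) (norm_nonneg _) (Real.exp_pos _).le
    _ = ((n : ℝ) + 1) * (Real.exp (n * b) * Real.exp (n * b')) := by simp
    _ ≤ Real.exp (n * ε) * (Real.exp (n * b) * Real.exp (n * b')) := by gcongr
    _ = Real.exp (n * (ε + b + b')) := by
        rw [← Real.exp_add, ← Real.exp_add]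
        ring_nf

/-- The profile condition of `HasExponentialProfile`, without regularity conditions on `g`. -/
def IsExponentialProfile (a : ℕ → ℕ → ℂ) (g : ℝ → ℝ) : Prop :=
  ∀ ε : ℝ, 0 < ε → ∀ᶠ n : ℕ in atTop, ∀ k ≤ n,
    a n k ≠ 0 ∧ |1 / (n : ℝ) * Real.log ‖a n k‖ - g ((k : ℝ) / n)| ≤ ε

namespace IsExponentialProfile

variable {a : ℕ → ℕ → ℂ} {g : ℝ → ℝ} {t : ℝ}

lemma eventually_exp_le_norm_flowCoeff_le (ha : IsExponentialProfile a g) (ht : 0 ≤ t) {z : ℂ}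
    (hz : z.im ≠ 0) {ε : ℝ} (hε : 0 < ε) : ∀ᶠ n : ℕ in atTop, ∀ k ≤ n,
      Real.exp (n * (g (k / n) + hermitePot t (k / n) z - ε)) ≤ ‖flowCoeff a t n z k‖ ∧
      ‖flowCoeff a t n z k‖ ≤ Real.exp (n * (g (k / n) + hermitePot t (k / n) z + ε)) := by
  filter_upwards [ha (ε / 2) (half_pos hε),
    eventually_abs_log_hermitePoly_sub_le hz ht (half_pos hε), eventually_gt_atTop 0]
    with n hcoeff hherm hn k hk
  have hn' : (0 : ℝ) < n := Nat.cast_pos.2 hn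
  obtain ⟨ha0, hcoeff⟩ := hcoeff k hk
  obtain ⟨hh0, hherm⟩ := hherm k hk
  rw [abs_le] at hcoeff hherm
  have hlog : Real.log ‖flowCoeff a t n z k‖ = n * (1 / (n : ℝ) * Real.log ‖a n k‖ +
      1 / (n : ℝ) * Real.log ‖(hermitePoly ((t / n : ℝ) : ℂ) k).eval z‖) := by
    rw [flowCoeff, norm_mul, Real.log_mul (norm_ne_zero_iff.2 ha0) (norm_ne_zero_iff.2 hh0)]
    field_simp
  have hpos : 0 < ‖flowCoeff a t n z k‖ := norm_pos_iff.2 (mul_ne_zero ha0 hh0)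
  rw [← Real.le_log_iff_exp_le hpos, ← Real.log_le_iff_le_exp hpos, hlog]
  constructor <;> refine mul_le_mul_of_nonneg_left ?_ hn'.le <;> linarith

lemma eventually_norm_eval_flowPoly_le (ha : IsExponentialProfile a g)
    (hg : ContinuousOn g (Set.Icc 0 1)) (ht : 0 < t) {z : ℂ} (hz : z.im ≠ 0) {ε : ℝ} (hε : 0 < ε) :
    ∀ᶠ n : ℕ in atTop, ∀ x : ℕ → ℂ, (∀ k ≤ n, ‖x k‖ ≤ Real.exp (n * (ε / 3))) →
      ‖(flowPoly a t n x).eval z‖ ≤ Real.exp (n * (limitPot t g z + ε)) := by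
  have hε3 : 0 < ε / 3 := by positivity
  filter_upwards [ha.eventually_exp_le_norm_flowCoeff_le ht.le hz hε3,
    eventually_add_one_le_exp hε3] with n hcoeff hn x hx
  have hle : ∀ k ≤ n, ‖flowCoeff a t n z k‖ ≤ Real.exp (n * (limitPot t g z + ε / 3)) := by
    refine fun k hk => (hcoeff k hk).2.trans ?_
    gcongr
    exact le_limitPot ht hg z (natCast_div_mem_Icc hk)
  refine (norm_eval_flowPoly_le hn hx hle).trans_eq ?_
  ring_nf

lemma exists_norm_coeff_le (ha : IsExponentialProfile a g) (hg : ContinuousOn g (Set.Icc 0 1)) :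
    ∃ A : ℝ, ∀ᶠ n : ℕ in atTop, ∀ k ≤ n, ‖a n k‖ ≤ Real.exp (n * A) := by
  obtain ⟨A, hA⟩ := (isCompact_Icc.image_of_continuousOn hg).bddAbove
  refine ⟨A + 1, ?_⟩
  filter_upwards [ha 1 one_pos, eventually_gt_atTop 0] with n hcoeff hn k hk
  have hn' : (0 : ℝ) < n := Nat.cast_pos.2 hn
  obtain ⟨ha0, hcoeff⟩ := hcoeff k hk
  have hgA := hA (Set.mem_image_of_mem g (natCast_div_mem_Icc hk))
  rw [← Real.log_le_iff_le_exp (norm_pos_iff.2 ha0), ← div_le_iff₀' hn', div_eq_inv_mul,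
    ← one_div]
  linarith [(abs_le.1 hcoeff).2]

lemma exists_norm_eval_flowPoly_le (ha : IsExponentialProfile a g)
    (hg : ContinuousOn g (Set.Icc 0 1)) (ht : 0 ≤ t) (ρ : ℝ) :
    ∃ K : ℝ, ∀ᶠ n : ℕ in atTop, ∀ x : ℕ → ℂ, (∀ k ≤ n, ‖x k‖ ≤ Real.exp n) →
      ∀ z : ℂ, ‖z‖ ≤ ρ → ‖(flowPoly a t n x).eval z‖ ≤ Real.exp (n * K) := by
  obtain ⟨A, hA⟩ := ha.exists_norm_coeff_le hg
  refine ⟨1 + 1 + (A + Real.log (|ρ| + t + 1)), ?_⟩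
  filter_upwards [hA, eventually_add_one_le_exp one_pos, eventually_gt_atTop 0]
    with n hcoeff hexp hn x hx z hz
  have hn' : (n : ℝ) ≠ 0 := Nat.cast_ne_zero.2 hn.ne'
  refine norm_eval_flowPoly_le hexp (by simpa only [mul_one] using hx) fun k hk => ?_
  have hherm : ‖(hermitePoly ((t / n : ℝ) : ℂ) k).eval z‖ ≤
      Real.exp (n * Real.log (|ρ| + t + 1)) := by
    rw [mul_comm, Real.exp_mul, Real.exp_log (by positivity), Real.rpow_natCast]
    calc ‖(hermitePoly ((t / n : ℝ) : ℂ) k).eval z‖ ≤ (‖z‖ + t + 1) ^ k :=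
          norm_hermitePoly_eval_le (by positivity) z (div_mul_cancel₀ t hn').le k hk
      _ ≤ (|ρ| + t + 1) ^ k := by
          gcongr
          exact hz.trans (le_abs_self ρ)
      _ ≤ (|ρ| + t + 1) ^ n := pow_le_pow_right₀ (by linarith [abs_nonneg ρ]) hk
  rw [flowCoeff, norm_mul, mul_add, Real.exp_add]
  exact mul_le_mul (hcoeff k hk) hherm (norm_nonneg _) (Real.exp_pos _).le

lemma eventually_circleAverage_flowPoly_le (ha : IsExponentialProfile a g)
    (hg : ContinuousOn g (Set.Icc 0 1)) (ht : 0 < t) {N : ℕ → ℕ} (hN : Tendsto N atTop atTop)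
    {x : ℕ → ℕ → ℂ}
    (hx : ∀ ε : ℝ, 0 < ε → ∀ᶠ m in atTop, ∀ k ≤ N m, ‖x m k‖ ≤ Real.exp (N m * ε))
    (hne : ∀ᶠ m in atTop, flowPoly a t (N m) (x m) ≠ 0) (z : ℂ) {R : ℝ} (hR : R ≠ 0) {ε : ℝ}
    (hε : 0 < ε) : ∀ᶠ m in atTop,
      Real.circleAverage (fun ζ => Real.log ‖(flowPoly a t (N m) (x m)).eval ζ‖) z R ≤
        N m * (Real.circleAverage (limitPot t g) z R + ε) := by
  obtain ⟨K, hK⟩ := ha.exists_norm_eval_flowPoly_le hg ht.le (‖z‖ + |R|)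
  refine eventually_circleAverage_log_norm_eval_le hN hne
    (continuous_limitPot ht hg).continuousOn.circleIntegrable' hR (K := K) ?_ ?_ hε
  · filter_upwards [hN.eventually hK, hx 1 one_pos] with m hm hxm θ
    refine hm _ (by simpa only [mul_one] using hxm) _ ((norm_add_le _ _).trans_eq ?_)
    simp
  · filter_upwards [ae_circleMap_im_ne_zero z hR] with θ him δ hδ
    filter_upwards [hN.eventually (ha.eventually_norm_eval_flowPoly_le hg ht him hδ),
      hx (δ / 3) (by positivity)] with m hm hxm
    exact hm _ hxm

end IsExponentialProfile

end FlowPoly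

section IsGood

/-- The coefficients `x` are subexponential and the evolved polynomial is not too small at the first
few points of the sequence `zs`, both at precision `1 / (m + 1)`. -/
def IsGood (a : ℕ → ℕ → ℂ) (g : ℝ → ℝ) (t : ℝ) (zs : ℕ → ℂ) (m n : ℕ) (x : ℕ → ℂ) : Prop :=
  (∀ k ≤ n, ‖x k‖ ≤ Real.exp (n * (1 / ((m : ℝ) + 1)))) ∧
    ∀ i ≤ m, Real.exp (n * (limitPot t g (zs i) - 1 / ((m : ℝ) + 1))) ≤
      ‖(flowPoly a t n x).eval (zs i)‖

variable {a : ℕ → ℕ → ℂ} {g : ℝ → ℝ} {t : ℝ} {zs : ℕ → ℂ}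

lemma IsGood.flowPoly_ne_zero {m n : ℕ} {x : ℕ → ℂ} (h : IsGood a g t zs m n x) :
    flowPoly a t n x ≠ 0 := fun h0 => by
  simpa [h0] using (Real.exp_pos _).trans_le (h.2 0 m.zero_le)

lemma hasLogPotential_of_isGood (ha : IsExponentialProfile a g)
    (hg : ContinuousOn g (Set.Icc 0 1)) (ht : 0 < t) (hzs : DenseRange zs) {N : ℕ → ℕ}
    (hN : Tendsto N atTop atTop) {x : ℕ → ℕ → ℂ} (hx : ∀ m, IsGood a g t zs m (N m) (x m)) :
    HasLogPotential (fun m => flowPoly a t (N m) (x m)) N (limitPot t g) (Set.range zs) where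
  continuous := continuous_limitPot ht hg
  dense := hzs
  grow := exists_log_sub_le_limitPot ht hg hzs
  tendsto_atTop := hN
  natDegree_le := fun m => natDegree_flowPoly_le a t _ _
  lower := by
    rintro _ ⟨i, rfl⟩ ε hε
    filter_upwards [tendsto_one_div_add_atTop_nhds_zero_nat.eventually_lt_const hε,
      eventually_ge_atTop i] with m hm hi
    refine le_trans ?_ ((hx m).2 i hi)
    gcongr
  upper := fun z R hR ε hε => by
    refine ha.eventually_circleAverage_flowPoly_le hg ht hN (fun δ hδ => ?_)
      (.of_forall fun m => (hx m).flowPoly_ne_zero) z hR.ne' hε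
    filter_upwards [tendsto_one_div_add_atTop_nhds_zero_nat.eventually_lt_const hδ] with m hm k hk
    refine ((hx m).1 k hk).trans ?_
    gcongr

end IsGood

/-! ### Realizations are good with high probability -/

lemma tendsto_mul_measureReal_gt {Ω : Type*} [MeasurableSpace Ω] {P : Measure Ω}
    [IsFiniteMeasure P] {Y : Ω → ℝ} (hY : Measurable Y) (hi : Integrable Y P) {c : ℝ}
    (hc : 0 < c) :
    Tendsto (fun n : ℕ => ((n : ℝ) + 1) * P.real {ω | n * c < Y ω}) atTop (𝓝 0) := by
  have hms : ∀ n : ℕ, MeasurableSet {ω | n * c < Y ω} := fun n =>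
    measurableSet_lt measurable_const hY
  have hint : Integrable (fun ω => Y ω + c) P := hi.add (integrable_const c)
  have hanti : Antitone fun n : ℕ => {ω | n * c < Y ω} := fun m n hmn ω (hω : n * c < Y ω) =>
    (mul_le_mul_of_nonneg_right (Nat.cast_le.2 hmn) hc.le).trans_lt hω
  have hempty : ⋂ n : ℕ, {ω | n * c < Y ω} = ∅ := Set.eq_empty_of_forall_notMem fun ω hω => by
    obtain ⟨n, hn⟩ := exists_nat_ge (Y ω / c)
    exact (Set.mem_iInter.1 hω n).not_ge ((div_le_iff₀ hc).1 hn)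
  have hlim := (hanti.tendsto_setIntegral hms hint.integrableOn).const_mul c⁻¹
  rw [hempty, setIntegral_empty, mul_zero] at hlim
  refine squeeze_zero (fun n => by positivity) (fun n => ?_) hlim
  rw [le_inv_mul_iff₀ hc, ← mul_assoc, mul_add_one, mul_comm c]
  exact setIntegral_ge_of_const_le_real (hms n) (measure_ne_top _ _)
    (fun ω hω => by linarith [show n * c < Y ω from hω]) hint.integrableOn

lemma eventually_le_card_filter_div_mem_Icc {p q : ℝ} (hp : 0 ≤ p) (hpq : p < q) (hq : q ≤ 1)
    (M : ℕ) : ∀ᶠ n : ℕ in atTop,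
      M ≤ ((Finset.range (n + 1)).filter fun k : ℕ => (k : ℝ) / n ∈ Set.Icc p q).card := by
  have hlen := tendsto_natCast_atTop_atTop.eventually_ge_atTop ((M + 1) / (q - p))
  filter_upwards [hlen, eventually_gt_atTop 0] with n hlen hn
  have hn' : (0 : ℝ) < n := Nat.cast_pos.2 hn
  rw [div_le_iff₀ (sub_pos.2 hpq)] at hlen
  have hsub : Finset.Icc ⌈p * n⌉₊ ⌊q * n⌋₊ ⊆
      (Finset.range (n + 1)).filter fun k : ℕ => (k : ℝ) / n ∈ Set.Icc p q := by
    intro k hk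
    obtain ⟨hpk, hkq⟩ := Finset.mem_Icc.1 hk
    rw [Nat.ceil_le] at hpk
    rw [Nat.le_floor_iff (mul_nonneg (hp.trans hpq.le) hn'.le)] at hkq
    refine Finset.mem_filter.2 ⟨Finset.mem_range_succ_iff.2 ?_, (le_div_iff₀ hn').2 hpk,
      (div_le_iff₀ hn').2 hkq⟩
    exact_mod_cast hkq.trans (mul_le_of_le_one_left hn'.le hq)
  refine le_trans ?_ (Finset.card_le_card hsub)
  have hceil := Nat.ceil_lt_add_one (a := p * n) (by positivity)
  have hfloor := Nat.lt_floor_add_one (q * n)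
  have hgap : (⌈p * n⌉₊ + M : ℝ) < ⌊q * n⌋₊ + 1 + 1 := by nlinarith
  rw [Nat.card_Icc]
  norm_cast at hgap
  lia

lemma exists_Icc_le_add_hermitePot {g : ℝ → ℝ} {t : ℝ} (ht : 0 < t)
    (hg : ContinuousOn g (Set.Icc 0 1)) (z : ℂ) {ε : ℝ} (hε : 0 < ε) :
    ∃ p q : ℝ, 0 ≤ p ∧ p < q ∧ q ≤ 1 ∧
      ∀ β ∈ Set.Icc p q, limitPot t g z - ε ≤ g β + hermitePot t β z := by
  obtain ⟨α, hα, hmax⟩ := exists_limitPot_eq ht hg z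
  obtain ⟨η, hη, hclose⟩ :=
    Metric.continuousOn_iff.1 (hg.add (continuousOn_hermitePot ht z)) α hα ε hε
  refine ⟨max 0 (α - η / 2), min 1 (α + η / 2), le_max_left _ _, ?_, min_le_left _ _,
    fun β hβ => ?_⟩
  · rw [max_lt_iff, lt_min_iff, lt_min_iff]
    exact ⟨⟨one_pos, by linarith [hα.1]⟩, by linarith [hα.2], by linarith⟩
  · obtain ⟨⟨h0, hlo⟩, h1, hhi⟩ := hβ.imp max_le_iff.1 le_min_iff.1
    have hβα := hclose β ⟨h0, h1⟩ (abs_lt.2 ⟨by linarith, by linarith⟩)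
    rw [Real.dist_eq, Pi.add_apply, Pi.add_apply, ← hmax] at hβα
    linarith [(abs_lt.1 hβα).1]

namespace IsAdmissibleNoise

variable {Ω : Type*} [MeasurableSpace Ω] {P : Measure Ω} [IsProbabilityMeasure P]
  {ξ : ℕ → Ω → ℂ} {a : ℕ → ℕ → ℂ} {g : ℝ → ℝ} {t : ℝ}

lemma measureReal_norm_gt_le (hξ : IsAdmissibleNoise P ξ) (c : ℝ) (k : ℕ) :
    P.real {ω | Real.exp c < ‖ξ k ω‖} ≤ P.real {ω | c < Real.log (1 + ‖ξ 0 ω‖)} := by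
  have hdist := congrArg ENNReal.toReal ((hξ.identDistrib k).measure_mem_eq
    (s := {w : ℂ | Real.exp c < ‖w‖}) (measurableSet_lt measurable_const measurable_norm))
  refine hdist.trans_le (measureReal_mono fun ω hω => ?_)
  exact (Real.lt_log_iff_exp_lt (by positivity)).2
    ((show Real.exp c < ‖ξ 0 ω‖ from hω).trans (lt_one_add _))

lemma tendsto_measureReal_exists_norm_gt (hξ : IsAdmissibleNoise P ξ) {c : ℝ} (hc : 0 < c) :
    Tendsto (fun n : ℕ => P.real {ω | ∃ k ≤ n, Real.exp (n * c) < ‖ξ k ω‖}) atTop (𝓝 0) := by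
  have hmeas : Measurable fun ω => Real.log (1 + ‖ξ 0 ω‖) :=
    ((hξ.measurable 0).norm.const_add 1).log
  refine squeeze_zero (fun n => measureReal_nonneg) (fun n => ?_)
    (tendsto_mul_measureReal_gt hmeas hξ.integrable_log hc)
  calc P.real {ω | ∃ k ≤ n, Real.exp (n * c) < ‖ξ k ω‖}
      = P.real (⋃ k ∈ Finset.range (n + 1), {ω | Real.exp (n * c) < ‖ξ k ω‖}) := by
        congr 1
        ext ω
        simp
    _ ≤ ∑ k ∈ Finset.range (n + 1), P.real {ω | Real.exp (n * c) < ‖ξ k ω‖} :=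
        measureReal_biUnion_finset_le _ _
    _ ≤ ∑ _k ∈ Finset.range (n + 1), P.real {ω | n * c < Real.log (1 + ‖ξ 0 ω‖)} :=
        Finset.sum_le_sum fun k _ => hξ.measureReal_norm_gt_le _ k
    _ = ((n : ℝ) + 1) * P.real {ω | n * c < Real.log (1 + ‖ξ 0 ω‖)} := by simp

lemma tendsto_measureReal_norm_eval_flowPoly_lt (hξ : IsAdmissibleNoise P ξ)
    (ha : IsExponentialProfile a g) (hg : ContinuousOn g (Set.Icc 0 1)) (ht : 0 < t) {z : ℂ}
    (hz : z.im ≠ 0) {ε : ℝ} (hε : 0 < ε) :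
    Tendsto (fun n : ℕ => P.real {ω | ‖(flowPoly a t n fun k => ξ k ω).eval z‖ <
      Real.exp (n * (limitPot t g z - ε))}) atTop (𝓝 0) := by
  have hε3 : 0 < ε / 3 := by positivity
  obtain ⟨c, hc, hanti⟩ := hξ.exists_anticoncentration
  obtain ⟨p, q, hp, hpq, hq, hβ⟩ := exists_Icc_le_add_hermitePot ht hg z hε3
  refine tendsto_order.2 ⟨fun b hb => .of_forall fun n => hb.trans_le measureReal_nonneg,
    fun b hb => ?_⟩
  obtain ⟨M, hM⟩ := hanti (b / 2) (by positivity)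
  have hsmall : ∀ᶠ n : ℕ in atTop, Real.exp (-(n * (ε / 3))) ≤ c :=
    (Real.tendsto_exp_neg_atTop_nhds_zero.comp
      (tendsto_natCast_atTop_atTop.atTop_mul_const hε3)).eventually_le_const hc
  filter_upwards [hsmall, eventually_le_card_filter_div_mem_Icc hp hpq hq M,
    ha.eventually_exp_le_norm_flowCoeff_le ht.le hz hε3] with n hcn hcard hcoeff
  set B := Real.exp (n * (limitPot t g z - 2 * (ε / 3))) with hB
  have hlarge : M ≤ ((Finset.range (n + 1)).filter fun k => B ≤ ‖flowCoeff a t n z k‖).card := by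
    refine hcard.trans (Finset.card_le_card fun k hkpq => ?_)
    obtain ⟨hk, hkpq⟩ := Finset.mem_filter.1 hkpq
    refine Finset.mem_filter.2 ⟨hk, le_trans ?_ (hcoeff k (Finset.mem_range_succ_iff.1 hk)).1⟩
    rw [hB]
    exact Real.exp_le_exp.2 (mul_le_mul_of_nonneg_left (by linarith [hβ _ hkpq]) n.cast_nonneg)
  refine lt_of_le_of_lt ((measureReal_mono fun ω hω => ?_).trans
    (hM _ (flowCoeff a t n z) B (Real.exp_pos _) hlarge)) (half_lt_self hb)
  rw [Set.mem_ofPred_eq, eval_flowPoly, show n * (limitPot t g z - ε) =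
    -(n * (ε / 3)) + n * (limitPot t g z - 2 * (ε / 3)) by ring, Real.exp_add] at hω
  exact hω.le.trans (by gcongr)

lemma tendsto_measureReal_not_isGood (hξ : IsAdmissibleNoise P ξ) (ha : IsExponentialProfile a g)
    (hg : ContinuousOn g (Set.Icc 0 1)) (ht : 0 < t) {zs : ℕ → ℂ} (hz : ∀ i, (zs i).im ≠ 0)
    (m : ℕ) :
    Tendsto (fun n : ℕ => P.real {ω | ¬ IsGood a g t zs m n fun k => ξ k ω}) atTop (𝓝 0) := by
  have hm : (0 : ℝ) < 1 / ((m : ℝ) + 1) := by positivity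
  have hlim := (hξ.tendsto_measureReal_exists_norm_gt hm).add
    (tendsto_finsetSum (Finset.range (m + 1)) fun i _ =>
      hξ.tendsto_measureReal_norm_eval_flowPoly_lt ha hg ht (hz i) hm)
  rw [Finset.sum_const_zero, add_zero] at hlim
  refine squeeze_zero (fun n => measureReal_nonneg) (fun n => ?_) hlim
  refine (measureReal_mono fun ω hω => ?_).trans <| (measureReal_union_le _ _).trans <|
    add_le_add_right (measureReal_biUnion_finset_le _ _) _
  contrapose! hω
  simp only [Set.mem_union, Set.mem_iUnion, Finset.mem_range, Set.mem_ofPred_eq, not_or,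
    not_exists, not_and, not_lt] at hω
  exact not_not.2 ⟨fun k hk => hω.1 k hk, fun i hi => hω.2 i (Nat.lt_succ_of_le hi)⟩

end IsAdmissibleNoise

/-! ### Potentials of measures carried by the real line -/

section RealLine

variable {U V h : ℂ → ℝ} {z : ℂ} {R : ℝ}

lemma IsRieszMeasure.circleAverage_eq_self (hU : Continuous U) {ν : Measure ℂ} {L : ℝ}
    (h : IsRieszMeasure U ν L) (hν : ∀ᵐ w ∂ν, w.im = 0) (hR : 0 < R) (hRz : R ≤ z.im) :
    Real.circleAverage U z R = U z := by
  have hval : ∀ r : ℝ, 0 < r → r ≤ z.im →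
      Real.circleAverage U z r = L + ∫ w, (Real.log ‖z - w‖ - logKer 1 w) ∂ν := by
    intro r hr hrz
    rw [h z r hr, truncPotential]
    congr 1
    refine integral_congr_ae ?_
    filter_upwards [hν] with w hw
    rw [regKer, logKer_of_le]
    calc r ≤ (z - w).im := by rwa [Complex.sub_im, hw, sub_zero]
      _ ≤ ‖z - w‖ := (le_abs_self _).trans (Complex.abs_im_le_norm _)
  refine tendsto_nhds_unique (tendsto_const_nhds.congr' ?_)
    ((tendsto_circleAverage_zero hU z).comp tendsto_one_div_add_atTop_nhds_zero_nat)
  filter_upwards [tendsto_one_div_add_atTop_nhds_zero_nat.eventually_lt_const (hR.trans_le hRz)]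
    with k hk
  rw [Function.comp_apply, hval R hR hRz, hval _ (by positivity) hk.le]

lemma eq_zero_of_circleAverage_eq_zero (hc : Continuous h) (hnonneg : ∀ z, 0 ≤ h z)
    (hz : Real.circleAverage h z R = 0) {ζ : ℂ} (hζ : ζ ∈ Metric.sphere z |R|) : h ζ = 0 := by
  rw [← image_circleMap_Ioc] at hζ
  obtain ⟨θ, hθ, rfl⟩ := hζ
  by_contra hne
  have hpos := intervalIntegral.integral_pos (f := fun θ => h (circleMap z R θ)) Real.two_pi_pos
    (hc.comp (continuous_circleMap z R)).continuousOn (fun _ _ => hnonneg _)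
    ⟨θ, Set.Ioc_subset_Icc_self hθ, (hnonneg _).lt_of_ne' hne⟩
  rw [Real.circleAverage, smul_eq_mul] at hz
  exact (mul_pos (inv_pos.2 Real.two_pi_pos) hpos).ne' hz

/-- The minimum principle for a function which is harmonic, in the sense of the mean value property,
on the upper half-plane. -/
lemma eq_zero_of_circleAverage_eq_self (hc : Continuous h) (hnonneg : ∀ z, 0 ≤ h z)
    (hmean : ∀ z R, 0 < R → R ≤ z.im → Real.circleAverage h z R = h z) {z₀ : ℂ} (hz₀ : 0 < z₀.im)
    (h₀ : h z₀ = 0) (hz : 0 < z.im) : h z = 0 := by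
  have hball : ∀ z, 0 < z.im → h z = 0 → ∀ ζ ∈ Metric.ball z z.im, h ζ = 0 := by
    intro z hz h0 ζ hζ
    rcases eq_or_ne ζ z with rfl | hne
    · exact h0
    · rw [mem_ball_iff_norm] at hζ
      refine eq_zero_of_circleAverage_eq_zero (z := z) (R := ‖ζ - z‖) hc hnonneg ?_ (by simp)
      rw [hmean z _ (norm_pos_iff.2 (sub_ne_zero.2 hne)) hζ.le, h0]
  have hopen : IsOpen {z : ℂ | 0 < z.im ∧ h z = 0} := by
    refine Metric.isOpen_iff.2 fun z ⟨hz, h0⟩ => ⟨z.im, hz, fun ζ hζ => ⟨?_, hball z hz h0 ζ hζ⟩⟩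
    have him := (Complex.abs_im_le_norm (ζ - z)).trans_lt (mem_ball_iff_norm.1 hζ)
    rw [Complex.sub_im] at him
    linarith [(abs_lt.1 him).1]
  have hpre : IsPreconnected {z : ℂ | 0 < z.im} := (convex_halfSpace_im_gt 0).isPreconnected
  exact (hpre.subset_left_of_subset_union hopen (isOpen_ne_fun hc continuous_const)
    (Set.disjoint_left.2 fun z hzero hne => hne hzero.2)
    (fun z hz => (em (h z = 0)).imp (fun h0 => ⟨hz, h0⟩) id) ⟨z₀, hz₀, hz₀, h₀⟩ hz).2

lemma eq_of_isRieszMeasure_of_le (hU : Continuous U) (hV : Continuous V) (hle : ∀ z, V z ≤ U z)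
    {μ ν : Measure ℂ} {L L' : ℝ} (hμ : IsRieszMeasure U μ L) (hν : IsRieszMeasure V ν L')
    (hμ0 : ∀ᵐ w ∂μ, w.im = 0) (hν0 : ∀ᵐ w ∂ν, w.im = 0) {z₀ : ℂ} (hz₀ : 0 < z₀.im)
    (h₀ : U z₀ = V z₀) (hz : 0 < z.im) : U z = V z := by
  refine sub_eq_zero.1 (eq_zero_of_circleAverage_eq_self (h := fun z => U z - V z) (hU.sub hV)
    (fun z => sub_nonneg.2 (hle z)) (fun z R hR hRz => ?_) hz₀ (sub_eq_zero.2 h₀) hz)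
  rw [Real.circleAverage_fun_sub hU.continuousOn.circleIntegrable'
      hV.continuousOn.circleIntegrable',
    hμ.circleAverage_eq_self hU hμ0 hR hRz, hν.circleAverage_eq_self hV hν0 hR hRz]

end RealLine

/-! ### The limiting zero distribution -/

section Limit

variable {Ω : Type*} [MeasurableSpace Ω] {P : Measure Ω} {ξ : ℕ → Ω → ℂ} {a : ℕ → ℕ → ℂ}
  {g : ℝ → ℝ} {t : ℝ}

lemma exists_denseRange_im_ne_zero : ∃ zs : ℕ → ℂ, DenseRange zs ∧ ∀ i, (zs i).im ≠ 0 := by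
  have hd : Dense {z : ℂ | z.im ≠ 0} :=
    (dense_compl_singleton (0 : ℝ)).preimage Complex.isOpenMap_im
  obtain ⟨s, hs, hsc, hsd⟩ := hd.exists_countable_dense_subset
  obtain ⟨zs, rfl⟩ := hsc.exists_eq_range hsd.nonempty
  exact ⟨zs, hsd, fun i => hs ⟨i, rfl⟩⟩

lemma exists_forall_isGood_abs_integral_sub_lt (ha : IsExponentialProfile a g)
    (hg : ContinuousOn g (Set.Icc 0 1)) (ht : 0 < t) {zs : ℕ → ℂ} (hzs : DenseRange zs)
    {ν : ProbabilityMeasure ℂ} {L : ℝ} (hν : IsRieszMeasure (limitPot t g) (ν : Measure ℂ) L)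
    (f : ℂ →ᵇ ℝ) {η : ℝ} (hη : 0 < η) :
    ∃ m, ∀ n, m ≤ n → ∀ x, IsGood a g t zs m n x →
      |∫ z, f z ∂(zeroDistribution (flowPoly a t n x)) - ∫ z, f z ∂(ν : Measure ℂ)| < η := by
  by_contra! hfar
  choose N hN x hx hfar using hfar
  obtain ⟨ν', ⟨L', hν'⟩, hlim⟩ := (hasLogPotential_of_isGood ha hg ht hzs
    (tendsto_atTop_mono hN tendsto_id) hx).exists_tendsto
  rw [hν'.unique hν] at hlim
  obtain ⟨m, hm⟩ := ((hlim f).eventually (Metric.ball_mem_nhds _ hη)).exists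
  exact (hfar m).not_gt hm

variable [IsProbabilityMeasure P]

lemma exists_isRieszMeasure_limitPot (hξ : IsAdmissibleNoise P ξ) (ha : IsExponentialProfile a g)
    (hg : ContinuousOn g (Set.Icc 0 1)) (ht : 0 < t) :
    ∃ ν : ProbabilityMeasure ℂ, ∃ L, IsRieszMeasure (limitPot t g) (ν : Measure ℂ) L := by
  obtain ⟨zs, hzs, him⟩ := exists_denseRange_im_ne_zero
  have hex : ∀ m, ∃ n x, m ≤ n ∧ IsGood a g t zs m n x := by
    intro m
    obtain ⟨n, hn, hmn⟩ := (((hξ.tendsto_measureReal_not_isGood ha hg ht him m).eventually_lt_const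
      one_pos).and (eventually_ge_atTop m)).exists
    by_contra! hbad
    rw [Set.eq_univ_of_forall fun ω => show ω ∈ {ω | ¬ IsGood a g t zs m n fun k => ξ k ω} from
      hbad n _ hmn, probReal_univ] at hn
    exact lt_irrefl _ hn
  choose N x hN hx using hex
  obtain ⟨ν, hν, -⟩ := (hasLogPotential_of_isGood ha hg ht hzs
    (tendsto_atTop_mono hN tendsto_id) hx).exists_tendsto
  exact ⟨ν, hν⟩

theorem isLimitingZeroDistribution_of_isRieszMeasure (hξ : IsAdmissibleNoise P ξ)
    (ha : IsExponentialProfile a g) (hg : ContinuousOn g (Set.Icc 0 1)) (ht : 0 < t)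
    {ν : ProbabilityMeasure ℂ} {L : ℝ} (hν : IsRieszMeasure (limitPot t g) (ν : Measure ℂ) L) :
    IsLimitingZeroDistribution P ξ a t ν := by
  obtain ⟨zs, hzs, him⟩ := exists_denseRange_im_ne_zero
  refine fun f => tendstoInMeasure_iff_measureReal_norm.2 fun η hη => ?_
  obtain ⟨m, hm⟩ := exists_forall_isGood_abs_integral_sub_lt ha hg ht hzs hν f hη
  refine squeeze_zero' (.of_forall fun n => measureReal_nonneg) ?_
    (hξ.tendsto_measureReal_not_isGood ha hg ht him m)
  filter_upwards [eventually_ge_atTop m] with n hn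
  exact measureReal_mono fun ω hω hgood => (hm n hn _ hgood).not_ge hω

lemma IsLimitingZeroDistribution.unique {μ ν : ProbabilityMeasure ℂ}
    (hμ : IsLimitingZeroDistribution P ξ a t μ) (hν : IsLimitingZeroDistribution P ξ a t ν) :
    μ = ν := by
  have h : (μ : Measure ℂ) = ν := ext_of_forall_integral_eq_of_IsFiniteMeasure fun f => by
    obtain ⟨_, hω⟩ := (tendstoInMeasure_ae_unique (hμ f) (hν f)).exists
    exact hω
  exact Subtype.ext h

end Limit

section Collapse

variable {g : ℝ → ℝ} {t L : ℝ} {ν : Measure ℂ}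

lemma isRieszMeasure_const_add_hermitePot (ht : 0 < t) (c : ℝ) :
    ∃ L, IsRieszMeasure (fun z => c + hermitePot t 1 z) (semicircle t) L :=
  ⟨_, (isRieszMeasure_semicircle ht).const_add (continuous_hermitePot ht (by simp)) c⟩

lemma eq_semicircle_of_wignerTime_le (ht : 0 < t) (hg : ContinuousOn g (Set.Icc 0 1))
    (hb : BddAbove (wignerTimeFun g '' Set.Ioo 0 1)) [IsFiniteMeasure ν]
    (hν : IsRieszMeasure (limitPot t g) ν L) (h : wignerTime g ≤ t) : ν = semicircle t := by
  have hsc := isProbabilityMeasure_semicircle ht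
  obtain ⟨L', hL'⟩ := isRieszMeasure_const_add_hermitePot ht (g 1)
  rw [← funext (limitPot_eq_of_wignerTime_le ht hg hb h)] at hL'
  exact hν.unique hL'

lemma pos_of_lt_wignerTime (ht : 0 < t) (hg : ContinuousOn g (Set.Icc 0 1))
    (hd : DifferentiableWithinAt ℝ g (Set.Iio 1) 1) (hν : IsRieszMeasure (limitPot t g) ν L)
    (h : t < wignerTime g) : 0 < ν {z : ℂ | z.im ≠ 0} := by
  refine pos_iff_ne_zero.2 fun h0 => ?_
  obtain ⟨L', hL'⟩ := isRieszMeasure_const_add_hermitePot ht (g 1)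
  obtain ⟨z₀, hz₀, heq⟩ := exists_limitPot_eq_of_im_pos ht hg hd
  obtain ⟨z, hz, hlt⟩ := exists_lt_limitPot_of_lt_wignerTime ht hg h
  exact hlt.ne' (eq_of_isRieszMeasure_of_le (continuous_limitPot ht hg)
    (continuous_const.add (continuous_hermitePot ht (by simp)))
    (fun z => le_limitPot ht hg z (by simp)) hν hL' (ae_iff.2 h0)
    (ae_iff.2 (semicircle_im_ne_zero t)) hz₀ heq hz)

lemma eq_semicircle_iff_wignerTime_le (ht : 0 < t) (hg : ContinuousOn g (Set.Icc 0 1))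
    (hd : DifferentiableWithinAt ℝ g (Set.Iio 1) 1) [IsFiniteMeasure ν]
    (hν : IsRieszMeasure (limitPot t g) ν L) : ν = semicircle t ↔ wignerTime g ≤ t := by
  refine ⟨fun h => ?_, eq_semicircle_of_wignerTime_le ht hg (bddAbove_wignerTimeFun hg hd) hν⟩
  by_contra! hlt
  have hpos := pos_of_lt_wignerTime ht hg hd hν hlt
  rw [h, semicircle_im_ne_zero] at hpos
  exact lt_irrefl _ hpos

end Collapse

end

end HeatZeros

theorem theorem2p10_general {Ω : Type*} [MeasurableSpace Ω] (P : Measure Ω)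
    [IsProbabilityMeasure P] (ξ : ℕ → Ω → ℂ) (a : ℕ → ℕ → ℂ) (g : ℝ → ℝ)
    (hξ : HeatZeros.IsAdmissibleNoise P ξ) (ha : HeatZeros.IsExponentialProfile a g)
    (hg : ContinuousOn g (Set.Icc 0 1)) (hd : DifferentiableWithinAt ℝ g (Set.Iio 1) 1)
    (t : ℝ) (ht : 0 < t) :
    BddAbove (HeatZeros.wignerTimeFun g '' Set.Ioo 0 1) ∧
    ∃ ν : ProbabilityMeasure ℂ,
      (∀ ν' : ProbabilityMeasure ℂ,
        HeatZeros.IsLimitingZeroDistribution P ξ a t ν' ↔ ν' = ν) ∧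
      ((ν : Measure ℂ) = HeatZeros.semicircle t ↔ HeatZeros.wignerTime g ≤ t) ∧
      (t < HeatZeros.wignerTime g → 0 < (ν : Measure ℂ) {z : ℂ | z.im ≠ 0}) := by
  obtain ⟨ν, L, hL⟩ := HeatZeros.exists_isRieszMeasure_limitPot hξ ha hg ht
  have hν := HeatZeros.isLimitingZeroDistribution_of_isRieszMeasure hξ ha hg ht hL
  exact ⟨HeatZeros.bddAbove_wignerTimeFun hg hd, ν,
    fun ν' => ⟨fun h => h.unique hν, fun h => h ▸ hν⟩,
    HeatZeros.eq_semicircle_iff_wignerTime_le ht hg hd hL,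
    HeatZeros.pos_of_lt_wignerTime ht hg hd hL⟩

theorem theorem2p10 {Ω : Type*} [MeasurableSpace Ω] (P : Measure Ω) [IsProbabilityMeasure P]
    (ξ : ℕ → Ω → ℂ) (a : ℕ → ℕ → ℂ) (g : ℝ → ℝ)
    (hξ : HeatZeros.IsAdmissibleNoise P ξ) (ha : HeatZeros.HasExponentialProfile a g)
    (t : ℝ) (ht : 0 < t) :
    BddAbove (HeatZeros.wignerTimeFun g '' Set.Ioo 0 1) ∧
    ∃ ν : ProbabilityMeasure ℂ,
      (∀ ν' : ProbabilityMeasure ℂ,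
        HeatZeros.IsLimitingZeroDistribution P ξ a t ν' ↔ ν' = ν) ∧
      ((ν : Measure ℂ) = HeatZeros.semicircle t ↔ HeatZeros.wignerTime g ≤ t) ∧
      (t < HeatZeros.wignerTime g → 0 < (ν : Measure ℂ) {z : ℂ | z.im ≠ 0}) :=
  theorem2p10_general P ξ a g hξ ha.profile ha.continuousOn ha.leftDeriv_one t ht
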